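/- **Setting.** Let $L\ge 2$, $N\ge 1$, and let $\alpha_1,\dots,\alpha_{L-1},\beta_1,\dots,\beta_N,\gamma_1,\dots,\gamma_{L-1}$ be complex numbers with $$0<\mathrm{Re}\,\alpha_1<\mathrm{Re}\,\gamma_1<\mathrm{Re}\,\alpha_2<\mathrm{Re}\,\gamma_2<\dots<\mathrm{Re}\,\alpha_{L-1}<\mathrm{Re}\,\gamma_{L-1}<1+\sum_{i}\mathrm{Re}\,\beta_i,\qquad \mathrm{Re}\,\beta_i<0\ (1\le i\le N)$$ (this is the condition for the absolute convergence of all the integrals below). Put $\gamma_L=1$, $\zeta_k=\alpha_k-\gamma_{k+1}$, $\eta_k=\gamma_k-\alpha_k$, $\theta_i=-\beta_i$, $a_n=\alpha_n-\gamma_n$, $b_{i,n}=\sum_{j\ne i}\beta_j-\gamma_n$, $t_0=1$, and $$U(t)=\prod_{k=1}^{L-1}t_k^{\zeta_k}(t_{k-1}-t_k)^{\eta_k}\prod_{i=1}^N(1-x_it_{L-1})^{\theta_i},$$ $$\varphi_0=\frac{dt_1\wedge\dots\wedge dt_{L-1}}{\prod_{k=1}^{L-1}(t_{k-1}-t_k)},\qquad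 \varphi^{(i)}_n=\frac{dt_1\wedge\dots\wedge dt_{L-1}}{(x_it_{L-1}-1)\prod_{1\le k\le L-1,\,k\ne n}(t_{k-1}-t_k)}\qquad(1\le i\le N,\ 1\le n\le L-1).$$ *The system.* ${\cal P}_{L,N}$ is the linear Pfaffian system, of rank $N(L-1)+1$, $$d\boldsymbol y=\Big\{\sum_{i}\big(E_i\,d\log x_i+F_i\,d\log(1-x_i)\big)+\sum_{i<j}G_{ij}\,d\log(x_i-x_j)\Big\}\boldsymbol y ,$$ for $\boldsymbol y={}^{\rm T}(y_0,y^{(1)}_1,\dots,y^{(1)}_{L-1},\dots,y^{(N)}_1,\dots,y^{(N)}_{L-1})$, where the matrices act by the following formulas (all components not mentioned are $0$): $$(E_i\boldsymbol y)^{(i)}_n=a_n\Big(y_0+\sum_{m<n}y^{(i)}_m\Big)+b_{i,n}y^{(i)}_n-\sum_{j\ne i}\beta_jy^{(j)}_n,$$ $$(F_i\boldsymbol y)_0=-\beta_i\Big(y_0+\sum_{m}y^{(i)}_m\Big),\qquad (F_i\boldsymbol y)^{(i)}_n=-a_n\Big(y_0+\sum_{m}y^{(i)}_m\Big),$$ $$(G_{ij}\boldsymbol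 y)^{(i)}_n=\beta_j\big(y^{(j)}_n-y^{(i)}_n\big),\qquad (G_{ij}\boldsymbol y)^{(j)}_n=\beta_i\big(y^{(i)}_n-y^{(j)}_n\big).$$ *The domains of integration.* Let $\Delta_0=\{0\le\tau_{L-1}\le\dots\le\tau_1\le\tau_0\}$, which in the coordinates $t_k=\tau_k/\tau_0$ is the simplex $\{0\le t_{L-1}\le\dots\le t_1\le1\}$. Let $\pi_j$ be the cyclic substitution $\tau_k\mapsto\tau_{k+1}$ $(0\le k\le L-2)$, $\tau_{L-1}\mapsto\tau_0/x_j$, and let $\Delta^{(j)}_n=\pi_j^n(\Delta_0)=\{0\le\tau_{L-1+n}\le\dots\le\tau_{n}\}$, where $\tau_{k+L}=\tau_k/x_j$, for $1\le j\le N$, $1\le n\le L-1$. It is parametrized, and oriented, by $\Delta_0$ through $\pi_j^n$. *The region.* For $x\in\mathbb C^N$ let $[0,x_j]\subset\mathbb C$ be the closed line segment, and let $$\mathcal D_0=\{x: x_i\notin[1,\infty)\text{ for all }i\},\qquad \mathcal D^{(j)}=\{x: x_j\notin[1,\infty),\ x_i\notin[0,x_j]\text{ for all }i\ne j\}.$$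 Thus $\mathcal D_0\supset\{|x_1|<1,\dots,|x_N|<1\}$ and $\mathcal D^{(j)}\supset\{|x_j|<1,\ |x_j|<|x_i|\text{ for all }i\neq j\}$. Let $\Omega$ be a non-empty connected open subset of $\{x: x_1\cdots x_N\ne0\}\cap\bigcap_{j}\mathcal D^{(j)}$. Choose, over each of the domains $\Delta_0$, $\Delta^{(j)}_n$, any branch of $U$ for $x\in\Omega$ and $t$ in the interior of the domain (given by continuous determinations of the logarithms of all the factors of $U$), and choose any branches of $\log x_1,\dots,\log x_N$ on $\Omega$; they define the powers of $x_i$ below. **Theorem.** All the integrals $\int_{\Delta}U\varphi$ with $\varphi\in\{\varphi_0,\varphi^{(i)}_m\}$ and $\Delta\in\{\Delta_0,\Delta^{(j)}_n\}$ converge absolutely for $x\in\Omega$. The $(N(L-1)+1)\times(N(L-1)+1)$ matrix $Y(x)$ of these integrals, with rows indexed by the forms and columns by the domains, is a fundamental system of solutions of ${\cal P}_{L,N}$ on $\Omega$: its columns are holomorphic solutions, and $\det Y(x)\neq0$ for every $x\in\Omega$. It has the following local behaviour. 1. There is a vector-valued function, holomorphic on $\mathcal D_0$ and with all components nonzero at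 $x=0$, that coincides on $\Omega$ with the $0$-th column $\big(\int_{\Delta_0}U\varphi\big)_\varphi$. 2. For all $1\le j\le N$ and $1\le n\le L-1$, there are holomorphic functions $R_0$ and $R^{(i)}_m$ $(1\le i\le N,\ 1\le m\le L-1)$ on $\mathcal D^{(j)}$ such that on $\Omega$ $$\int_{\Delta_n^{(j)}}U\varphi_0=x_j^{b_{j,n}+1}\,\rho_j\,R_0,\qquad \int_{\Delta_n^{(j)}}U\varphi^{(j)}_m=\begin{cases}x_j^{b_{j,n}+1}\,\rho_j\,R^{(j)}_m&(m<n)\\ x_j^{b_{j,n}}\,\rho_j\,R^{(j)}_m&(m\ge n),\end{cases}$$ $$\int_{\Delta_n^{(j)}}U\varphi^{(i)}_m=\begin{cases}x_j^{b_{j,n}+2}\,\rho_j\,R^{(i)}_m&(m<n)\\ x_j^{b_{j,n}+1}\,\rho_j\,R^{(i)}_m&(m\ge n)\end{cases}\quad(i\ne j),\qquad\text{where }\rho_j=\prod_{i\ne j}x_i^{-\beta_i},$$ and for $m\ge n$ the restriction of $R^{(j)}_m$ to $\mathcal D^{(j)}\cap\{x_j=0\}$ is not identically zero. -/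

import Mathlib

namespace HGPfaff

/-- Parameters `(α, β, γ)` of the hypergeometric function `F_{L,N}` with `L = d + 1`.
Indices are zero-based: `α k`, `γ k` are `α_{k+1}`, `γ_{k+1}`, and `β i` is `β_{i+1}`. -/
structure Params (d N : ℕ) where
  α : Fin d → ℂ
  β : Fin N → ℂ
  γ : Fin d → ℂ

/-- The row and column index set, of cardinality `N (L - 1) + 1`: `none` is the index `0`, and
`some (i, n)` is the `n`-th place (zero-based) of the `i`-th block. -/
abbrev Idx (d N : ℕ) : Type := Option (Fin N × Fin d)

namespace Params

variable {d N : ℕ} (p : Params d N)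

/-- `ζ_k = α_k - γ_{k+1}`, where `γ_L = 1`. -/
noncomputable def ζ (k : Fin d) : ℂ :=
  p.α k - (Fin.snoc p.γ 1 : Fin (d + 1) → ℂ) k.succ

/-- `η_k = γ_k - α_k`. -/
noncomputable def η (k : Fin d) : ℂ := p.γ k - p.α k

/-- `θ_i = - β_i`. -/
noncomputable def θ (i : Fin N) : ℂ := -p.β i

/-- `a_n = α_n - γ_n`. -/
noncomputable def a (n : Fin d) : ℂ := p.α n - p.γ n

/-- `b_{i,n} = ∑_{j ≠ i} β_j - γ_n`. -/
noncomputable def b (i : Fin N) (n : Fin d) : ℂ :=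
  (∑ j ∈ Finset.univ.erase i, p.β j) - p.γ n

/-- The range of parameters in which all the integrals converge absolutely:
`0 < Re α_1 < Re γ_1 < Re α_2 < ⋯ < Re α_{L-1} < Re γ_{L-1} < 1 + ∑ Re β_i` and `Re β_i < 0`. -/
structure Convergent : Prop where
  α_pos : ∀ k, 0 < (p.α k).re
  α_lt_γ : ∀ k, (p.α k).re < (p.γ k).re
  γ_lt_α : ∀ n k, n < k → (p.γ n).re < (p.α k).re
  γ_lt : ∀ n, (p.γ n).re < 1 + ∑ i, (p.β i).re
  β_neg : ∀ i, (p.β i).re < 0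

end Params

section Pfaffian

variable {d N : ℕ} (p : Params d N)

/-- The residue matrix `E_i` along `x_i = 0`. -/
noncomputable def matE (i : Fin N) : Matrix (Idx d N) (Idx d N) ℂ :=
  Matrix.of fun r c =>
    match r, c with
    | none, _ => 0
    | some (i', n), none => if i' = i then p.a n else 0
    | some (i', n), some (j, m) =>
        if i' = i then
          if j = i then
            if m < n then p.a n else if m = n then p.b i n else 0
          else if m = n then -p.β j else 0
        else 0

/-- The residue matrix `F_i` along `x_i = 1`. -/
noncomputable def matF (i : Fin N) : Matrix (Idx d N) (Idx d N) ℂ :=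
  Matrix.of fun r c =>
    let entry : ℂ :=
      match r with
      | none => -p.β i
      | some (i', n) => if i' = i then -p.a n else 0
    match c with
    | none => entry
    | some (j, _) => if j = i then entry else 0

/-- The residue matrix `G_{ij}` along `x_i = x_j`. -/
noncomputable def matG (i j : Fin N) : Matrix (Idx d N) (Idx d N) ℂ :=
  Matrix.of fun r c =>
    match r, c with
    | some (k, n), some (l, m) =>
        if n = m then
          if k = i ∧ l = i then -p.β j
          else if k = i ∧ l = j then p.β j
          else if k = j ∧ l = i then p.β i
          else if k = j ∧ l = j then -p.β i
          else 0
        else 0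
    | _, _ => 0

/-- The matrix-valued one-form
`∑_i (E_i dlog x_i + F_i dlog (1 - x_i)) + ∑_{i<j} G_{ij} dlog (x_i - x_j)`
at the point `x`, evaluated on the tangent vector `v`. -/
noncomputable def pfaffForm (x v : Fin N → ℂ) : Matrix (Idx d N) (Idx d N) ℂ :=
  ∑ i, ((v i / x i) • matE p i + (-v i / (1 - x i)) • matF p i)
    + ∑ i, ∑ j, if i < j then ((v i - v j) / (x i - x j)) • matG p i j else 0

/-- `y` is a (holomorphic) solution on `Ω` of the linear Pfaffian system `P_{L,N}`. -/
def IsSolution (Ω : Set (Fin N → ℂ)) (y : (Fin N → ℂ) → Idx d N → ℂ) : Prop :=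
  ∀ x ∈ Ω, DifferentiableAt ℂ y x ∧ ∀ v, fderiv ℂ y x v = (pfaffForm p x v).mulVec (y x)

/-- A fundamental system of solutions: the columns are solutions, and the matrix is
invertible at every point. -/
def IsFundamentalSystem (Ω : Set (Fin N → ℂ))
    (Y : (Fin N → ℂ) → Matrix (Idx d N) (Idx d N) ℂ) : Prop :=
  (∀ c, IsSolution p Ω (fun x r => Y x r c)) ∧ ∀ x ∈ Ω, (Y x).det ≠ 0

end Pfaffian

section Integrals

variable {d N : ℕ}

/-- The vector `(1, t_1, …, t_{L-1})`, i.e. `τ` with `τ_0 = 1`. -/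
def homog {R : Type*} [One R] (t : Fin d → R) : Fin (d + 1) → R := Fin.cons 1 t

/-- The affine coordinates `t_k = τ_k / τ_0`. -/
noncomputable def dehomog (τ : Fin (d + 1) → ℂ) : Fin d → ℂ := fun k => τ k.succ / τ 0

/-- The (open) standard simplex `Δ_0 = {0 < t_{L-1} < ⋯ < t_1 < 1}`; it differs from the closed
one by a null set. -/
def simplex (d : ℕ) : Set (Fin d → ℝ) :=
  {u | (∀ k : Fin d, homog u k.succ < homog u k.castSucc) ∧ 0 < homog u (Fin.last d)}

/-- The cyclic transformation `(τ_0, …, τ_{L-1}) ↦ (τ_1, …, τ_{L-1}, τ_0 / ξ)`, where `ξ = x_i`. -/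
noncomputable def cyc (ξ : ℂ) (τ : Fin (d + 1) → ℂ) : Fin (d + 1) → ℂ :=
  Fin.snoc (Fin.tail τ) (τ 0 / ξ)

/-- The inverse `(τ_0, …, τ_{L-1}) ↦ (ξ τ_{L-1}, τ_0, …, τ_{L-2})` of `cyc ξ`. -/
noncomputable def cycInv (ξ : ℂ) (τ : Fin (d + 1) → ℂ) : Fin (d + 1) → ℂ :=
  Fin.cons (ξ * τ (Fin.last d)) (Fin.init τ)

theorem cyc_cycInv {ξ : ℂ} (hξ : ξ ≠ 0) (τ : Fin (d + 1) → ℂ) : cyc ξ (cycInv ξ τ) = τ := by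
  simp [cyc, cycInv, Fin.tail_cons, mul_div_cancel_left₀ _ hξ]

theorem cycInv_cyc {ξ : ℂ} (hξ : ξ ≠ 0) (τ : Fin (d + 1) → ℂ) : cycInv ξ (cyc ξ τ) = τ := by
  simp [cyc, cycInv, Fin.init_snoc, mul_div_cancel₀ _ hξ]

/-- The parametrization by `Δ_0` of the domains of integration. The index `none` gives `Δ_0`
itself. The index `some (j, n)` gives `Δ_{n+1}^{(j)} = π_j^{n+1}(Δ_0)`, which is
`{0 ≤ τ_{L+n} ≤ ⋯ ≤ τ_{n+1}}` with `τ_{k+L} = τ_k / x_j`, i.e. the set of those `τ` whose image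
under the `(n+1)`-st power of `cyc (x j)` lies in `Δ_0`. -/
noncomputable def chain (c : Idx d N) (x : Fin N → ℂ) (u : Fin d → ℝ) : Fin d → ℂ :=
  match c with
  | none => fun k => (u k : ℂ)
  | some (j, n) => dehomog ((cycInv (x j))^[(n : ℕ) + 1] (homog fun k => (u k : ℂ)))

/-- The Jacobian determinant `∂(t_1, …, t_{L-1}) / ∂(u_1, …, u_{L-1})` of a parametrization. -/
noncomputable def jacobian (T : (Fin d → ℝ) → Fin d → ℂ) (u : Fin d → ℝ) : ℂ :=
  (Matrix.of fun k l : Fin d => fderiv ℝ T u (Pi.single l 1) k).det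

/-- The difference `t_{k-1} - t_k`, where `t_0 = 1`. -/
def gap (t : Fin d → ℂ) (k : Fin d) : ℂ := homog t k.castSucc - homog t k.succ

/-- The last coordinate `t_{L-1}`. -/
def lastCoord (t : Fin d → ℂ) : ℂ := homog t (Fin.last d)

/-- The coefficient of `dt_1 ∧ ⋯ ∧ dt_{L-1}` in `φ_0` (index `none`) and in `φ_n^{(i)}`. -/
noncomputable def formCoeff (r : Idx d N) (x : Fin N → ℂ) (t : Fin d → ℂ) : ℂ :=
  match r with
  | none => 1 / ∏ k, gap t k
  | some (i, n) => 1 / ((x i * lastCoord t - 1) * ∏ k ∈ Finset.univ.erase n, gap t k)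

/-- `W` is a branch, over the domain of integration with index `c` and for `x ∈ Ω`, of the
multi-valued function
`U(t) = ∏_k t_k ^ ζ_k (t_{k-1} - t_k) ^ η_k ∏_i (1 - x_i t_{L-1}) ^ θ_i`:
it is obtained from continuous determinations of the logarithms of all the factors. -/
def IsBranchOfU (p : Params d N) (Ω : Set (Fin N → ℂ)) (c : Idx d N)
    (W : (Fin N → ℂ) → (Fin d → ℝ) → ℂ) : Prop :=
  ∃ (A B : Fin d → (Fin N → ℂ) × (Fin d → ℝ) → ℂ) (C : Fin N → (Fin N → ℂ) × (Fin d → ℝ) → ℂ),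
    (∀ k, ContinuousOn (A k) (Ω ×ˢ simplex d)) ∧
    (∀ k, ContinuousOn (B k) (Ω ×ˢ simplex d)) ∧
    (∀ i, ContinuousOn (C i) (Ω ×ˢ simplex d)) ∧
    ∀ x ∈ Ω, ∀ u ∈ simplex d,
      (∀ k, Complex.exp (A k (x, u)) = chain c x u k) ∧
      (∀ k, Complex.exp (B k (x, u)) = gap (chain c x u) k) ∧
      (∀ i, Complex.exp (C i (x, u)) = 1 - x i * lastCoord (chain c x u)) ∧
      W x u = Complex.exp
        (∑ k, (p.ζ k * A k (x, u) + p.η k * B k (x, u)) + ∑ i, p.θ i * C i (x, u))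

/-- The pull-back to `Δ_0` of the form `U φ` with row index `r`, on the domain with index `c`. -/
noncomputable def integrand (W : (Fin N → ℂ) → (Fin d → ℝ) → ℂ) (r c : Idx d N)
    (x : Fin N → ℂ) (u : Fin d → ℝ) : ℂ :=
  W x u * formCoeff r x (chain c x u) * jacobian (chain c x) u

/-- The matrix of integrals `∫_{Δ_n^{(j)}} U φ_m^{(i)}`, where `W c` is the branch of `U` used on
the domain with index `c`. -/
noncomputable def periodMatrix (W : Idx d N → (Fin N → ℂ) → (Fin d → ℝ) → ℂ)
    (x : Fin N → ℂ) : Matrix (Idx d N) (Idx d N) ℂ :=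
  Matrix.of fun r c => ∫ u in simplex d, integrand (W c) r c x u

end Integrals

section LocalBehaviour

variable {d N : ℕ}

/-- `x_i ∉ [1, ∞)` for all `i`; this contains the unit polydisc. -/
def domain0 (N : ℕ) : Set (Fin N → ℂ) := {x | ∀ i, (1 : ℂ) ∉ segment ℝ 0 (x i)}

/-- `x_j ∉ [1, ∞)`, and `x_i` is not on the segment `[0, x_j]` for `i ≠ j`. This contains the
points with `|x_j| < 1` and `|x_j| < |x_i|` for all `i ≠ j`. -/
def domainAt (j : Fin N) : Set (Fin N → ℂ) :=
  {x | (1 : ℂ) ∉ segment ℝ 0 (x j) ∧ ∀ i, i ≠ j → x i ∉ segment ℝ 0 (x j)}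

/-- The points with `x_j ≠ 0` that are in `domainAt j`, for all `j`: there all the domains of
integration avoid the singular locus of `U`. -/
def slitDomain (N : ℕ) : Set (Fin N → ℂ) := {x | ∀ j, x j ≠ 0 ∧ x ∈ domainAt j}

/-- `lam` consists of branches of `log x_1, …, log x_N` on `Ω`. -/
def IsLogBranch (Ω : Set (Fin N → ℂ)) (lam : Fin N → (Fin N → ℂ) → ℂ) : Prop :=
  ∀ i, ContinuousOn (lam i) Ω ∧ ∀ x ∈ Ω, Complex.exp (lam i x) = x i

/-- The power of `x_j` that is split off, beyond `x_j ^ b_{j,n}`, in the entry with row index `r`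
of the column `(j, n)`. -/
def extraOrder (j : Fin N) (n : Fin d) (r : Idx d N) : ℕ :=
  match r with
  | none => 1
  | some (i, m) => (if i = j then 0 else 1) + (if m < n then 1 else 0)

/-- The local behaviour `Y(x) = Φ(x) diag(1, …, x_j ^ b_{j,n}, …)`. The `0`-th column of `Φ` is
holomorphic at the origin and has no zero entry there. In the column `(j, n)`, apart from the
multi-valued factor `∏_{i ≠ j} x_i ^ (-β_i)`, the entries are holomorphic near the generic point of
`x_j = 0`, divisible there by the powers of `x_j` given by `extraOrder`, and those on or below
the diagonal of the `j`-th diagonal block do not vanish identically on `x_j = 0`. -/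
def HasLocalBehaviour (p : Params d N) (Ω : Set (Fin N → ℂ)) (lam : Fin N → (Fin N → ℂ) → ℂ)
    (Y : (Fin N → ℂ) → Matrix (Idx d N) (Idx d N) ℂ) : Prop :=
  (∃ Φ : (Fin N → ℂ) → Idx d N → ℂ,
    DifferentiableOn ℂ Φ (domain0 N) ∧ (∀ r, Φ 0 r ≠ 0) ∧
    ∀ x ∈ Ω, ∀ r, Y x r none = Φ x r) ∧
  ∀ (j : Fin N) (n : Fin d), ∃ R : (Fin N → ℂ) → Idx d N → ℂ,
    DifferentiableOn ℂ R (domainAt j) ∧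
    (∀ x ∈ Ω, ∀ r, Y x r (some (j, n)) =
      Complex.exp (p.b j n * lam j x)
        * (∏ i ∈ Finset.univ.erase j, Complex.exp (-p.β i * lam i x))
        * (x j ^ extraOrder j n r * R x r)) ∧
    ∀ m, n ≤ m → ∃ x ∈ domainAt j, x j = 0 ∧ R x (some (j, m)) ≠ 0

end LocalBehaviour

end HGPfaff

open HGPfaff

/-!
The idea is to pull every period back to the unit cube. On the chain `c` let `σ_k = t_k / t_{k-1}`
be the ratios of consecutive coordinates. On `Δ_0` these are the cube coordinates `w_k` themselves;
the cyclic substitution permutes the ratios cyclically, so on the chain with index `(j, n)` they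
are, after a permutation of the cube coordinates, `σ_k = w_k` for `k ≠ n` and `σ_n = 1 / (x_j ∏ w)`
(`homog_chain`). In these coordinates each period becomes a constant, times a monomial in the `x_i`,
times an integral
`∫ ∏_k w_k ^ A_k (1 - w_k) ^ B_k ∏_i (1 - z_i v_i) ^ c_i`
with principal powers, where each `v_i` is a monomial in `w`, and `z_i = x_i` in the column `0`,
`z_j = x_j` and `z_i = x_j / x_i` in the columns `(j, n)` (`exists_periods_eq`). A branch of `U`
contributes only a constant, because two continuous logarithms on a connected set differ by a
constant. All `A_k` and `B_k` have real part `> -1`, so these integrals converge absolutely and are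
holomorphic in `z` as long as no `z_i` lies on `[1, ∞)`; at `z = 0` they are products of beta
integrals, hence nonzero. This gives the convergence and the local behaviour.

The forms satisfy `φ_r / φ_0 = formRatio`, a rational function of `σ`, and therefore the Pfaffian
system follows from two kinds of relations between the periods (`pfaffForm_mulVec_integral`): the
action of `x_l ∂/∂x_l` on a form without a pole along `x_l t_{L-1} = 1`, and the action of the Euler
operator `∑_l x_l ∂/∂x_l` on a form with a pole. Both reduce to integrations by parts on the
cube (`integral_colKernel_mul_colLogDeriv`, `sum_integral_colKernel_mul_colLogDeriv`).

The non-vanishing of the determinant is proved by induction on `N` (`det_normalizedMatrix_ne_zero`).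
The region is stable under `x_0 ↦ s x_0` for `0 < s ≤ 1`. As `s → 0`, the matrix of periods, with
its rows and columns suitably rescaled, tends to a block triangular matrix whose diagonal blocks are
a triangular matrix with beta integrals on the diagonal and the matrix of periods in the other
variables (`eventually_det_scaledMatrix_ne_zero`). So the determinant does not vanish for small `s`;
as the columns solve a linear differential equation along the segment, it does not vanish at `s = 1`
either.
-/

namespace HGPfaff

open MeasureTheory Set Filter Topology

/-! ### Euler kernels on the unit cube -/

section Kernel

variable {d N : ℕ}

/-- The open unit cube, which parametrizes the simplex by the ratios of consecutive coordinates. -/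
def cube (d : ℕ) : Set (Fin d → ℝ) := univ.pi fun _ => Ioo 0 1

theorem mem_cube {w : Fin d → ℝ} : w ∈ cube d ↔ ∀ k, 0 < w k ∧ w k < 1 := by
  simp [cube, Set.mem_pi]

theorem measurableSet_cube : MeasurableSet (cube d) :=
  MeasurableSet.univ_pi fun _ => measurableSet_Ioo

theorem restrict_cube : (volume : Measure (Fin d → ℝ)).restrict (cube d) =
    Measure.pi fun _ : Fin d => (volume : Measure ℝ).restrict (Ioo 0 1) := by
  rw [cube, volume_pi, Measure.restrict_pi_pi]

theorem cube_subset_Icc : cube d ⊆ Icc 0 1 := fun _ hw =>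
  ⟨fun k => (mem_cube.1 hw k).1.le, fun k => (mem_cube.1 hw k).2.le⟩

theorem ofReal_ne_zero_of_mem {w : Fin d → ℝ} (hw : w ∈ cube d) (k : Fin d) : (w k : ℂ) ≠ 0 :=
  Complex.ofReal_ne_zero.2 (mem_cube.1 hw k).1.ne'

theorem one_sub_ofReal_ne_zero_of_mem {w : Fin d → ℝ} (hw : w ∈ cube d) (k : Fin d) :
    1 - (w k : ℂ) ≠ 0 := by
  have : (1 : ℝ) - w k ≠ 0 := (sub_pos.2 (mem_cube.1 hw k).2).ne'
  exact_mod_cast this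

/-- The multi-dimensional Beta density `∏ w_k ^ A_k (1 - w_k) ^ B_k`. -/
noncomputable def betaDensity (A B : Fin d → ℂ) (w : Fin d → ℝ) : ℂ :=
  ∏ k, ((w k : ℂ) ^ A k * (1 - (w k : ℂ)) ^ B k)

/-- The product `∏_i (1 - z_i v_i) ^ c_i`, with principal powers. -/
noncomputable def binomProd (c z : Fin N → ℂ) (v : Fin N → ℝ) : ℂ :=
  ∏ i, (1 - z i * (v i : ℂ)) ^ c i

/-- The monomials `∏_{k ∈ T_i} w_k`. -/
def cubeMonomial (T : Fin N → Finset (Fin d)) (w : Fin d → ℝ) (i : Fin N) : ℝ := ∏ k ∈ T i, w k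

/-- The integrand of a generalized Euler integral on the unit cube. -/
noncomputable def eulerKernel (A B : Fin d → ℂ) (c : Fin N → ℂ) (T : Fin N → Finset (Fin d))
    (z : Fin N → ℂ) (w : Fin d → ℝ) : ℂ :=
  betaDensity A B w * binomProd c z (cubeMonomial T w)

/-- The generalized Euler integral on the unit cube. -/
noncomputable def eulerIntegral (A B : Fin d → ℂ) (c : Fin N → ℂ) (T : Fin N → Finset (Fin d))
    (z : Fin N → ℂ) : ℂ :=
  ∫ w in cube d, eulerKernel A B c T z w

theorem integrableOn_Ioo_beta {a b : ℂ} (ha : -1 < a.re) (hb : -1 < b.re) :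
    IntegrableOn (fun s : ℝ => (s : ℂ) ^ a * (1 - (s : ℂ)) ^ b) (Ioo 0 1) := by
  have h := Complex.betaIntegral_convergent (u := a + 1) (v := b + 1)
    (by simp; linarith) (by simp; linarith)
  rw [intervalIntegrable_iff_integrableOn_Ioo_of_le zero_le_one] at h
  simpa using h

theorem integral_Ioo_beta_ne_zero {a b : ℂ} (ha : -1 < a.re) (hb : -1 < b.re) :
    ∫ s in Ioo (0 : ℝ) 1, (s : ℂ) ^ a * (1 - (s : ℂ)) ^ b ≠ 0 := by
  have ha' : 0 < (a + 1).re := by simp; linarith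
  have hb' : 0 < (b + 1).re := by simp; linarith
  have h := Complex.Gamma_mul_Gamma_eq_betaIntegral ha' hb'
  have h2 : (a + 1).betaIntegral (b + 1) ≠ 0 := by
    intro h0
    rw [h0, mul_zero] at h
    exact mul_ne_zero (Complex.Gamma_ne_zero_of_re_pos ha') (Complex.Gamma_ne_zero_of_re_pos hb') h
  rw [Complex.betaIntegral, intervalIntegral.integral_of_le zero_le_one,
    integral_Ioc_eq_integral_Ioo] at h2
  simpa using h2

theorem integrableOn_betaDensity {A B : Fin d → ℂ} (hA : ∀ k, -1 < (A k).re)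
    (hB : ∀ k, -1 < (B k).re) : IntegrableOn (betaDensity A B) (cube d) := by
  rw [IntegrableOn, restrict_cube]
  exact Integrable.fintype_prod (f := fun k (s : ℝ) => (s : ℂ) ^ A k * (1 - (s : ℂ)) ^ B k)
    fun k => integrableOn_Ioo_beta (hA k) (hB k)

theorem integral_betaDensity_ne_zero {A B : Fin d → ℂ} (hA : ∀ k, -1 < (A k).re)
    (hB : ∀ k, -1 < (B k).re) : ∫ w in cube d, betaDensity A B w ≠ 0 := by
  rw [restrict_cube]
  have := integral_fintype_prod_eq_prod
    (μ := fun _ : Fin d => (volume : Measure ℝ).restrict (Ioo 0 1))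
    (fun k (s : ℝ) => (s : ℂ) ^ A k * (1 - (s : ℂ)) ^ B k)
  simp only [betaDensity]
  rw [this]
  exact Finset.prod_ne_zero_iff.2 fun k _ => integral_Ioo_beta_ne_zero (hA k) (hB k)

/-- The principal branch of `log (1 - z)` is available exactly off `[1, ∞)`, in the form used in
`domain0`. -/
theorem one_sub_mem_slitPlane_iff {z : ℂ} :
    1 - z ∈ Complex.slitPlane ↔ (1 : ℂ) ∉ segment ℝ 0 z := by
  rw [segment_eq_image, Complex.mem_slitPlane_iff]
  simp only [mem_image, mem_Icc, smul_zero, zero_add, not_exists, not_and, and_imp,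
    Complex.real_smul, Complex.sub_re, Complex.one_re, Complex.sub_im, Complex.one_im]
  constructor
  · intro h s hs0 hs1 hs
    have hre : s * z.re = 1 := by simpa using congrArg Complex.re hs
    have him : s * z.im = 0 := by simpa using congrArg Complex.im hs
    have hs' : s ≠ 0 := by rintro rfl; simp at hre
    rcases h with h | h
    · nlinarith [hs0.lt_of_ne' hs']
    · exact h (by simpa [hs'] using him)
  · intro h
    by_contra! hc
    obtain ⟨h1, h2⟩ := hc
    have hz : 1 ≤ z.re := by linarith
    refine h (1 / z.re) (by positivity) ((div_le_one (by linarith)).2 hz) ?_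
    apply Complex.ext
    · rw [Complex.re_ofReal_mul]; simp; field_simp
    · rw [Complex.im_ofReal_mul]; simp; right; linarith

theorem one_sub_mul_mem_slitPlane {z : ℂ} (hz : (1 : ℂ) ∉ segment ℝ 0 z) {s : ℝ} (h0 : 0 ≤ s)
    (h1 : s ≤ 1) : 1 - z * s ∈ Complex.slitPlane := by
  rw [one_sub_mem_slitPlane_iff, segment_eq_image] at *
  rintro ⟨r, hr, h⟩
  refine hz ⟨r * s, ⟨mul_nonneg hr.1 h0, mul_le_one₀ hr.2 h0 h1⟩, ?_⟩
  rw [← h]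
  simp
  ring

theorem isOpen_domain0 : IsOpen (domain0 N) := by
  simp only [domain0, ← one_sub_mem_slitPlane_iff, ofPred_forall]
  exact isOpen_iInter_of_finite fun i => Complex.isOpen_slitPlane.preimage (by fun_prop)

theorem one_sub_mul_mem_slitPlane' {z : Fin N → ℂ} (hz : z ∈ domain0 N) {v : Fin N → ℝ}
    (hv : v ∈ Icc (0 : Fin N → ℝ) 1) (i : Fin N) : 1 - z i * v i ∈ Complex.slitPlane :=
  one_sub_mul_mem_slitPlane (hz i) (hv.1 i) (hv.2 i)

theorem one_sub_mul_ne_zero {z : Fin N → ℂ} (hz : z ∈ domain0 N) {v : Fin N → ℝ}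
    (hv : v ∈ Icc (0 : Fin N → ℝ) 1) (i : Fin N) : 1 - z i * (v i : ℂ) ≠ 0 :=
  Complex.slitPlane_ne_zero (one_sub_mul_mem_slitPlane' hz hv i)

theorem continuousOn_binomProd (c : Fin N → ℂ) :
    ContinuousOn (fun q : (Fin N → ℂ) × (Fin N → ℝ) => binomProd c q.1 q.2)
      (domain0 N ×ˢ Icc 0 1) := by
  unfold binomProd
  refine continuousOn_finsetProd _ fun i _ => ?_
  refine ContinuousOn.cpow (by fun_prop) (by fun_prop) fun q hq => ?_
  exact one_sub_mul_mem_slitPlane' hq.1 hq.2 i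

/-- The differential of `binomProd` with respect to `z`. -/
noncomputable def binomDeriv (c z : Fin N → ℂ) (v : Fin N → ℝ) : (Fin N → ℂ) →L[ℂ] ℂ :=
  ∑ i, (binomProd c z v * (-(c i * v i) / (1 - z i * v i))) •
    (ContinuousLinearMap.proj i : (Fin N → ℂ) →L[ℂ] ℂ)

theorem continuousOn_binomDeriv (c : Fin N → ℂ) :
    ContinuousOn (fun q : (Fin N → ℂ) × (Fin N → ℝ) => binomDeriv c q.1 q.2)
      (domain0 N ×ˢ Icc 0 1) := by
  unfold binomDeriv
  refine continuousOn_finsetSum _ fun i _ => ?_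
  refine ContinuousOn.smul ((continuousOn_binomProd c).mul ?_) continuousOn_const
  refine ContinuousOn.div (by fun_prop) (by fun_prop) fun q hq => one_sub_mul_ne_zero hq.1 hq.2 i

theorem hasFDerivAt_binomProd (c : Fin N → ℂ) {z : Fin N → ℂ} {v : Fin N → ℝ}
    (hz : z ∈ domain0 N) (hv : v ∈ Icc (0 : Fin N → ℝ) 1) :
    HasFDerivAt (fun z => binomProd c z v) (binomDeriv c z v) z := by
  have h1 : ∀ i ∈ Finset.univ, HasFDerivAt (fun z : Fin N → ℂ => (1 - z i * (v i : ℂ)) ^ c i)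
      ((binomProd c z v * (-(c i * v i) / (1 - z i * v i)) / ∏ j ∈ Finset.univ.erase i,
        (1 - z j * (v j : ℂ)) ^ c j) •
        (ContinuousLinearMap.proj i : (Fin N → ℂ) →L[ℂ] ℂ)) z := by
    intro i _
    have hs := one_sub_mul_mem_slitPlane' hz hv i
    have hl : HasFDerivAt (fun z : Fin N → ℂ => 1 - z i * (v i : ℂ))
        (-(v i : ℂ) • (ContinuousLinearMap.proj i : (Fin N → ℂ) →L[ℂ] ℂ)) z := by
      have := ((ContinuousLinearMap.proj (R := ℂ) (φ := fun _ : Fin N => ℂ) i).hasFDerivAt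
        (x := z)).mul_const (v i : ℂ) |>.const_sub 1
      exact this.congr_fderiv (neg_smul _ _).symm
    have := ((hasDerivAt_id (1 - z i * (v i : ℂ))).cpow_const (c := c i) hs).comp_hasFDerivAt z hl
    refine this.congr_fderiv ?_
    have hne := one_sub_mul_ne_zero hz hv i
    have hprod : ∏ j ∈ Finset.univ.erase i, (1 - z j * (v j : ℂ)) ^ c j ≠ 0 :=
      Finset.prod_ne_zero_iff.2 fun j _ => by
        simp [Complex.cpow_eq_zero_iff, one_sub_mul_ne_zero hz hv j]
    have hb : binomProd c z v = (1 - z i * (v i : ℂ)) ^ c i *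
        ∏ j ∈ Finset.univ.erase i, (1 - z j * (v j : ℂ)) ^ c j :=
      (Finset.mul_prod_erase _ _ (Finset.mem_univ i)).symm
    rw [hb, id, Complex.cpow_sub _ _ hne, Complex.cpow_one, smul_smul]
    congr 1
    field_simp
  have h2 := HasFDerivAt.finsetProd h1
  refine h2.congr_fderiv ?_
  unfold binomDeriv
  refine Finset.sum_congr rfl fun i _ => ?_
  have hprod : ∏ j ∈ Finset.univ.erase i, (1 - z j * (v j : ℂ)) ^ c j ≠ 0 :=
    Finset.prod_ne_zero_iff.2 fun j _ => by
      simp [Complex.cpow_eq_zero_iff, one_sub_mul_ne_zero hz hv j]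
  rw [smul_smul, mul_div_cancel₀ _ hprod]

theorem cubeMonomial_mem_Icc (T : Fin N → Finset (Fin d)) {w : Fin d → ℝ} (hw : w ∈ Icc 0 1) :
    cubeMonomial T w ∈ Icc (0 : Fin N → ℝ) 1 :=
  ⟨fun _ => Finset.prod_nonneg fun k _ => hw.1 k,
    fun _ => Finset.prod_le_one (fun k _ => hw.1 k) fun k _ => hw.2 k⟩

theorem continuous_cubeMonomial (T : Fin N → Finset (Fin d)) : Continuous (cubeMonomial T) :=
  continuous_pi fun i => by unfold cubeMonomial; fun_prop

/-- A density times a function continuous on the closed cube is integrable. -/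
theorem IntegrableOn.mul_continuousOn_Icc {E : Type*} [NormedAddCommGroup E] [NormedSpace ℂ E]
    {g : (Fin d → ℝ) → ℂ} (hg : IntegrableOn g (cube d)) {f : (Fin d → ℝ) → E}
    (hf : ContinuousOn f (Icc 0 1)) : IntegrableOn (fun w => g w • f w) (cube d) := by
  obtain ⟨C, hC⟩ := isCompact_Icc.exists_bound_of_continuousOn hf
  refine Integrable.smul_bdd (C := C) hg ?_ ?_
  · exact (hf.mono cube_subset_Icc).aestronglyMeasurable measurableSet_cube
  · exact (ae_restrict_iff' measurableSet_cube).2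
      (ae_of_all _ fun w hw => hC w (cube_subset_Icc hw))

theorem integrableOn_eulerKernel {A B : Fin d → ℂ} (hA : ∀ k, -1 < (A k).re)
    (hB : ∀ k, -1 < (B k).re) (c : Fin N → ℂ) (T : Fin N → Finset (Fin d)) {z : Fin N → ℂ}
    (hz : z ∈ domain0 N) : IntegrableOn (eulerKernel A B c T z) (cube d) := by
  refine IntegrableOn.mul_continuousOn_Icc (integrableOn_betaDensity hA hB) ?_
  exact (continuousOn_binomProd c).comp (f := fun w => (z, cubeMonomial T w))
    (by have := continuous_cubeMonomial T; fun_prop)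
    fun w hw => ⟨hz, cubeMonomial_mem_Icc T hw⟩

theorem integrableOn_eulerKernel_mul_deriv {A B : Fin d → ℂ} (hA : ∀ k, -1 < (A k).re)
    (hB : ∀ k, -1 < (B k).re) (c : Fin N → ℂ) (T : Fin N → Finset (Fin d)) {z : Fin N → ℂ}
    (hz : z ∈ domain0 N) (i : Fin N) : IntegrableOn (fun w => eulerKernel A B c T z w *
      (-(c i * cubeMonomial T w i) / (1 - z i * cubeMonomial T w i))) (cube d) := by
  have hm := continuous_cubeMonomial T
  refine IntegrableOn.mul_continuousOn_Icc (integrableOn_eulerKernel hA hB c T hz) ?_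
  refine ContinuousOn.div (by fun_prop) (by fun_prop)
    fun w hw => one_sub_mul_ne_zero hz (cubeMonomial_mem_Icc T hw) i

theorem hasFDerivAt_eulerIntegral {A B : Fin d → ℂ} (hA : ∀ k, -1 < (A k).re)
    (hB : ∀ k, -1 < (B k).re) (c : Fin N → ℂ) (T : Fin N → Finset (Fin d)) {z : Fin N → ℂ}
    (hz : z ∈ domain0 N) :
    HasFDerivAt (eulerIntegral A B c T)
      (∑ i, (∫ w in cube d, eulerKernel A B c T z w *
        (-(c i * cubeMonomial T w i) / (1 - z i * cubeMonomial T w i))) •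
        (ContinuousLinearMap.proj i : (Fin N → ℂ) →L[ℂ] ℂ)) z := by
  obtain ⟨r, hr, hball⟩ := Metric.nhds_basis_closedBall.mem_iff.1 (isOpen_domain0.mem_nhds hz)
  obtain ⟨C, hC⟩ := ((isCompact_closedBall z r).prod
    (isCompact_Icc (a := (0 : Fin N → ℝ)) (b := 1))).exists_bound_of_continuousOn
      ((continuousOn_binomDeriv c).mono (prod_mono hball subset_rfl))
  have hg := integrableOn_betaDensity hA hB
  have hD : IntegrableOn (fun w => betaDensity A B w • binomDeriv c z (cubeMonomial T w))
      (cube d) := by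
    refine IntegrableOn.mul_continuousOn_Icc hg ?_
    exact (continuousOn_binomDeriv c).comp (f := fun w => (z, cubeMonomial T w))
      (by have := continuous_cubeMonomial T; fun_prop)
      fun w hw => ⟨hz, cubeMonomial_mem_Icc T hw⟩
  have key := hasFDerivAt_integral_of_dominated_of_fderiv_le (𝕜 := ℂ)
    (μ := volume.restrict (cube d)) (F := fun z w => eulerKernel A B c T z w)
    (F' := fun z w => betaDensity A B w • binomDeriv c z (cubeMonomial T w))
    (x₀ := z) (bound := fun w => ‖betaDensity A B w‖ * C) (s := Metric.closedBall z r)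
    (Metric.closedBall_mem_nhds z hr)
    (by
      filter_upwards [isOpen_domain0.mem_nhds hz] with y hy
      exact (integrableOn_eulerKernel hA hB c T hy).1)
    (integrableOn_eulerKernel hA hB c T hz) hD.1
    ((ae_restrict_iff' measurableSet_cube).2 (ae_of_all _ fun w hw y hy => by
      rw [norm_smul]
      gcongr
      exact hC (y, cubeMonomial T w) ⟨hy, cubeMonomial_mem_Icc T (cube_subset_Icc hw)⟩))
    (hg.norm.mul_const C)
    ((ae_restrict_iff' measurableSet_cube).2 (ae_of_all _ fun w hw y hy =>
      (hasFDerivAt_binomProd c (hball hy)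
        (cubeMonomial_mem_Icc T (cube_subset_Icc hw))).const_mul _))
  refine key.congr_fderiv ?_
  have hs : ∀ w, betaDensity A B w • binomDeriv c z (cubeMonomial T w) =
      ∑ i, (eulerKernel A B c T z w *
        (-(c i * cubeMonomial T w i) / (1 - z i * cubeMonomial T w i))) •
        (ContinuousLinearMap.proj i : (Fin N → ℂ) →L[ℂ] ℂ) := by
    intro w
    rw [binomDeriv, Finset.smul_sum]
    refine Finset.sum_congr rfl fun i _ => ?_
    rw [smul_smul, eulerKernel, mul_assoc]
  simp only [hs]
  rw [integral_finsetSum]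
  · refine Finset.sum_congr rfl fun i _ => ?_
    exact integral_smul_const _ _
  · intro i _
    exact (integrableOn_eulerKernel_mul_deriv hA hB c T hz i).smul_const _

theorem differentiableOn_eulerIntegral {A B : Fin d → ℂ} (hA : ∀ k, -1 < (A k).re)
    (hB : ∀ k, -1 < (B k).re) (c : Fin N → ℂ) (T : Fin N → Finset (Fin d)) :
    DifferentiableOn ℂ (eulerIntegral A B c T) (domain0 N) := fun _ hz =>
  (hasFDerivAt_eulerIntegral hA hB c T hz).differentiableAt.differentiableWithinAt

/-- At the origin an Euler integral is a product of beta integrals. -/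
theorem eulerIntegral_ne_zero_of_eq_zero {A B : Fin d → ℂ} (hA : ∀ k, -1 < (A k).re)
    (hB : ∀ k, -1 < (B k).re) (c : Fin N → ℂ) (T : Fin N → Finset (Fin d)) {z : Fin N → ℂ}
    (hz : ∀ i, z i = 0) : eulerIntegral A B c T z ≠ 0 := by
  have : eulerKernel A B c T z = betaDensity A B := by
    ext w; simp [eulerKernel, binomProd, hz]
  rw [eulerIntegral, this]
  exact integral_betaDensity_ne_zero hA hB

/-- Integral shifts of the exponents multiply the kernel by a rational function. -/
theorem eulerKernel_shift (A B : Fin d → ℂ) (c : Fin N → ℂ) (T : Fin N → Finset (Fin d))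
    {z : Fin N → ℂ} (hz : z ∈ domain0 N) (a b : Fin d → ℤ) (e : Fin N → ℤ) {w : Fin d → ℝ}
    (hw : w ∈ cube d) :
    eulerKernel (fun k => A k + a k) (fun k => B k + b k) (fun i => c i + e i) T z w =
      eulerKernel A B c T z w * ((∏ k, (w k : ℂ) ^ a k) * (∏ k, (1 - (w k : ℂ)) ^ b k) *
        ∏ i, (1 - z i * cubeMonomial T w i) ^ e i) := by
  have h1 : betaDensity (fun k => A k + a k) (fun k => B k + b k) w =
      betaDensity A B w * ((∏ k, (w k : ℂ) ^ a k) * (∏ k, (1 - (w k : ℂ)) ^ b k)) := by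
    simp only [betaDensity, ← Finset.prod_mul_distrib]
    refine Finset.prod_congr rfl fun k _ => ?_
    rw [Complex.cpow_add _ _ (ofReal_ne_zero_of_mem hw k),
      Complex.cpow_add _ _ (one_sub_ofReal_ne_zero_of_mem hw k), Complex.cpow_intCast,
      Complex.cpow_intCast]
    ring
  have h2 : binomProd (fun i => c i + e i) z (cubeMonomial T w) =
      binomProd c z (cubeMonomial T w) * ∏ i, (1 - z i * cubeMonomial T w i) ^ e i := by
    simp only [binomProd, ← Finset.prod_mul_distrib]
    refine Finset.prod_congr rfl fun i _ => ?_
    rw [Complex.cpow_add _ _ (one_sub_mul_ne_zero hz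
      (cubeMonomial_mem_Icc T (cube_subset_Icc hw)) i), Complex.cpow_intCast]
  rw [eulerKernel, h1, h2, eulerKernel]
  ring

end Kernel

/-! ### Integration by parts on the cube -/

section IntegrationByParts

variable {d N : ℕ}

theorem update_mem_cube {w : Fin d → ℝ} (hw : w ∈ cube d) (m : Fin d) {s : ℝ}
    (hs : s ∈ Ioo (0 : ℝ) 1) : Function.update w m s ∈ cube d := by
  rw [mem_cube] at *
  intro k
  by_cases h : k = m
  · subst h; simpa using hs
  · simpa [h] using hw k

/-- A partial derivative of a function that vanishes on two opposite faces of the cube has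
integral zero. -/
theorem integral_cube_partialDeriv_eq_zero (m : Fin d) {V V' : (Fin d → ℝ) → ℂ}
    (hderiv : ∀ w ∈ cube d, HasDerivAt (fun s => V (Function.update w m s)) (V' w) (w m))
    (h0 : ∀ w ∈ cube d, Tendsto (fun s => V (Function.update w m s)) (𝓝[>] 0) (𝓝 0))
    (h1 : ∀ w ∈ cube d, Tendsto (fun s => V (Function.update w m s)) (𝓝[<] 1) (𝓝 0))
    (hint : IntegrableOn V' (cube d)) : ∫ w in cube d, V' w = 0 := by
  obtain _ | n := d
  · exact m.elim0
  rw [IntegrableOn, restrict_cube] at hint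
  rw [restrict_cube]
  have he := (measurePreserving_piFinSuccAbove
    (fun _ : Fin (n + 1) => (volume : Measure ℝ).restrict (Ioo 0 1)) m).symm
  rw [← he.integral_comp', integral_prod_symm]
  swap
  · exact (he.integrable_comp_emb (MeasurableEquiv.measurableEmbedding _)).2 hint
  · rw [← (restrict_cube : _ = Measure.pi fun _ : Fin n => _)]
    have hint' := ((he.integrable_comp_emb (MeasurableEquiv.measurableEmbedding _)).2
      hint).prod_left_ae
    rw [← (restrict_cube : _ = Measure.pi fun _ : Fin n => _)] at hint'
    refine integral_eq_zero_of_ae ?_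
    filter_upwards [hint', ae_restrict_mem measurableSet_cube] with y hy hyc
    simp only [MeasurableEquiv.piFinSuccAbove_symm_apply, Function.comp_def] at hy ⊢
    have hmem : ∀ s ∈ Ioo (0 : ℝ) 1, (m.insertNth s y : Fin (n + 1) → ℝ) ∈ cube (n + 1) := by
      intro s hs
      rw [mem_cube, Fin.forall_iff_succAbove m]
      simpa using ⟨hs, mem_cube.1 hyc⟩
    have hup : ∀ s t : ℝ, Function.update (m.insertNth s y : Fin (n + 1) → ℝ) m t =
        (m.insertNth t y : Fin (n + 1) → ℝ) := fun s t =>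
      Fin.update_insertNth (α := fun _ => ℝ) m s t y
    have hhalf := hmem (1 / 2) (by norm_num)
    have h0' := h0 _ hhalf
    have h1' := h1 _ hhalf
    simp only [hup] at h0' h1'
    have key := intervalIntegral.integral_eq_sub_of_hasDerivAt_of_tendsto
      (f := fun s : ℝ => V (m.insertNth s y : Fin (n + 1) → ℝ))
      (f' := fun s : ℝ => V' (m.insertNth s y : Fin (n + 1) → ℝ)) zero_lt_one
      (fun s hs => by
        have := hderiv _ (hmem s hs)
        simpa only [hup, Fin.insertNth_apply_same] using this)
      ((intervalIntegrable_iff_integrableOn_Ioo_of_le zero_le_one).2 hy) h0' h1'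
    rw [intervalIntegral.integral_of_le zero_le_one, integral_Ioc_eq_integral_Ioo] at key
    rw [sub_self] at key
    exact key

theorem cubeMonomial_update (T : Fin N → Finset (Fin d)) (w : Fin d → ℝ) (m : Fin d) (s : ℝ)
    (i : Fin N) : cubeMonomial T (Function.update w m s) i =
      if m ∈ T i then s * ∏ k ∈ (T i).erase m, w k else cubeMonomial T w i := by
  split_ifs with h
  · rw [cubeMonomial, ← Finset.mul_prod_erase _ _ h, Function.update_self]
    congr 1
    exact Finset.prod_congr rfl fun k hk => Function.update_of_ne (Finset.ne_of_mem_erase hk) _ _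
  · refine Finset.prod_congr rfl fun k hk => Function.update_of_ne ?_ _ _
    rintro rfl
    exact h hk

theorem hasDerivAt_betaDensity {A B : Fin d → ℂ} {w : Fin d → ℝ} (hw : w ∈ cube d) (m : Fin d) :
    HasDerivAt (fun s => betaDensity A B (Function.update w m s))
      (betaDensity A B w * (A m / w m - B m / (1 - w m))) (w m) := by
  have hf : (fun s => betaDensity A B (Function.update w m s)) = fun s : ℝ =>
      ((s : ℂ) ^ A m * (1 - (s : ℂ)) ^ B m) *
        ∏ k ∈ Finset.univ.erase m, ((w k : ℂ) ^ A k * (1 - (w k : ℂ)) ^ B k) := by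
    ext s
    rw [betaDensity, ← Finset.mul_prod_erase _ _ (Finset.mem_univ m), Function.update_self]
    congr 1
    refine Finset.prod_congr rfl fun k hk => ?_
    rw [Function.update_of_ne (Finset.ne_of_mem_erase hk)]
  have hw0 := ofReal_ne_zero_of_mem hw m
  have hw1 := one_sub_ofReal_ne_zero_of_mem hw m
  have hwm := mem_cube.1 hw m
  have h1 : HasDerivAt (fun s : ℝ => (s : ℂ) ^ A m) (A m * (w m : ℂ) ^ (A m - 1) * 1) (w m) :=
    ((hasDerivAt_id (w m : ℂ)).cpow_const (c := A m) (Or.inl (by simpa using hwm.1))).comp_ofReal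
  have h2 : HasDerivAt (fun s : ℝ => (1 - (s : ℂ)) ^ B m)
      (B m * (1 - (w m : ℂ)) ^ (B m - 1) * (-1)) (w m) :=
    (((hasDerivAt_id (w m : ℂ)).const_sub 1).cpow_const (c := B m)
      (Or.inl (by simpa using hwm.2))).comp_ofReal
  rw [hf]
  refine ((h1.mul h2).mul_const _).congr_deriv ?_
  rw [betaDensity, ← Finset.mul_prod_erase _ _ (Finset.mem_univ m), Complex.cpow_sub _ _ hw0,
    Complex.cpow_sub _ _ hw1, Complex.cpow_one, Complex.cpow_one]
  field_simp
  ring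

theorem hasDerivAt_binomProd_cubeMonomial (c : Fin N → ℂ) (T : Fin N → Finset (Fin d))
    {z : Fin N → ℂ} (hz : z ∈ domain0 N) {w : Fin d → ℝ} (hw : w ∈ cube d) (m : Fin d) :
    HasDerivAt (fun s => binomProd c z (cubeMonomial T (Function.update w m s)))
      (binomProd c z (cubeMonomial T w) * ∑ i, -(if m ∈ T i then c i * z i * cubeMonomial T w i /
        (1 - z i * cubeMonomial T w i) else 0) / w m) (w m) := by
  have hv := cubeMonomial_mem_Icc T (cube_subset_Icc hw)
  have hw0 := ofReal_ne_zero_of_mem hw m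
  have h1 : ∀ i ∈ Finset.univ, HasDerivAt
      (fun s => (1 - z i * (cubeMonomial T (Function.update w m s) i : ℂ)) ^ c i)
      ((1 - z i * cubeMonomial T w i) ^ c i * (-(if m ∈ T i then c i * z i * cubeMonomial T w i /
        (1 - z i * cubeMonomial T w i) else 0) / w m)) (w m) := by
    intro i _
    have hs := one_sub_mul_mem_slitPlane' hz hv i
    have hne := one_sub_mul_ne_zero hz hv i
    simp only [cubeMonomial_update]
    split_ifs with h
    · have hm : cubeMonomial T w i = w m * ∏ k ∈ (T i).erase m, w k :=
        (Finset.mul_prod_erase _ _ h).symm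
      set P : ℝ := ∏ k ∈ (T i).erase m, w k
      rw [hm] at hs hne ⊢
      push_cast at hs hne ⊢
      have hl : HasDerivAt (fun s : ℂ => 1 - z i * (s * (P : ℂ))) (-(z i * P)) (w m : ℂ) := by
        have := (((hasDerivAt_id (w m : ℂ)).mul_const (P : ℂ)).const_mul (z i)).const_sub 1
        simpa using this
      refine ((hl.cpow_const (c := c i) hs).comp_ofReal).congr_deriv ?_
      rw [Complex.cpow_sub _ _ hne, Complex.cpow_one]
      field_simp
    · simpa using hasDerivAt_const (w m) ((1 - z i * (cubeMonomial T w i : ℂ)) ^ c i)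
  refine (HasDerivAt.fun_finsetProd h1).congr_deriv ?_
  rw [Finset.mul_sum]
  refine Finset.sum_congr rfl fun i _ => ?_
  rw [Function.update_eq_self, smul_eq_mul, ← mul_assoc, binomProd,
    ← Finset.prod_erase_mul _ _ (Finset.mem_univ i)]

/-- Integration by parts along the coordinate `w_m`, applied to the Euler field `w_m ∂/∂w_m`. -/
theorem integral_eulerKernel_euler {A B : Fin d → ℂ} (hA : ∀ k, -1 < (A k).re)
    (hB : ∀ k, -1 < (B k).re) (c : Fin N → ℂ) (T : Fin N → Finset (Fin d)) {z : Fin N → ℂ}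
    (hz : z ∈ domain0 N) (m : Fin d) (hm : 0 < (B m).re) :
    IntegrableOn (fun w => eulerKernel A B c T z w * (A m + 1 - B m * w m / (1 - w m) -
      ∑ i, if m ∈ T i then c i * z i * cubeMonomial T w i / (1 - z i * cubeMonomial T w i) else 0))
      (cube d) ∧
    ∫ w in cube d, eulerKernel A B c T z w * (A m + 1 - B m * w m / (1 - w m) -
      ∑ i, if m ∈ T i then c i * z i * cubeMonomial T w i / (1 - z i * cubeMonomial T w i) else 0)
      = 0 := by
  have hint : IntegrableOn (fun w => eulerKernel A B c T z w * (A m + 1 - B m * w m / (1 - w m) -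
      ∑ i, if m ∈ T i then c i * z i * cubeMonomial T w i / (1 - z i * cubeMonomial T w i) else 0))
      (cube d) := by
    have i1 : IntegrableOn (fun w => eulerKernel A B c T z w * (B m * w m / (1 - w m)))
        (cube d) := by
      have hsh := (integrableOn_eulerKernel (A := fun k => A k + (if k = m then 1 else 0 : ℤ))
        (B := fun k => B k + (if k = m then -1 else 0 : ℤ)) (fun k => by
          have := hA k
          split_ifs <;> simp <;> linarith) (fun k => by
          have := hB k
          split_ifs with h
          · subst h; simpa using hm
          · simpa) (fun i => c i + (0 : ℤ)) T hz).const_mul (B m)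
      refine IntegrableOn.congr_fun hsh (fun w hw => ?_) measurableSet_cube
      rw [eulerKernel_shift A B c T hz (fun k => if k = m then 1 else 0)
        (fun k => if k = m then -1 else 0) (fun _ => 0) hw]
      simp only [zpow_zero, Finset.prod_const_one, mul_one]
      rw [Finset.prod_eq_single m (by intro b _ hb; simp [hb]) (by simp),
        Finset.prod_eq_single m (by intro b _ hb; simp [hb]) (by simp)]
      simp
      ring
    have i2 : IntegrableOn (fun w => eulerKernel A B c T z w * (A m + 1 -
      ∑ i, if m ∈ T i then c i * z i * cubeMonomial T w i / (1 - z i * cubeMonomial T w i) else 0))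
      (cube d) := by
      have hmo := continuous_cubeMonomial T
      refine IntegrableOn.mul_continuousOn_Icc (integrableOn_eulerKernel hA hB c T hz) ?_
      refine continuousOn_const.sub (continuousOn_finsetSum _ fun i _ => ?_)
      split_ifs
      · exact ContinuousOn.div (by fun_prop) (by fun_prop)
          fun w hw => one_sub_mul_ne_zero hz (cubeMonomial_mem_Icc T hw) i
      · exact continuousOn_const
    refine (i2.sub i1).congr_fun (fun w _ => ?_) measurableSet_cube
    simp only [Pi.sub_apply]
    ring
  refine ⟨hint, ?_⟩
  have hcont : ContinuousOn (fun w : Fin d → ℝ => binomProd c z (cubeMonomial T w)) (Icc 0 1) :=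
    (continuousOn_binomProd c).comp (f := fun w : Fin d → ℝ => (z, cubeMonomial T w))
      (by have := continuous_cubeMonomial T; fun_prop)
      fun w hw => ⟨hz, cubeMonomial_mem_Icc T hw⟩
  obtain ⟨C, hC⟩ := isCompact_Icc.exists_bound_of_continuousOn hcont
  -- near the two faces the potential is a constant times `‖s ^ (A_m + 1) (1 - s) ^ B_m‖`
  have hbound : ∀ w ∈ cube d, ∃ D : ℝ, ∀ s ∈ Ioo (0 : ℝ) 1,
      ‖eulerKernel A B c T z (Function.update w m s) * s‖ ≤
        s ^ ((A m).re + 1) * (1 - s) ^ (B m).re * D := by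
    intro w hw
    refine ⟨‖∏ k ∈ Finset.univ.erase m, ((w k : ℂ) ^ A k * (1 - (w k : ℂ)) ^ B k)‖ * C,
      fun s hs => ?_⟩
    have hb := hC _ (cube_subset_Icc (update_mem_cube hw m hs))
    rw [eulerKernel, betaDensity, ← Finset.mul_prod_erase _ _ (Finset.mem_univ m),
      Function.update_self, norm_mul, norm_mul, norm_mul, norm_mul]
    have e1 : ‖(s : ℂ) ^ A m‖ = s ^ (A m).re := Complex.norm_cpow_eq_rpow_re_of_pos hs.1 _
    have e2 : ‖(1 - (s : ℂ)) ^ B m‖ = (1 - s) ^ (B m).re := by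
      have := Complex.norm_cpow_eq_rpow_re_of_pos (sub_pos.2 hs.2) (B m)
      simpa using this
    have e3 : ∏ k ∈ Finset.univ.erase m, ((Function.update w m s k : ℂ) ^ A k *
        (1 - (Function.update w m s k : ℂ)) ^ B k) =
        ∏ k ∈ Finset.univ.erase m, ((w k : ℂ) ^ A k * (1 - (w k : ℂ)) ^ B k) := by
      refine Finset.prod_congr rfl fun k hk => ?_
      rw [Function.update_of_ne (Finset.ne_of_mem_erase hk)]
    rw [e1, e2, e3, Real.rpow_add_one hs.1.ne', Complex.norm_real, Real.norm_of_nonneg hs.1.le]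
    have hs1 : 0 ≤ (1 - s) ^ (B m).re := Real.rpow_nonneg (sub_nonneg.2 hs.2.le) _
    have hs0 : 0 ≤ s ^ (A m).re := Real.rpow_nonneg hs.1.le _
    have : ∀ a b e f : ℝ, 0 ≤ a → 0 ≤ b → 0 ≤ e → f ≤ C → a * b * e * f * s ≤
        a * s * b * (e * C) := by
      intro a b e f ha hb he hf
      have := mul_le_mul_of_nonneg_left hf (mul_nonneg (mul_nonneg (mul_nonneg ha hb) he) hs.1.le)
      nlinarith
    exact this _ _ _ _ hs0 hs1 (norm_nonneg _) hb
  refine integral_cube_partialDeriv_eq_zero m (V := fun w => eulerKernel A B c T z w * w m)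
    ?_ ?_ ?_ hint
  · intro w hw
    have hw0 := ofReal_ne_zero_of_mem hw m
    have h3 : HasDerivAt (fun s : ℝ => ((Function.update w m s m : ℝ) : ℂ)) 1 (w m) := by
      simp only [Function.update_self]
      exact (hasDerivAt_id (w m : ℂ)).comp_ofReal
    refine (((hasDerivAt_betaDensity hw m).mul
      (hasDerivAt_binomProd_cubeMonomial c T hz hw m)).mul h3).congr_deriv ?_
    simp only [Function.update_eq_self, Pi.mul_apply]
    rw [eulerKernel, ← Finset.sum_div, Finset.sum_neg_distrib]
    field_simp
    ring
  · intro w hw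
    obtain ⟨D, hD⟩ := hbound w hw
    have hlim : Tendsto (fun s : ℝ => s ^ ((A m).re + 1) * (1 - s) ^ (B m).re * D) (𝓝[>] 0)
        (𝓝 0) := by
      have hc : ContinuousAt (fun s : ℝ => s ^ ((A m).re + 1) * (1 - s) ^ (B m).re * D) 0 := by
        refine ContinuousAt.mul (ContinuousAt.mul ?_ ?_) continuousAt_const
        · exact Real.continuousAt_rpow_const _ _ (Or.inr (by linarith [hA m]))
        · exact ContinuousAt.rpow_const (by fun_prop) (Or.inl (by simp))
      have := hc.tendsto
      rw [Real.zero_rpow (by linarith [hA m]), zero_mul, zero_mul] at this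
      exact this.mono_left nhdsWithin_le_nhds
    refine squeeze_zero_norm' ?_ hlim
    filter_upwards [Ioo_mem_nhdsGT (zero_lt_one (α := ℝ))] with s hs
    simpa using hD s hs
  · intro w hw
    obtain ⟨D, hD⟩ := hbound w hw
    have hlim : Tendsto (fun s : ℝ => s ^ ((A m).re + 1) * (1 - s) ^ (B m).re * D) (𝓝[<] 1)
        (𝓝 0) := by
      have hc : ContinuousAt (fun s : ℝ => s ^ ((A m).re + 1) * (1 - s) ^ (B m).re * D) 1 := by
        refine ContinuousAt.mul (ContinuousAt.mul ?_ ?_) continuousAt_const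
        · exact Real.continuousAt_rpow_const _ _ (Or.inl (by simp))
        · exact ContinuousAt.rpow_const (by fun_prop) (Or.inr hm.le)
      have := hc.tendsto
      rw [sub_self, Real.zero_rpow hm.ne', mul_zero, zero_mul] at this
      exact this.mono_left nhdsWithin_le_nhds
    refine squeeze_zero_norm' ?_ hlim
    filter_upwards [Ioo_mem_nhdsLT (zero_lt_one (α := ℝ))] with s hs
    simpa using hD s hs

end IntegrationByParts

/-! ### The Pfaffian system in terms of Euler operators -/

section PfaffianAlgebra

variable {d N : ℕ} (p : Params d N)

theorem matE_mulVec (i : Fin N) (y : Idx d N → ℂ) (r : Idx d N) :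
    (matE p i).mulVec y r = match r with
      | none => 0
      | some (k, n) => if k = i then
          p.a n * (y none + ∑ m ∈ Finset.Iio n, y (some (i, m))) + p.b i n * y (some (i, n)) -
            ∑ j ∈ Finset.univ.erase i, p.β j * y (some (j, n)) else 0 := by
  rcases r with _ | ⟨k, n⟩
  · simp [Matrix.mulVec, dotProduct, matE]
  · simp only [Matrix.mulVec, dotProduct, matE, Matrix.of_apply, Fintype.sum_option,
      Fintype.sum_prod_type]
    split_ifs with hk
    · rw [← Finset.add_sum_erase _ _ (Finset.mem_univ i)]
      have h1 : ∑ m, (if i = i then if m < n then p.a n else if m = n then p.b i n else 0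
          else if m = n then -p.β i else 0) * y (some (i, m)) =
          p.a n * ∑ m ∈ Finset.Iio n, y (some (i, m)) + p.b i n * y (some (i, n)) := by
        have : ∀ m, (if i = i then if m < n then p.a n else if m = n then p.b i n else 0
          else if m = n then -p.β i else 0) * y (some (i, m)) =
          (if m < n then p.a n * y (some (i, m)) else 0) +
          (if m = n then p.b i n * y (some (i, m)) else 0) := by
          intro m
          by_cases h : m < n
          · simp [h, h.ne]
          · simp [h]
        rw [Finset.sum_congr rfl fun m _ => this m, Finset.sum_add_distrib, Finset.mul_sum,
          ← Finset.sum_filter]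
        congr 1
        · refine Finset.sum_congr ?_ fun _ _ => rfl
          ext; simp
        · simp
      have h2 : ∑ j ∈ Finset.univ.erase i, ∑ m, (if j = i then if m < n then p.a n else
          if m = n then p.b i n else 0 else if m = n then -p.β j else 0) * y (some (j, m)) =
          -∑ j ∈ Finset.univ.erase i, p.β j * y (some (j, n)) := by
        rw [← Finset.sum_neg_distrib]
        refine Finset.sum_congr rfl fun j hj => ?_
        simp [Finset.ne_of_mem_erase hj]
      rw [h1, h2]
      ring
    · simp

theorem matF_mulVec (i : Fin N) (y : Idx d N → ℂ) (r : Idx d N) :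
    (matF p i).mulVec y r = match r with
      | none => -p.β i * (y none + ∑ m, y (some (i, m)))
      | some (k, n) => if k = i then -p.a n * (y none + ∑ m, y (some (i, m))) else 0 := by
  have key : ∀ e : ℂ, e * y none + ∑ j, ∑ m : Fin d, (if j = i then e else 0) * y (some (j, m)) =
      e * (y none + ∑ m, y (some (i, m))) := by
    intro e
    rw [Finset.sum_eq_single i (by intro b _ hb; simp [hb]) (by simp), mul_add, Finset.mul_sum]
    simp
  rcases r with _ | ⟨k, n⟩
  · simp only [Matrix.mulVec, dotProduct, matF, Matrix.of_apply, Fintype.sum_option,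
      Fintype.sum_prod_type]
    exact key _
  · simp only [Matrix.mulVec, dotProduct, matF, Matrix.of_apply, Fintype.sum_option,
      Fintype.sum_prod_type]
    rw [key]
    split_ifs <;> simp

theorem matG_mulVec {i j : Fin N} (hij : i ≠ j) (y : Idx d N → ℂ) (r : Idx d N) :
    (matG p i j).mulVec y r = match r with
      | none => 0
      | some (k, n) => (if k = i then p.β j * (y (some (j, n)) - y (some (i, n))) else 0) +
          (if k = j then p.β i * (y (some (i, n)) - y (some (j, n))) else 0) := by
  rcases r with _ | ⟨k, n⟩
  · simp [Matrix.mulVec, dotProduct, matG]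
  · simp only [Matrix.mulVec, dotProduct, matG, Matrix.of_apply, Fintype.sum_option,
      Fintype.sum_prod_type, zero_mul, zero_add, ite_mul, Finset.sum_ite_eq, Finset.mem_univ,
      if_true]
    by_cases hki : k = i
    · subst hki
      rw [← Finset.add_sum_erase _ _ (Finset.mem_univ k),
        ← Finset.add_sum_erase _ _ (Finset.mem_erase.2 ⟨hij.symm, Finset.mem_univ j⟩)]
      rw [Finset.sum_eq_zero]
      · simp [hij, hij.symm]; ring
      · intro l hl
        simp only [Finset.mem_erase] at hl
        simp [hl.1, hl.2.1]
    · by_cases hkj : k = j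
      · subst hkj
        rw [← Finset.add_sum_erase _ _ (Finset.mem_univ k),
          ← Finset.add_sum_erase _ _ (Finset.mem_erase.2 ⟨hij, Finset.mem_univ i⟩)]
        rw [Finset.sum_eq_zero]
        · simp [hij, hij.symm]; ring
        · intro l hl
          simp only [Finset.mem_erase] at hl
          simp [hl.1, hl.2.1]
      · simp [hki, hkj]

/-- The Pfaffian system follows from the action of the operators `D_l = x_l ∂/∂x_l` with `l ≠ i`
on the `i`-th block, and of the total Euler operator `∑_l D_l`. -/
theorem pfaffForm_mulVec_of_euler {x : Fin N → ℂ} (hx0 : ∀ i, x i ≠ 0) (hx1 : ∀ i, x i ≠ 1)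
    (hxx : ∀ i j, i ≠ j → x i ≠ x j) {y : Idx d N → ℂ} {D : Fin N → Idx d N → ℂ}
    (h0 : ∀ l, D l none = p.β l * x l / (1 - x l) * (y none + ∑ m, y (some (l, m))))
    (h1 : ∀ l i m, l ≠ i → D l (some (i, m)) =
      x l * p.β l / (x l - x i) * (y (some (l, m)) - y (some (i, m))))
    (h2 : ∀ i m, ∑ l, D l (some (i, m)) = -p.γ m * y (some (i, m)) +
      p.a m * (y none + ∑ k ∈ Finset.Iio m, y (some (i, k))) +
      p.a m * (x i / (1 - x i)) * (y none + ∑ k, y (some (i, k))))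
    (v : Fin N → ℂ) (r : Idx d N) :
    (pfaffForm p x v).mulVec y r = ∑ l, v l / x l * D l r := by
  have hx1' : ∀ i, 1 - x i ≠ 0 := fun i => sub_ne_zero.2 (hx1 i).symm
  have expand : (pfaffForm p x v).mulVec y r =
      ∑ i, (v i / x i * (matE p i).mulVec y r + (-v i / (1 - x i)) * (matF p i).mulVec y r) +
      ∑ i, ∑ j, if i < j then (v i - v j) / (x i - x j) * (matG p i j).mulVec y r else 0 := by
    simp only [pfaffForm, Matrix.add_mulVec, Matrix.sum_mulVec, Pi.add_apply, Finset.sum_apply,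
      Matrix.smul_mulVec, Pi.smul_apply, smul_eq_mul]
    congr 1
    refine Finset.sum_congr rfl fun i _ => Finset.sum_congr rfl fun j _ => ?_
    split_ifs <;> simp [Matrix.smul_mulVec]
  rw [expand]
  rcases r with _ | ⟨k, n⟩
  · rw [Finset.sum_eq_zero (s := Finset.univ) (f := fun i => ∑ j, if i < j then _ else _)]
    · rw [add_zero]
      refine Finset.sum_congr rfl fun i _ => ?_
      rw [matE_mulVec, matF_mulVec, h0]
      have := hx0 i
      have := hx1' i
      simp only
      field_simp
      ring
    · intro i _
      refine Finset.sum_eq_zero fun j _ => ?_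
      split_ifs with h
      · rw [matG_mulVec p h.ne]; simp
      · rfl
  · have hG : (∑ i, ∑ j, if i < j then (v i - v j) / (x i - x j) *
        (matG p i j).mulVec y (some (k, n)) else 0) = ∑ l ∈ Finset.univ.erase k,
        (v k - v l) / (x k - x l) * (p.β l * (y (some (l, n)) - y (some (k, n)))) := by
      have e1 : ∀ i j, (if i < j then (v i - v j) / (x i - x j) *
          (matG p i j).mulVec y (some (k, n)) else 0) =
          (if k = i then if i < j then (v i - v j) / (x i - x j) *
            (p.β j * (y (some (j, n)) - y (some (i, n)))) else 0 else 0) +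
          (if k = j then if i < j then (v i - v j) / (x i - x j) *
            (p.β i * (y (some (i, n)) - y (some (j, n)))) else 0 else 0) := by
        intro i j
        by_cases h : i < j
        · rw [matG_mulVec p h.ne]
          simp only [h, if_true]
          split_ifs <;> ring
        · simp [h]
      simp only [e1, Finset.sum_add_distrib]
      rw [Finset.sum_comm (s := Finset.univ) (t := Finset.univ)
        (f := fun i j => if k = j then _ else _)]
      have e2 : ∀ F : Fin N → Fin N → ℂ, (∑ i, ∑ j, if k = i then F i j else 0) = ∑ j, F k j := by
        intro F
        rw [Finset.sum_eq_single k (by intro b _ hb; simp [hb.symm]) (by simp)]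
        simp
      rw [e2 fun i j => if i < j then (v i - v j) / (x i - x j) *
            (p.β j * (y (some (j, n)) - y (some (i, n)))) else 0,
        e2 fun j i => if i < j then (v i - v j) / (x i - x j) *
            (p.β i * (y (some (i, n)) - y (some (j, n)))) else 0, ← Finset.sum_add_distrib,
        ← Finset.sum_erase_add _ _ (Finset.mem_univ k)]
      simp only [lt_irrefl, if_false, add_zero]
      refine Finset.sum_congr rfl fun l hl => ?_
      rcases lt_or_gt_of_ne (Finset.ne_of_mem_erase hl) with h | h
      · simp only [h, h.not_gt, if_true, if_false, zero_add]
        rw [← neg_sub (v k), ← neg_sub (x k), neg_div_neg_eq]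
      · simp [h, h.not_gt]
    rw [hG]
    have hEF : (∑ i, (v i / x i * (matE p i).mulVec y (some (k, n)) +
        (-v i / (1 - x i)) * (matF p i).mulVec y (some (k, n)))) =
        v k / x k * (matE p k).mulVec y (some (k, n)) +
        (-v k / (1 - x k)) * (matF p k).mulVec y (some (k, n)) := by
      refine Finset.sum_eq_single k ?_ (by simp)
      intro b _ hb
      rw [matE_mulVec, matF_mulVec]
      simp [hb.symm]
    rw [hEF, matE_mulVec, matF_mulVec]
    simp only [if_true]
    have hD := h2 k n
    rw [← Finset.add_sum_erase _ _ (Finset.mem_univ k)] at hD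
    rw [← Finset.add_sum_erase _ _ (Finset.mem_univ k), eq_sub_of_add_eq hD]
    have hb : p.b k n * y (some (k, n)) - ∑ j ∈ Finset.univ.erase k, p.β j * y (some (j, n)) =
        -p.γ n * y (some (k, n)) -
        ∑ j ∈ Finset.univ.erase k, p.β j * (y (some (j, n)) - y (some (k, n))) := by
      simp only [Params.b, mul_sub, Finset.sum_sub_distrib, sub_mul, ← Finset.sum_mul]
      ring
    have hsum : ∑ l ∈ Finset.univ.erase k,
        (v k - v l) / (x k - x l) * (p.β l * (y (some (l, n)) - y (some (k, n)))) -
        v k / x k * ∑ l ∈ Finset.univ.erase k, p.β l * (y (some (l, n)) - y (some (k, n))) =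
        ∑ l ∈ Finset.univ.erase k, v l / x l * D l (some (k, n)) -
        v k / x k * ∑ l ∈ Finset.univ.erase k, D l (some (k, n)) := by
      rw [Finset.mul_sum, Finset.mul_sum, ← Finset.sum_sub_distrib, ← Finset.sum_sub_distrib]
      refine Finset.sum_congr rfl fun l hl => ?_
      have hlk := Finset.ne_of_mem_erase hl
      rw [h1 l k n hlk]
      have e1 : x k - x l ≠ 0 := sub_ne_zero.2 (hxx _ _ hlk.symm)
      have e2 : x l - x k ≠ 0 := sub_ne_zero.2 (hxx _ _ hlk)
      have e3 := hx0 k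
      have e4 := hx0 l
      rw [← neg_sub (x k) (x l)]
      field_simp
      ring
    have e3 := hx0 k
    have e4 := hx1' k
    have hv : v k / x k * (p.a n * (x k / (1 - x k)) * (y none + ∑ m, y (some (k, m)))) =
        -v k / (1 - x k) * (-p.a n * (y none + ∑ m, y (some (k, m)))) := by
      field_simp
    linear_combination (v k / x k) * hb + hsum - hv

end PfaffianAlgebra

section Fibre

variable {d N : ℕ} (p : Params d N)

/-- The quotient `φ_r / φ_0`, in terms of the ratios `σ_k = t_k / t_{k-1}`. -/
noncomputable def formRatio (x : Fin N → ℂ) (σ : Fin d → ℂ) (r : Idx d N) : ℂ :=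
  match r with
  | none => 1
  | some (i, m) => Fin.partialProd σ m.castSucc * (1 - σ m) / (x i * ∏ k, σ k - 1)

theorem partialProd_last {M : Type*} [CommMonoid M] {n : ℕ} (σ : Fin n → M) :
    Fin.partialProd σ (Fin.last n) = ∏ k, σ k := by
  induction n with
  | zero => simp
  | succ n ih =>
    rw [← Fin.succ_last, Fin.partialProd_succ', ih, Fin.prod_univ_succ]
    rfl

theorem filter_castSucc_lt (m : Fin d) :
    Finset.univ.filter (fun k : Fin d => k.castSucc < m.castSucc) = Finset.Iio m := by
  ext k; simp

theorem sum_sub_telescope (g : Fin (d + 1) → ℂ) (m : Fin (d + 1)) :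
    ∑ k ∈ Finset.univ.filter (fun k : Fin d => k.castSucc < m), (g k.castSucc - g k.succ) =
      g 0 - g m := by
  induction m using Fin.induction with
  | zero => simp
  | succ j ih =>
    have : Finset.univ.filter (fun k : Fin d => k.castSucc < j.succ) =
        insert j (Finset.univ.filter fun k : Fin d => k.castSucc < j.castSucc) := by
      ext k
      simp only [Finset.mem_filter, Finset.mem_univ, true_and, Finset.mem_insert, Fin.lt_def,
        Fin.ext_iff, Fin.val_castSucc, Fin.val_succ]
      omega
    rw [this, Finset.sum_insert (by simp), ih]
    ring

theorem partialProd_mul_one_sub (σ : Fin d → ℂ) (m : Fin d) :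
    Fin.partialProd σ m.castSucc * (1 - σ m) =
      Fin.partialProd σ m.castSucc - Fin.partialProd σ m.succ := by
  rw [Fin.partialProd_succ]; ring

theorem sum_Iio_partialProd (σ : Fin d → ℂ) (m : Fin d) :
    ∑ k ∈ Finset.Iio m, Fin.partialProd σ k.castSucc * (1 - σ k) =
      1 - Fin.partialProd σ m.castSucc := by
  simp only [partialProd_mul_one_sub]
  rw [← filter_castSucc_lt, sum_sub_telescope, Fin.partialProd_zero]

theorem sum_partialProd (σ : Fin d → ℂ) :
    ∑ k, Fin.partialProd σ k.castSucc * (1 - σ k) = 1 - ∏ k, σ k := by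
  simp only [partialProd_mul_one_sub]
  have := sum_sub_telescope (Fin.partialProd σ) (Fin.last d)
  rw [Fin.partialProd_zero, partialProd_last] at this
  rw [← this]
  refine Finset.sum_congr ?_ fun _ _ => rfl
  ext k; simp

/-- The partial fraction identities that turn the derivatives of the periods into linear
combinations of periods. -/
theorem pfaffForm_mulVec_integral {x : Fin N → ℂ} (hx0 : ∀ i, x i ≠ 0) (hx1 : ∀ i, x i ≠ 1)
    (hxx : ∀ i j, i ≠ j → x i ≠ x j) {σ : (Fin d → ℝ) → Fin d → ℂ}
    {G : Idx d N → (Fin d → ℝ) → ℂ} (hint : ∀ r, IntegrableOn (G r) (cube d))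
    (hG : ∀ w ∈ cube d, ∀ r, G r w = G none w * formRatio x (σ w) r)
    (hX : ∀ w ∈ cube d, ∀ i, x i * ∏ k, σ w k - 1 ≠ 0) (hσ : ∀ w ∈ cube d, ∀ m, 1 - σ w m ≠ 0)
    {D : Fin N → Idx d N → ℂ}
    (h0 : ∀ l r, (∀ m, r ≠ some (l, m)) → D l r = ∫ w in cube d,
      G r w * (p.θ l * (x l * ∏ k, σ w k) / (x l * ∏ k, σ w k - 1)))
    (h2 : ∀ i m, ∑ l, D l (some (i, m)) = ∫ w in cube d,
      G (some (i, m)) w * (-p.α m + p.η m * σ w m / (1 - σ w m)))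
    (v : Fin N → ℂ) (r : Idx d N) :
    (pfaffForm p x v).mulVec (fun r => ∫ w in cube d, G r w) r = ∑ l, v l / x l * D l r := by
  have hx1' : ∀ i, 1 - x i ≠ 0 := fun i => sub_ne_zero.2 (hx1 i).symm
  have isum : ∀ (i : Fin N) (s : Finset (Fin d)), IntegrableOn
      (fun w => G none w + ∑ m ∈ s, G (some (i, m)) w) (cube d) := fun i s =>
    (hint none).add (integrable_finsetSum s fun m _ => hint (some (i, m)))
  have esum : ∀ (i : Fin N) (s : Finset (Fin d)),
      (∫ w in cube d, G none w) + ∑ m ∈ s, ∫ w in cube d, G (some (i, m)) w =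
      ∫ w in cube d, (G none w + ∑ m ∈ s, G (some (i, m)) w) := by
    intro i s
    rw [integral_add (hint none) (integrable_finsetSum s fun m _ => hint (some (i, m))),
      integral_finsetSum s fun m _ => hint (some (i, m))]
  have hfull : ∀ w ∈ cube d, ∀ i, G none w + ∑ m, G (some (i, m)) w =
      G none w * ((x i - 1) * (∏ k, σ w k) / (x i * ∏ k, σ w k - 1)) := by
    intro w hw i
    have := hX w hw i
    simp only [hG w hw (some (i, _)), formRatio]
    rw [← Finset.mul_sum, ← Finset.sum_div, sum_partialProd]
    generalize ∏ k, σ w k = t at this ⊢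
    have : t * x i - 1 ≠ 0 := by rwa [mul_comm]
    field_simp
    ring
  have hpart : ∀ w ∈ cube d, ∀ i n, G none w + ∑ m ∈ Finset.Iio n, G (some (i, m)) w =
      G none w * ((x i * (∏ k, σ w k) - Fin.partialProd (σ w) n.castSucc) /
        (x i * ∏ k, σ w k - 1)) := by
    intro w hw i n
    have := hX w hw i
    simp only [hG w hw (some (i, _)), formRatio]
    rw [← Finset.mul_sum, ← Finset.sum_div, sum_Iio_partialProd]
    generalize ∏ k, σ w k = t at this ⊢
    field_simp
    ring
  refine pfaffForm_mulVec_of_euler p hx0 hx1 hxx ?_ ?_ ?_ v r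
  · intro l
    rw [h0 l none (by simp), esum, ← integral_const_mul]
    refine setIntegral_congr_fun measurableSet_cube fun w hw => ?_
    have e1 := hX w hw l
    have e2 := hx1' l
    simp only [hfull w hw l, Params.θ]
    generalize ∏ k, σ w k = t at e1 ⊢
    field_simp
    ring
  · intro l i m hl
    rw [h0 l (some (i, m)) (by simp [hl.symm]), ← integral_sub (hint _) (hint _),
      ← integral_const_mul]
    refine setIntegral_congr_fun measurableSet_cube fun w hw => ?_
    have e1 := hX w hw l
    have e2 := hX w hw i
    have e3 : x l - x i ≠ 0 := sub_ne_zero.2 (hxx _ _ hl)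
    simp only [hG w hw (some (_, _)), formRatio, Params.θ]
    generalize ∏ k, σ w k = t at e1 e2 ⊢
    have : t * x l - 1 ≠ 0 := by rwa [mul_comm]
    have : t * x i - 1 ≠ 0 := by rwa [mul_comm]
    field_simp
    ring
  · intro i m
    rw [h2 i m, esum, esum, ← integral_const_mul, ← integral_const_mul, ← integral_const_mul,
      ← integral_add ((hint _).const_mul _) ((isum _ _).const_mul _),
      ← integral_add (f := fun w => -p.γ m * G (some (i, m)) w +
        p.a m * (G none w + ∑ k ∈ Finset.Iio m, G (some (i, k)) w))
        (((hint _).const_mul _).add ((isum _ _).const_mul _)) ((isum _ _).const_mul _)]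
    refine setIntegral_congr_fun measurableSet_cube fun w hw => ?_
    have e1 := hX w hw i
    have e2 := hσ w hw m
    have e3 := hx1' i
    simp only [hfull w hw i, hpart w hw i m]
    simp only [hG w hw (some (_, _)), formRatio, Params.η, Params.a]
    generalize ∏ k, σ w k = t at e1 ⊢
    field_simp
    ring

end Fibre

/-! ### The periods as Euler integrals on the cube -/

section Columns

variable {d N : ℕ} (p : Params d N)

/-- The monomials in the cube coordinates that occur in the factors of the column `c`. -/
def colT (c : Idx d N) (i : Fin N) : Finset (Fin d) :=
  match c with
  | none => Finset.univ
  | some (j, n) => if i = j then Finset.univ else {n}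

/-- The arguments of the Euler integrals of the column `c`: `x_i` in the column `0`, and `x_j`,
`x_j / x_i` in the column `(j, n)`. -/
noncomputable def colZ (c : Idx d N) (x : Fin N → ℂ) (i : Fin N) : ℂ :=
  match c with
  | none => x i
  | some (j, _) => if i = j then x j else x j / x i

/-- The exponents of `w_k` in the entry `(none, c)`. -/
noncomputable def baseA (c : Idx d N) (k : Fin d) : ℂ :=
  match c with
  | none => p.α k - 1
  | some (_, n) => if k = n then (∑ i, p.β i) - p.γ n else p.α k - p.γ n

/-- The exponents of `1 - w_k` in the entry `(none, c)`. -/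
noncomputable def baseB (c : Idx d N) (k : Fin d) : ℂ :=
  match c with
  | none => p.η k - 1
  | some (j, n) => if k = n then p.θ j else p.η k - 1

/-- The exponents of the factors `1 - z_l v_l` in the entry `(none, c)`. -/
noncomputable def baseC (c : Idx d N) (l : Fin N) : ℂ :=
  match c with
  | none => p.θ l
  | some (j, n) => if l = j then p.η n - 1 else p.θ l

/-- The change of the exponent of `w_k` from the entry `(none, c)` to `(r, c)`. -/
def shiftA (r c : Idx d N) (k : Fin d) : ℤ :=
  match r, c with
  | none, _ => 0
  | some (_, m), none => if k < m then 1 else 0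
  | some (_, m), some (_, n) =>
    if m < n then (if k < m then 1 else 0) + (if k = n then 1 else 0)
    else if n < k ∧ m ≤ k then -1 else 0

/-- The change of the exponent of `1 - w_k` from the entry `(none, c)` to `(r, c)`. -/
def shiftB (r c : Idx d N) (k : Fin d) : ℤ :=
  match r, c with
  | none, _ => 0
  | some (_, m), none => if k = m then 1 else 0
  | some (i, m), some (j, n) =>
    (if k = m then if m = n then 0 else 1 else 0) + (if k = n then if i = j then -1 else 0 else 0)

/-- The change of the exponent of `1 - z_l v_l` from the entry `(none, c)` to `(r, c)`. -/
def shiftC (r c : Idx d N) (l : Fin N) : ℤ :=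
  match r, c with
  | none, _ => 0
  | some (i, _), none => if l = i then -1 else 0
  | some (i, m), some (j, n) =>
    (if l = j then if m = n then 1 else 0 else 0) + (if l = i then if i = j then 0 else -1 else 0)

/-- The exponents of `w_k` in the entry `(r, c)`. -/
noncomputable def expA (r c : Idx d N) (k : Fin d) : ℂ := baseA p c k + shiftA r c k

/-- The exponents of `1 - w_k` in the entry `(r, c)`. -/
noncomputable def expB (r c : Idx d N) (k : Fin d) : ℂ := baseB p c k + shiftB r c k

/-- The exponents of the factors `1 - z_l v_l` in the entry `(r, c)`. -/
noncomputable def expC (r c : Idx d N) (l : Fin N) : ℂ := baseC p c l + shiftC r c l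

/-- The sign of the entry `(r, c)`. -/
noncomputable def colSign (r c : Idx d N) : ℂ :=
  match r, c with
  | none, _ => 1
  | some _, none => -1
  | some (_, m), some (_, n) => if m = n then -1 else 1

/-- The exponents of `x_l` in the monomial in front of the entry `(r, c)`. -/
noncomputable def expNu (r c : Idx d N) (l : Fin N) : ℂ :=
  match c with
  | none => 0
  | some (j, n) => if l = j then p.b j n + extraOrder j n r else
      -p.β l - (match r with
        | none => 0
        | some (i, _) => if l = i then 1 else 0)

/-- The exponent of `x_l` in the monomial `z_i`. -/
def expEps (c : Idx d N) (l i : Fin N) : ℂ :=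
  match c with
  | none => if l = i then 1 else 0
  | some (j, _) => (if l = j then 1 else 0) - (if i = j then 0 else if l = i then 1 else 0)

/-- The integrand of the entry `(r, c)`, at a point with coordinates `x_l = exp ell_l`. -/
noncomputable def colKernel (r c : Idx d N) (x ell : Fin N → ℂ) (w : Fin d → ℝ) : ℂ :=
  colSign r c * Complex.exp (∑ l, expNu p r c l * ell l) *
    eulerKernel (expA p r c) (expB p r c) (expC p r c) (colT c) (colZ c x) w

/-- The ratios `t_k / t_{k-1}` on the chain `c`, in the coordinates of the cube. -/
noncomputable def colSigma (c : Idx d N) (x : Fin N → ℂ) (w : Fin d → ℝ) : Fin d → ℂ :=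
  match c with
  | none => fun k => w k
  | some (j, n) => Function.update (fun k => (w k : ℂ)) n (1 / (x j * ∏ k, (w k : ℂ)))

variable {p}

theorem Params.Convergent.sum_β_nonpos (hp : p.Convergent) : ∑ i, (p.β i).re ≤ 0 :=
  Finset.sum_nonpos fun i _ => (hp.β_neg i).le

theorem expA_re (hp : p.Convergent) (r c : Idx d N) (k : Fin d) : -1 < (expA p r c k).re := by
  have h1 := hp.α_pos k
  have hs := hp.sum_β_nonpos
  rcases c with _ | ⟨j, n⟩
  · rcases r with _ | ⟨i, m⟩
    · simp [expA, baseA, shiftA]; linarith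
    · simp only [expA, baseA, shiftA]
      split_ifs <;> simp <;> linarith
  · have h2 := hp.γ_lt n
    rcases lt_trichotomy k n with h | h | h
    · rcases r with _ | ⟨i, m⟩
      · simp [expA, baseA, shiftA, h.ne]; linarith
      · simp only [expA, baseA, shiftA, h.ne, if_false, h.not_gt, false_and]
        split_ifs <;> simp <;> linarith
    · subst h
      rcases r with _ | ⟨i, m⟩
      · simp [expA, baseA, shiftA]; linarith
      · simp only [expA, baseA, shiftA, if_true, lt_irrefl, false_and, if_false]
        split_ifs <;> simp <;> linarith
    · have h3 := hp.γ_lt_α n k h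
      rcases r with _ | ⟨i, m⟩
      · simp [expA, baseA, shiftA, h.ne']; linarith
      · simp only [expA, baseA, shiftA, h.ne', if_false, h, true_and]
        split_ifs <;> simp <;> linarith

theorem expB_re (hp : p.Convergent) (r c : Idx d N) (k : Fin d) : -1 < (expB p r c k).re := by
  have h1 := hp.α_lt_γ k
  rcases c with _ | ⟨j, n⟩
  · rcases r with _ | ⟨i, m⟩
    · simp [expB, baseB, shiftB, Params.η]; linarith
    · simp only [expB, baseB, shiftB, Params.η]
      split_ifs <;> simp <;> linarith
  · have h2 := hp.β_neg j
    rcases r with _ | ⟨i, m⟩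
    · simp only [expB, baseB, shiftB, Params.η, Params.θ]
      split_ifs <;> simp <;> linarith
    · simp only [expB, baseB, shiftB, Params.η, Params.θ]
      by_cases h : k = n
      · subst h
        by_cases hkm : k = m
        · subst hkm; split_ifs <;> simp <;> linarith
        · split_ifs <;> simp <;> linarith
      · simp only [h, if_false]
        split_ifs <;> simp <;> linarith

theorem zpow_prod_ite_one {s : Finset (Fin d)} {P : Fin d → Prop} [DecidablePred P]
    (hP : ∀ k, P k ↔ k ∈ s) (f : Fin d → ℂ) :
    ∏ k, f k ^ (if P k then 1 else 0 : ℤ) = ∏ k ∈ s, f k := by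
  have h : ∀ k, f k ^ (if P k then 1 else 0 : ℤ) = if k ∈ s then f k else 1 := fun k => by
    by_cases hk : P k
    · simp [hk, (hP k).1 hk]
    · have hs : k ∉ s := fun hs => hk ((hP k).2 hs)
      simp [hk, hs]
  rw [Finset.prod_congr rfl fun k _ => h k, Finset.prod_ite_mem, Finset.univ_inter]

theorem zpow_prod_ite_neg_one {s : Finset (Fin d)} {P : Fin d → Prop} [DecidablePred P]
    (hP : ∀ k, P k ↔ k ∈ s) (f : Fin d → ℂ) :
    ∏ k, f k ^ (if P k then -1 else 0 : ℤ) = (∏ k ∈ s, f k)⁻¹ := by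
  rw [← zpow_prod_ite_one hP, ← Finset.prod_inv_distrib]
  refine Finset.prod_congr rfl fun k _ => ?_
  split_ifs <;> simp

theorem partialProd_castSucc {M : Type*} [CommMonoid M] (σ : Fin d → M) (m : Fin d) :
    Fin.partialProd σ m.castSucc = ∏ k ∈ Finset.Iio m, σ k := by
  suffices ∀ m : Fin (d + 1), Fin.partialProd σ m =
      ∏ k ∈ Finset.univ.filter (fun k : Fin d => k.castSucc < m), σ k by
    rw [this, filter_castSucc_lt]
  intro m
  induction m using Fin.induction with
  | zero => simp
  | succ j ih =>
    have : Finset.univ.filter (fun k : Fin d => k.castSucc < j.succ) =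
        insert j (Finset.univ.filter fun k : Fin d => k.castSucc < j.castSucc) := by
      ext k
      simp only [Finset.mem_filter, Finset.mem_univ, true_and, Finset.mem_insert, Fin.lt_def,
        Fin.ext_iff, Fin.val_castSucc, Fin.val_succ]
      omega
    rw [this, Finset.prod_insert (by simp), Fin.partialProd_succ, ih, mul_comm]

theorem prod_Iio_mul_prod_Ici (f : Fin d → ℂ) (m : Fin d) :
    (∏ k ∈ Finset.Iio m, f k) * ∏ k ∈ Finset.Ici m, f k = ∏ k, f k := by
  rw [← Finset.prod_union]
  · refine Finset.prod_congr ?_ fun _ _ => rfl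
    ext k; simp [lt_or_ge]
  · rw [Finset.disjoint_left]
    intro k; simp

theorem prod_Iio_mul_prod_Ioi (f : Fin d → ℂ) (m : Fin d) :
    (∏ k ∈ Finset.Iio m, f k) * (f m * ∏ k ∈ Finset.Ioi m, f k) = ∏ k, f k := by
  rw [← prod_Iio_mul_prod_Ici f m, ← Finset.Ioi_insert, Finset.prod_insert (by simp)]

theorem prod_ofReal_ne_zero {w : Fin d → ℝ} (hw : w ∈ cube d) (s : Finset (Fin d)) :
    ∏ k ∈ s, (w k : ℂ) ≠ 0 :=
  Finset.prod_ne_zero_iff.2 fun k _ => ofReal_ne_zero_of_mem hw k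

theorem prod_colSigma_some {j : Fin N} {n : Fin d} {x : Fin N → ℂ} {w : Fin d → ℝ}
    (hw : w ∈ cube d) : ∏ k, colSigma (some (j, n)) x w k = 1 / (x j * w n) := by
  rw [colSigma, Finset.prod_update_of_mem (Finset.mem_univ n)]
  have h := prod_ofReal_ne_zero hw (Finset.univ \ {n})
  have e : ∏ k, (w k : ℂ) = w n * ∏ k ∈ Finset.univ \ {n}, (w k : ℂ) := by
    rw [← Finset.prod_sdiff (Finset.subset_univ {n}), Finset.prod_singleton, mul_comm]
  rw [e]
  have := ofReal_ne_zero_of_mem hw n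
  field_simp

/-- The points at which the Euler integrals of the column `c` are holomorphic. -/
def colDomain (c : Idx d N) : Set (Fin N → ℂ) :=
  match c with
  | none => domain0 N
  | some (j, _) => domainAt j

theorem ne_zero_of_mem_domainAt {j : Fin N} {x : Fin N → ℂ} (hx : x ∈ domainAt j) {i : Fin N}
    (hi : i ≠ j) : x i ≠ 0 := by
  intro h
  exact hx.2 i hi (h ▸ left_mem_segment ℝ 0 (x j))

theorem notMem_segment_div_iff {a b : ℂ} (ha : a ≠ 0) :
    (1 : ℂ) ∉ segment ℝ 0 (b / a) ↔ a ∉ segment ℝ 0 b := by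
  simp only [segment_eq_image, smul_zero, zero_add, mem_image, Complex.real_smul]
  refine not_congr (exists_congr fun s => and_congr_right fun _ => ?_)
  rw [← mul_div_assoc, div_eq_one_iff_eq ha]

theorem colZ_mem_domain0 {c : Idx d N} {x : Fin N → ℂ} (hx : x ∈ colDomain c) :
    colZ c x ∈ domain0 N := by
  rcases c with _ | ⟨j, n⟩
  · exact hx
  · intro i
    by_cases h : i = j
    · subst h; simpa [colZ] using hx.1
    · simp only [colZ, h, if_false]
      exact (notMem_segment_div_iff (ne_zero_of_mem_domainAt hx h)).2 (hx.2 i h)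

theorem slitDomain_subset_domain0 : slitDomain N ⊆ domain0 N := fun _ hx i => (hx i).2.1

theorem slitDomain_subset_colDomain (c : Idx d N) : slitDomain N ⊆ colDomain c := by
  rcases c with _ | ⟨j, n⟩
  · exact slitDomain_subset_domain0
  · exact fun x hx => (hx j).2

theorem ne_of_mem_slitDomain {x : Fin N → ℂ} (hx : x ∈ slitDomain N) {i j : Fin N}
    (hij : i ≠ j) : x i ≠ x j := fun h =>
  (hx j).2.2 i hij (h ▸ right_mem_segment ℝ 0 (x j))

theorem ne_one_of_mem_slitDomain {x : Fin N → ℂ} (hx : x ∈ slitDomain N) (i : Fin N) :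
    x i ≠ 1 := fun h => (hx i).2.1 (h ▸ right_mem_segment ℝ 0 (x i))

theorem integrableOn_colKernel (hp : p.Convergent) (r c : Idx d N) {x : Fin N → ℂ}
    (hx : x ∈ colDomain c) (ell : Fin N → ℂ) : IntegrableOn (colKernel p r c x ell) (cube d) :=
  (integrableOn_eulerKernel (expA_re hp r c) (expB_re hp r c) _ _ (colZ_mem_domain0 hx)).const_mul _

theorem one_sub_colZ_ne_zero {c : Idx d N} {x : Fin N → ℂ} (hx : x ∈ colDomain c)
    {w : Fin d → ℝ} (hw : w ∈ cube d) (i : Fin N) :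
    1 - colZ c x i * (cubeMonomial (colT c) w i : ℂ) ≠ 0 :=
  one_sub_mul_ne_zero (colZ_mem_domain0 hx) (cubeMonomial_mem_Icc _ (cube_subset_Icc hw)) i

theorem cubeMonomial_colT_none (w : Fin d → ℝ) (i : Fin N) :
    (cubeMonomial (colT (none : Idx d N)) w i : ℂ) = ∏ k, (w k : ℂ) := by
  simp [cubeMonomial, colT]

theorem cubeMonomial_colT_self (w : Fin d → ℝ) (j : Fin N) (n : Fin d) :
    (cubeMonomial (colT (some (j, n))) w j : ℂ) = ∏ k, (w k : ℂ) := by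
  simp [cubeMonomial, colT]

theorem cubeMonomial_colT_ne (w : Fin d → ℝ) {i j : Fin N} (h : i ≠ j) (n : Fin d) :
    (cubeMonomial (colT (some (j, n))) w i : ℂ) = w n := by
  simp [cubeMonomial, colT, h]

theorem colX_sub_one_ne_zero {c : Idx d N} {x : Fin N → ℂ} (hx : x ∈ slitDomain N)
    {w : Fin d → ℝ} (hw : w ∈ cube d) (i : Fin N) : x i * ∏ k, colSigma c x w k - 1 ≠ 0 := by
  have h := one_sub_colZ_ne_zero (slitDomain_subset_colDomain c hx) hw i
  rcases c with _ | ⟨j, n⟩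
  · rw [cubeMonomial_colT_none] at h
    rw [← neg_ne_zero, neg_sub]
    exact h
  · rw [prod_colSigma_some hw]
    have hn := ofReal_ne_zero_of_mem hw n
    have hj := (hx j).1
    have hi := (hx i).1
    intro h0
    by_cases hij : i = j
    · subst hij
      apply one_sub_ofReal_ne_zero_of_mem hw n
      field_simp at h0
      linear_combination h0
    · rw [cubeMonomial_colT_ne w hij] at h
      simp only [colZ, hij, if_false] at h
      apply h
      field_simp at h0 ⊢
      linear_combination h0

theorem one_sub_colSigma_ne_zero {c : Idx d N} {x : Fin N → ℂ} (hx : x ∈ slitDomain N)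
    {w : Fin d → ℝ} (hw : w ∈ cube d) (m : Fin d) : 1 - colSigma c x w m ≠ 0 := by
  rcases c with _ | ⟨j, n⟩
  · exact one_sub_ofReal_ne_zero_of_mem hw m
  · by_cases h : m = n
    · subst h
      have h := one_sub_colZ_ne_zero (slitDomain_subset_colDomain (some (j, m)) hx) hw j
      rw [cubeMonomial_colT_self] at h
      simp only [colZ, if_true] at h
      simp only [colSigma, Function.update_self]
      have hj := (hx j).1
      have hS := prod_ofReal_ne_zero hw Finset.univ
      intro h0
      apply h
      field_simp at h0
      linear_combination -h0
    · simpa [colSigma, h] using one_sub_ofReal_ne_zero_of_mem hw m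

end Columns

section Solutions

variable {d N : ℕ} {p : Params d N}

theorem prod_zpow_single {ι : Type*} [Fintype ι] [DecidableEq ι] (f : ι → ℂ) (j : ι) (e : ℤ) :
    ∏ l, f l ^ (if l = j then e else 0) = f j ^ e := by
  rw [Finset.prod_eq_single j (by intro b _ hb; simp [hb]) (by simp)]
  simp

theorem colKernel_none_eq {x ell : Fin N → ℂ} (hx : x ∈ domain0 N) {w : Fin d → ℝ}
    (hw : w ∈ cube d) (i : Fin N) (m : Fin d) :
    colKernel p (some (i, m)) none x ell w =
      colKernel p none none x ell w * formRatio x (colSigma none x w) (some (i, m)) := by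
  have hz := colZ_mem_domain0 (c := (none : Idx d N)) hx
  have h1 := one_sub_colZ_ne_zero (c := (none : Idx d N)) hx hw i
  have e1 : ∑ l, expNu p (some (i, m)) none l * ell l = 0 := by simp [expNu]
  have e2 : ∑ l, expNu p none none l * ell l = 0 := by simp [expNu]
  simp only [colKernel, e1, e2]
  unfold expA expB expC
  rw [eulerKernel_shift _ _ _ _ hz _ _ _ hw, eulerKernel_shift _ _ _ _ hz _ _ _ hw]
  simp only [shiftA, shiftB, shiftC, zpow_zero, Finset.prod_const_one]
  rw [zpow_prod_ite_one (s := Finset.Iio m) (by simp), prod_zpow_single, prod_zpow_single]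
  simp only [formRatio, colSigma, partialProd_castSucc, colSign]
  rw [cubeMonomial_colT_none] at h1 ⊢
  simp only [colZ] at h1 ⊢
  rw [← neg_sub 1 (x i * _), zpow_one, zpow_neg_one]
  generalize ∏ k, (w k : ℂ) = S at h1 ⊢
  rw [div_neg]
  field_simp

theorem exp_expNu {x ell : Fin N → ℂ} (hell : ∀ l, Complex.exp (ell l) = x l) (i j : Fin N)
    (m n : Fin d) :
    Complex.exp (∑ l, expNu p (some (i, m)) (some (j, n)) l * ell l) =
      Complex.exp (∑ l, expNu p none (some (j, n)) l * ell l) *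
        ((if m < n then 1 else (x j)⁻¹) * (if i = j then 1 else x j / x i)) := by
  have h : ∀ l, expNu p (some (i, m)) (some (j, n)) l * ell l =
      expNu p none (some (j, n)) l * ell l +
      ((if l = j then (if m < n then 0 else -1) * ell l else 0) +
       ((if l = j then (if i = j then 0 else 1) * ell l else 0) +
        (if l = i then (if i = j then 0 else -1) * ell l else 0))) := by
    intro l
    simp only [expNu, extraOrder]
    by_cases h1 : l = j
    · subst h1
      by_cases h2 : i = l
      · subst h2; split_ifs <;> (simp; try ring)
      · have : l ≠ i := fun h => h2 h.symm
        split_ifs <;> (simp; try ring)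
    · by_cases h2 : l = i
      · subst h2; simp [h1]; ring
      · simp [h1, h2]
  rw [Finset.sum_congr rfl fun l _ => h l, Finset.sum_add_distrib, Finset.sum_add_distrib,
    Finset.sum_add_distrib, Finset.sum_ite_eq', Finset.sum_ite_eq', Finset.sum_ite_eq',
    Complex.exp_add, Complex.exp_add, Complex.exp_add]
  simp only [Finset.mem_univ, if_true]
  congr 2
  · split_ifs
    · simp
    · rw [neg_one_mul, Complex.exp_neg, hell]
  · by_cases hij : i = j
    · simp [hij]
    · simp only [hij, if_false]
      rw [neg_one_mul, Complex.exp_neg, hell, one_mul, hell, div_eq_mul_inv]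

theorem prod_shiftA {w : Fin d → ℝ} (hw : w ∈ cube d) (i j : Fin N) (m n : Fin d) :
    ∏ k, (w k : ℂ) ^ shiftA (some (i, m)) (some (j, n)) k =
      if m < n then (∏ k ∈ Finset.Iio m, (w k : ℂ)) * w n else
        (∏ k ∈ Finset.univ.filter fun k => n < k ∧ m ≤ k, (w k : ℂ))⁻¹ := by
  simp only [shiftA]
  split_ifs with h
  · simp only [zpow_add₀ (ofReal_ne_zero_of_mem hw _), Finset.prod_mul_distrib]
    rw [zpow_prod_ite_one (s := Finset.Iio m) (by simp), prod_zpow_single, zpow_one]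
  · rw [zpow_prod_ite_neg_one (s := Finset.univ.filter fun k => n < k ∧ m ≤ k) (by simp)]

theorem prod_shiftB {w : Fin d → ℝ} (hw : w ∈ cube d) (i j : Fin N) (m n : Fin d) :
    ∏ k, (1 - (w k : ℂ)) ^ shiftB (some (i, m)) (some (j, n)) k =
      (if m = n then 1 else 1 - (w m : ℂ)) * (if i = j then (1 - (w n : ℂ))⁻¹ else 1) := by
  simp only [shiftB]
  simp only [zpow_add₀ (one_sub_ofReal_ne_zero_of_mem hw _), Finset.prod_mul_distrib]
  rw [prod_zpow_single, prod_zpow_single]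
  congr 1 <;> split_ifs <;> simp

theorem prod_shiftC {f : Fin N → ℂ} (hf : ∀ l, f l ≠ 0) (i j : Fin N) (m n : Fin d) :
    ∏ l, f l ^ shiftC (some (i, m)) (some (j, n)) l =
      (if m = n then f j else 1) * (if i = j then 1 else (f i)⁻¹) := by
  simp only [shiftC]
  simp only [zpow_add₀ (hf _), Finset.prod_mul_distrib]
  rw [prod_zpow_single, prod_zpow_single]
  congr 1 <;> split_ifs <;> simp

theorem colKernel_some_eq {x ell : Fin N → ℂ} (hx : x ∈ slitDomain N)
    (hell : ∀ l, Complex.exp (ell l) = x l) {w : Fin d → ℝ}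
    (hw : w ∈ cube d) (i j : Fin N) (m n : Fin d) :
    colKernel p (some (i, m)) (some (j, n)) x ell w =
      colKernel p none (some (j, n)) x ell w *
        formRatio x (colSigma (some (j, n)) x w) (some (i, m)) := by
  have hxc := slitDomain_subset_colDomain (some (j, n)) hx
  have hz := colZ_mem_domain0 hxc
  have h1 := one_sub_colZ_ne_zero hxc hw
  have hX := colX_sub_one_ne_zero (c := some (j, n)) hx hw i
  simp only [colKernel, exp_expNu hell]
  unfold expA expB expC
  rw [eulerKernel_shift _ _ _ _ hz _ _ _ hw, eulerKernel_shift _ _ _ _ hz _ _ _ hw,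
    prod_shiftA hw, prod_shiftB hw, prod_shiftC h1]
  simp only [shiftA, shiftB, shiftC, zpow_zero, Finset.prod_const_one, mul_one, formRatio]
  rw [prod_colSigma_some hw] at hX ⊢
  generalize eulerKernel _ _ _ _ _ w = K
  generalize Complex.exp _ = E
  have hj := (hx j).1
  have hi := (hx i).1
  have hn := ofReal_ne_zero_of_mem hw n
  have hS := prod_ofReal_ne_zero hw
  -- the factor `1 / (x_i t - 1)`
  have hden : (1 / (x i * (1 / (x j * w n)) - 1)) = (w n : ℂ) *
      ((if i = j then 1 else x j / x i) * (if i = j then (1 - (w n : ℂ))⁻¹ else 1) *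
        (if i = j then 1 else (1 - colZ (some (j, n)) x i *
          (cubeMonomial (colT (some (j, n))) w i : ℂ))⁻¹)) := by
    by_cases hij : i = j
    · subst hij
      have := one_sub_ofReal_ne_zero_of_mem hw n
      simp only [if_true]
      rw [one_mul, mul_one, div_eq_iff hX]
      field_simp
    · have := h1 i
      rw [cubeMonomial_colT_ne w hij] at this ⊢
      simp only [colZ, hij, if_false] at this ⊢
      rw [mul_one, div_eq_iff hX]
      have h3 : x i - x j * w n ≠ 0 := by
        intro h0
        apply this
        field_simp
        rw [h0, mul_zero]
      have h4 : x i - w n * x j ≠ 0 := by rwa [mul_comm]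
      field_simp
  -- the factor `t_{m-1} - t_m`
  have hgap : Fin.partialProd (colSigma (some (j, n)) x w) m.castSucc *
      (1 - colSigma (some (j, n)) x w m) * (w n : ℂ) = colSign (some (i, m)) (some (j, n)) *
      (if m < n then 1 else (x j)⁻¹) * (if m < n then (∏ k ∈ Finset.Iio m, (w k : ℂ)) * w n else
        (∏ k ∈ Finset.univ.filter fun k => n < k ∧ m ≤ k, (w k : ℂ))⁻¹) *
      (if m = n then 1 else 1 - (w m : ℂ)) * (if m = n then 1 - colZ (some (j, n)) x j *
          (cubeMonomial (colT (some (j, n))) w j : ℂ) else 1) := by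
    rw [partialProd_castSucc]
    rcases lt_trichotomy m n with h | h | h
    · have : ∏ k ∈ Finset.Iio m, colSigma (some (j, n)) x w k = ∏ k ∈ Finset.Iio m, (w k : ℂ) := by
        refine Finset.prod_congr rfl fun k hk => ?_
        have : k ≠ n := ((Finset.mem_Iio.1 hk).trans h).ne
        simp [colSigma, this]
      rw [this]
      simp only [colSign, colSigma, h, h.ne, if_true, if_false, ne_eq, not_false_eq_true,
        Function.update_of_ne]
      ring
    · subst h
      have : ∏ k ∈ Finset.Iio m, colSigma (some (j, m)) x w k = ∏ k ∈ Finset.Iio m, (w k : ℂ) := by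
        refine Finset.prod_congr rfl fun k hk => ?_
        have : k ≠ m := (Finset.mem_Iio.1 hk).ne
        simp [colSigma, this]
      rw [this, cubeMonomial_colT_self]
      have hf : (Finset.univ.filter fun k => m < k ∧ m ≤ k) = Finset.Ioi m := by
        ext k; simp only [Finset.mem_filter, Finset.mem_univ, true_and, Finset.mem_Ioi]
        exact ⟨fun h => h.1, fun h => ⟨h, h.le⟩⟩
      rw [hf]
      simp only [colSign, colSigma, colZ, lt_irrefl, if_true, if_false, Function.update_self]
      rw [← prod_Iio_mul_prod_Ioi (fun k => (w k : ℂ)) m]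
      have h5 := hS (Finset.Iio m)
      have h6 := hS (Finset.Ioi m)
      generalize ∏ k ∈ Finset.Iio m, (w k : ℂ) = P at h5 ⊢
      generalize ∏ k ∈ Finset.Ioi m, (w k : ℂ) = Q at h6 ⊢
      field_simp
      ring
    · have hmn : n ∈ Finset.Iio m := by simpa
      have hp1 : ∏ k ∈ Finset.Iio m, colSigma (some (j, n)) x w k =
          (1 / (x j * ∏ k, (w k : ℂ))) * ((∏ k ∈ Finset.Iio m, (w k : ℂ)) / w n) := by
        rw [colSigma, Finset.prod_update_of_mem hmn, ← Finset.prod_sdiff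
          (Finset.singleton_subset_iff.2 hmn), Finset.prod_singleton, mul_div_cancel_right₀ _ hn]
      have hf : (Finset.univ.filter fun k => n < k ∧ m ≤ k) = Finset.Ici m := by
        ext k; simp only [Finset.mem_filter, Finset.mem_univ, true_and, Finset.mem_Ici]
        exact ⟨fun h => h.2, fun h' => ⟨h.trans_le h', h'⟩⟩
      rw [hp1, hf, ← prod_Iio_mul_prod_Ici (fun k => (w k : ℂ)) m]
      simp only [colSign, colSigma, h.not_gt, h.ne', if_false, ne_eq, not_false_eq_true,
        Function.update_of_ne]
      have h5 := hS (Finset.Iio m)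
      have h6 := hS (Finset.Ici m)
      generalize ∏ k ∈ Finset.Iio m, (w k : ℂ) = P at h5 ⊢
      generalize ∏ k ∈ Finset.Ici m, (w k : ℂ) = Q at h6 ⊢
      field_simp
  have hsign : colSign none (some (j, n)) = 1 := rfl
  rw [div_eq_mul_one_div (Fin.partialProd _ _ * _), hden, hsign]
  linear_combination (-K * E * ((if i = j then 1 else x j / x i) *
    (if i = j then (1 - (w n : ℂ))⁻¹ else 1) * (if i = j then 1 else (1 - colZ (some (j, n)) x i *
          (cubeMonomial (colT (some (j, n))) w i : ℂ))⁻¹))) * hgap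

/-- The kernels of a column arise from the one for `φ_0` by multiplication with the quotients of the
forms, evaluated on the chain. -/
theorem colKernel_eq {x ell : Fin N → ℂ} (hx : x ∈ slitDomain N)
    (hell : ∀ l, Complex.exp (ell l) = x l) {w : Fin d → ℝ} (hw : w ∈ cube d) (r c : Idx d N) :
    colKernel p r c x ell w = colKernel p none c x ell w * formRatio x (colSigma c x w) r := by
  rcases r with _ | ⟨i, m⟩
  · simp [formRatio]
  · rcases c with _ | ⟨j, n⟩
    · exact colKernel_none_eq (slitDomain_subset_domain0 hx) hw i m
    · exact colKernel_some_eq hx hell hw i j m n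

end Solutions

section Solutions

variable {d N : ℕ} {p : Params d N}

theorem isOpen_slitDomain : IsOpen (slitDomain N) := by
  have : slitDomain N = ⋂ j, ({x : Fin N → ℂ | x j ≠ 0} ∩ {x | 1 - x j ∈ Complex.slitPlane} ∩
      ⋂ i, {x : Fin N → ℂ | i ≠ j → x i ≠ 0 ∧ 1 - x j / x i ∈ Complex.slitPlane}) := by
    ext x
    simp only [slitDomain, domainAt, one_sub_mem_slitPlane_iff, mem_ofPred_eq, mem_iInter,
      mem_inter_iff]
    refine forall_congr' fun j => ?_
    rw [← and_assoc]
    refine and_congr_right fun _ => forall_congr' fun i => forall_congr' fun _ => ?_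
    constructor
    · intro h
      have h0 : x i ≠ 0 := fun h0 => h (h0 ▸ left_mem_segment ℝ 0 (x j))
      exact ⟨h0, (notMem_segment_div_iff h0).2 h⟩
    · rintro ⟨h0, h⟩
      exact (notMem_segment_div_iff h0).1 h
  rw [this]
  refine isOpen_iInter_of_finite fun j => ((isOpen_ne.preimage (by fun_prop)).inter
    (Complex.isOpen_slitPlane.preimage (by fun_prop))).inter
    (isOpen_iInter_of_finite fun i => ?_)
  by_cases hij : i = j
  · simp [hij]
  · simp only [ne_eq, hij, not_false_eq_true, forall_const]
    rw [isOpen_iff_mem_nhds]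
    rintro x ⟨h0, h⟩
    have hc : ContinuousAt (fun x : Fin N → ℂ => 1 - x j / x i) x :=
      continuousAt_const.sub ((continuous_apply j).continuousAt.div
        (continuous_apply i).continuousAt h0)
    filter_upwards [(isOpen_ne.preimage (continuous_apply i)).mem_nhds h0,
      hc (Complex.isOpen_slitPlane.mem_nhds h)] with y h1 h2
    exact ⟨h1, h2⟩

theorem hasFDerivAt_logBranch {Ω : Set (Fin N → ℂ)} (hΩ : IsOpen Ω)
    {lam : Fin N → (Fin N → ℂ) → ℂ} (hlam : IsLogBranch Ω lam) {x : Fin N → ℂ} (hx : x ∈ Ω)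
    (l : Fin N) : HasFDerivAt (lam l)
      ((x l)⁻¹ • (ContinuousLinearMap.proj l : (Fin N → ℂ) →L[ℂ] ℂ)) x := by
  obtain ⟨hc, he⟩ := hlam l
  have hx0 : x l ≠ 0 := he x hx ▸ Complex.exp_ne_zero _
  have hca : ContinuousAt (lam l) x := hc.continuousAt (hΩ.mem_nhds hx)
  -- near `x` the branch is `lam l x + log (y_l / x_l)`
  have hev : ∀ᶠ y in 𝓝 x, lam l y = lam l x + Complex.log (y l / x l) := by
    have h1 : Tendsto (fun y => lam l y - lam l x) (𝓝 x) (𝓝 0) := by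
      simpa using hca.tendsto.sub_const (lam l x)
    filter_upwards [hΩ.mem_nhds hx, h1 (Metric.ball_mem_nhds 0 Real.pi_pos)] with y hy hb
    have hb' : ‖lam l y - lam l x‖ < Real.pi := by simpa using hb
    have him := abs_lt.1 ((Complex.abs_im_le_norm _).trans_lt hb')
    rw [← he y hy, ← he x hx, ← Complex.exp_sub, Complex.log_exp him.1 him.2.le]
    ring
  have hd : HasFDerivAt (fun y : Fin N → ℂ => y l / x l)
      ((x l)⁻¹ • (ContinuousLinearMap.proj l : (Fin N → ℂ) →L[ℂ] ℂ)) x := by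
    simp only [div_eq_mul_inv]
    exact ((ContinuousLinearMap.proj (R := ℂ) (φ := fun _ : Fin N => ℂ) l).hasFDerivAt
      (x := x)).mul_const (x l)⁻¹
  have hlog : HasDerivAt Complex.log (x l / x l)⁻¹ (x l / x l) :=
    Complex.hasDerivAt_log (by rw [div_self hx0]; exact Complex.one_mem_slitPlane)
  have := (hlog.comp_hasFDerivAt x hd).const_add (lam l x)
  rw [div_self hx0, inv_one, one_smul] at this
  exact this.congr_of_eventuallyEq hev

theorem hasFDerivAt_colZ {c : Idx d N} {x : Fin N → ℂ} (hx : ∀ l, x l ≠ 0) :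
    HasFDerivAt (colZ c) (ContinuousLinearMap.pi fun i => ∑ l, (colZ c x i * expEps c l i / x l) •
      (ContinuousLinearMap.proj l : (Fin N → ℂ) →L[ℂ] ℂ)) x := by
  rw [hasFDerivAt_pi]
  intro i
  have hproj : ∀ l, HasFDerivAt (fun y : Fin N → ℂ => y l)
    (ContinuousLinearMap.proj l : (Fin N → ℂ) →L[ℂ] ℂ) x := fun l =>
    (ContinuousLinearMap.proj (R := ℂ) (φ := fun _ : Fin N => ℂ) l).hasFDerivAt (x := x)
  have single : ∀ j : Fin N, (∑ l, (x j * (if l = j then 1 else 0) / x l) •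
      (ContinuousLinearMap.proj l : (Fin N → ℂ) →L[ℂ] ℂ)) = ContinuousLinearMap.proj j := by
    intro j
    ext v
    simp only [sum_apply, smul_apply, ContinuousLinearMap.proj_apply, smul_eq_mul]
    rw [Finset.sum_eq_single j (by intro b _ hb; simp [hb]) (by simp)]
    simp [hx j]
  rcases c with _ | ⟨j, n⟩
  · refine (hproj i).congr_fderiv ?_
    simp only [colZ, expEps]
    exact (single i).symm
  · by_cases hij : i = j
    · subst hij
      simp only [colZ, expEps, if_true, sub_zero]
      exact (hproj i).congr_fderiv (single i).symm
    · simp only [colZ, expEps, hij, if_false]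
      have hinv : HasDerivAt (fun s : ℂ => s⁻¹) (-(x i ^ 2)⁻¹) (x i) := hasDerivAt_inv (hx i)
      have h := (hproj j).mul (hinv.comp_hasFDerivAt x (hproj i))
      refine (h.congr_fderiv ?_)
      have e : ∀ l, (x j / x i * ((if l = j then 1 else 0) - (if l = i then 1 else 0)) / x l) •
          (ContinuousLinearMap.proj l : (Fin N → ℂ) →L[ℂ] ℂ) =
          (x i)⁻¹ • ((x j * (if l = j then 1 else 0) / x l) •
            (ContinuousLinearMap.proj l : (Fin N → ℂ) →L[ℂ] ℂ)) +
          (-(x j / x i ^ 2)) • ((x i * (if l = i then 1 else 0) / x l) •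
            (ContinuousLinearMap.proj l : (Fin N → ℂ) →L[ℂ] ℂ)) := by
        intro l
        ext v
        simp only [add_apply, smul_apply, ContinuousLinearMap.proj_apply, smul_eq_mul]
        have := hx i
        have := hx l
        field_simp
        ring
      rw [Finset.sum_congr rfl fun l _ => e l, Finset.sum_add_distrib, ← Finset.smul_sum,
        ← Finset.smul_sum, single, single, smul_smul, add_comm]
      congr 2
      field_simp

/-- The effect of `x_l ∂/∂x_l` on the integrand of the entry `(r, c)`, in the coordinates of the
cube: the logarithmic derivative. -/
noncomputable def colLogDeriv (p : Params d N) (r c : Idx d N) (x : Fin N → ℂ) (l : Fin N)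
    (w : Fin d → ℝ) : ℂ :=
  expNu p r c l + ∑ i, expEps c l i * (-(expC p r c i * colZ c x i * cubeMonomial (colT c) w i /
    (1 - colZ c x i * cubeMonomial (colT c) w i)))

theorem integrableOn_colKernel_mul_colLogDeriv (hp : p.Convergent) (r c : Idx d N)
    {x : Fin N → ℂ} (hx : x ∈ colDomain c) (ell : Fin N → ℂ) (l : Fin N) :
    IntegrableOn (fun w => colKernel p r c x ell w * colLogDeriv p r c x l w) (cube d) := by
  have hm := continuous_cubeMonomial (colT c)
  refine IntegrableOn.mul_continuousOn_Icc (integrableOn_colKernel hp r c hx ell) ?_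
  unfold colLogDeriv
  refine continuousOn_const.add (continuousOn_finsetSum _ fun i _ =>
    continuousOn_const.mul (ContinuousOn.neg ?_))
  exact ContinuousOn.div (by fun_prop) (by fun_prop)
    fun w hw => one_sub_mul_ne_zero (colZ_mem_domain0 hx) (cubeMonomial_mem_Icc _ hw) i

theorem integral_colKernel (r c : Idx d N) (x ell : Fin N → ℂ) :
    ∫ w in cube d, colKernel p r c x ell w =
      colSign r c * Complex.exp (∑ l, expNu p r c l * ell l) *
        eulerIntegral (expA p r c) (expB p r c) (expC p r c) (colT c) (colZ c x) :=
  integral_const_mul _ _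

/-- The entry `(r, c)` may be differentiated under the integral sign, at fixed cube coordinates. -/
theorem hasFDerivAt_integral_colKernel (hp : p.Convergent) {Ω : Set (Fin N → ℂ)}
    (hΩo : IsOpen Ω) (hΩ : Ω ⊆ slitDomain N) {lam : Fin N → (Fin N → ℂ) → ℂ}
    (hlam : IsLogBranch Ω lam) (r c : Idx d N) {x : Fin N → ℂ} (hx : x ∈ Ω) :
    HasFDerivAt (fun x => ∫ w in cube d, colKernel p r c x (fun l => lam l x) w)
      (∑ l, ((∫ w in cube d, colKernel p r c x (fun l => lam l x) w * colLogDeriv p r c x l w) /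
        x l) • (ContinuousLinearMap.proj l : (Fin N → ℂ) →L[ℂ] ℂ)) x := by
  have hxs := hΩ hx
  have hx0 : ∀ l, x l ≠ 0 := fun l => (hxs l).1
  have hxc := slitDomain_subset_colDomain c hxs
  have hz := colZ_mem_domain0 hxc
  simp only [integral_colKernel]
  have h1 : HasFDerivAt (fun x => ∑ l, expNu p r c l * lam l x)
      (∑ l, (expNu p r c l / x l) • (ContinuousLinearMap.proj l : (Fin N → ℂ) →L[ℂ] ℂ)) x := by
    have := HasFDerivAt.fun_sum (u := Finset.univ) fun l _ =>
      (hasFDerivAt_logBranch hΩo hlam hx l).const_mul (expNu p r c l)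
    refine this.congr_fderiv (Finset.sum_congr rfl fun l _ => ?_)
    rw [smul_smul, div_eq_mul_inv]
  have h2 := (hasFDerivAt_eulerIntegral (expA_re hp r c) (expB_re hp r c) (expC p r c) (colT c)
    hz).comp x (hasFDerivAt_colZ (c := c) hx0)
  have h3 := (h1.cexp.const_mul (colSign r c)).mul h2
  refine h3.congr_fderiv ?_
  ext v
  simp only [add_apply, smul_apply,
    ContinuousLinearMap.comp_apply, sum_apply,
    ContinuousLinearMap.proj_apply, ContinuousLinearMap.pi_apply, smul_eq_mul,
    Function.comp_apply]
  set E := colSign r c * Complex.exp (∑ l, expNu p r c l * lam l x) with hE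
  set K := eulerKernel (expA p r c) (expB p r c) (expC p r c) (colT c) (colZ c x) with hK
  have hD : ∀ l, (∫ w in cube d, colKernel p r c x (fun l => lam l x) w *
      colLogDeriv p r c x l w) = E * (expNu p r c l * eulerIntegral (expA p r c) (expB p r c)
        (expC p r c) (colT c) (colZ c x) + ∑ i, expEps c l i * (colZ c x i *
          ∫ w in cube d, K w * (-(expC p r c i * cubeMonomial (colT c) w i) /
            (1 - colZ c x i * cubeMonomial (colT c) w i)))) := by
    intro l
    have hi := fun i => integrableOn_eulerKernel_mul_deriv (expA_re hp r c) (expB_re hp r c)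
      (expC p r c) (colT c) hz i
    have e : ∀ w, colKernel p r c x (fun l => lam l x) w * colLogDeriv p r c x l w =
        E * (expNu p r c l * K w + ∑ i, expEps c l i * (colZ c x i *
          (K w * (-(expC p r c i * cubeMonomial (colT c) w i) /
            (1 - colZ c x i * cubeMonomial (colT c) w i))))) := by
      intro w
      rw [colKernel, colLogDeriv, ← hE, ← hK, mul_add, mul_add, Finset.mul_sum, Finset.mul_sum]
      congr 1
      · ring
      · refine Finset.sum_congr rfl fun i _ => ?_
        ring
    simp only [e]
    rw [integral_const_mul, integral_add, integral_const_mul, integral_finsetSum]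
    · simp only [integral_const_mul]
      rfl
    · intro i _
      exact ((hi i).const_mul _).const_mul _
    · exact (integrableOn_eulerKernel (expA_re hp r c) (expB_re hp r c) _ _ hz).const_mul _
    · exact integrable_finsetSum _ fun i _ => ((hi i).const_mul _).const_mul _
  simp only [hD]
  simp only [Finset.mul_sum, mul_add, Finset.sum_add_distrib, add_div, add_mul, Finset.sum_div,
    Finset.sum_mul]
  rw [add_comm, Finset.sum_comm]
  congr 1
  · refine Finset.sum_congr rfl fun i _ => ?_
    rw [hE]
    ring
  · refine Finset.sum_congr rfl fun l _ => Finset.sum_congr rfl fun i _ => ?_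
    rw [hE]
    ring

end Solutions

section Solutions

variable {d N : ℕ} {p : Params d N}

/-- Two integrands have the same integral if they differ by one with integral zero, such as those
produced by integration by parts. -/
theorem setIntegral_eq_of_sub_eq {f g t : (Fin d → ℝ) → ℂ} (hf : IntegrableOn f (cube d))
    (ht : IntegrableOn t (cube d)) (ht0 : ∫ w in cube d, t w = 0)
    (h : ∀ w ∈ cube d, f w - t w = g w) : ∫ w in cube d, f w = ∫ w in cube d, g w := by
  rw [← setIntegral_congr_fun measurableSet_cube h, integral_sub hf ht, ht0, sub_zero]

/-- Integration by parts along `w_m` for the entry `(r, c)`. -/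
theorem integral_colKernel_euler (hp : p.Convergent) (r c : Idx d N) {x : Fin N → ℂ}
    (hx : x ∈ colDomain c) (ell : Fin N → ℂ) (m : Fin d) (hm : 0 < (expB p r c m).re) :
    IntegrableOn (fun w => colKernel p r c x ell w *
      (expA p r c m + 1 - expB p r c m * w m / (1 - w m) -
      ∑ i, if m ∈ colT c i then expC p r c i * colZ c x i * cubeMonomial (colT c) w i /
        (1 - colZ c x i * cubeMonomial (colT c) w i) else 0)) (cube d) ∧
    ∫ w in cube d, colKernel p r c x ell w *
      (expA p r c m + 1 - expB p r c m * w m / (1 - w m) -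
      ∑ i, if m ∈ colT c i then expC p r c i * colZ c x i * cubeMonomial (colT c) w i /
        (1 - colZ c x i * cubeMonomial (colT c) w i) else 0) = 0 := by
  obtain ⟨h1, h2⟩ := integral_eulerKernel_euler (expA_re hp r c) (expB_re hp r c) (expC p r c)
    (colT c) (colZ_mem_domain0 hx) m hm
  constructor
  · refine IntegrableOn.congr_fun (h1.const_mul (colSign r c *
      Complex.exp (∑ l, expNu p r c l * ell l))) (fun w _ => ?_) measurableSet_cube
    simp only [colKernel]
    ring
  · have := integral_const_mul (μ := volume.restrict (cube d))
      (colSign r c * Complex.exp (∑ l, expNu p r c l * ell l)) (fun w =>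
      eulerKernel (expA p r c) (expB p r c) (expC p r c) (colT c) (colZ c x) w *
      (expA p r c m + 1 - expB p r c m * w m / (1 - w m) -
      ∑ i, if m ∈ colT c i then expC p r c i * colZ c x i * cubeMonomial (colT c) w i /
        (1 - colZ c x i * cubeMonomial (colT c) w i) else 0))
    rw [h2, mul_zero] at this
    refine Eq.trans ?_ this
    refine integral_congr_ae (ae_of_all _ fun w => ?_)
    simp only [colKernel]
    ring

theorem shiftC_eq_zero {r : Idx d N} {c : Idx d N} {l : Fin N} (hr : ∀ m, r ≠ some (l, m))
    (hc : ∀ n, c ≠ some (l, n)) : shiftC r c l = 0 := by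
  rcases r with _ | ⟨i, m⟩
  · rfl
  · have hi : l ≠ i := by rintro rfl; exact hr m rfl
    rcases c with _ | ⟨j, n⟩
    · simp [shiftC, hi]
    · have hj : l ≠ j := by rintro rfl; exact hc n rfl
      simp [shiftC, hi, hj]

theorem sum_erase_β (j : Fin N) : ∑ i ∈ Finset.univ.erase j, p.β i = (∑ i, p.β i) - p.β j := by
  rw [← Finset.add_sum_erase _ _ (Finset.mem_univ j)]
  ring

/-- The derivative of an entry in the direction `x_l`, when the form has no pole along
`1 = x_l t`, is the integral of the derivative at fixed `t`. In the columns `(l, n)`, where the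
chain moves with `x_l`, this is an integration by parts along `w_n`. -/
theorem integral_colKernel_mul_colLogDeriv (hp : p.Convergent) (r c : Idx d N) {x : Fin N → ℂ}
    (hx : x ∈ slitDomain N) (ell : Fin N → ℂ) (l : Fin N) (hr : ∀ m, r ≠ some (l, m)) :
    ∫ w in cube d, colKernel p r c x ell w * colLogDeriv p r c x l w =
      ∫ w in cube d, colKernel p r c x ell w *
        (p.θ l * (x l * ∏ k, colSigma c x w k) / (x l * ∏ k, colSigma c x w k - 1)) := by
  have hxc := slitDomain_subset_colDomain c hx
  by_cases hc : ∃ n, c = some (l, n)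
  · obtain ⟨n, rfl⟩ := hc
    have hshift : shiftB r (some (l, n)) n = 0 := by
      rcases r with _ | ⟨i, m⟩
      · rfl
      · have hi : i ≠ l := by rintro rfl; exact hr m rfl
        simp only [shiftB, hi, if_false]
        split_ifs with h1 h2
        · rfl
        · exact absurd h1.symm h2
        · rfl
    have hB : expB p r (some (l, n)) n = p.θ l := by simp [expB, baseB, hshift]
    have hA : p.b l n + extraOrder l n r - expA p r (some (l, n)) n - 1 = p.θ l := by
      simp only [Params.b, sum_erase_β, expA, baseA, if_true, Params.θ]
      rcases r with _ | ⟨i, m⟩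
      · simp [extraOrder, shiftA]; ring
      · have hi : i ≠ l := by rintro rfl; exact hr m rfl
        simp only [extraOrder, shiftA, hi, if_false, lt_irrefl, false_and]
        by_cases h : m < n
        · simp [h, h.not_gt]; ring
        · simp [h]; ring
    have hre : 0 < (expB p r (some (l, n)) n).re := by
      rw [hB, Params.θ, Complex.neg_re]
      linarith [hp.β_neg l]
    obtain ⟨i1, i2⟩ := integral_colKernel_euler hp r _ hxc ell n hre
    refine setIntegral_eq_of_sub_eq (integrableOn_colKernel_mul_colLogDeriv hp r _ hxc ell l)
      i1 i2 fun w hw => ?_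
    have hT : ∀ i, n ∈ colT (some (l, n)) i := by
      intro i; simp only [colT]; split_ifs <;> simp
    have hE : ∀ i, expEps (some (l, n)) l i = 1 := by
      intro i
      simp only [expEps, if_true]
      split_ifs with h1 h2
      · simp
      · exact absurd h2.symm h1
      · simp
    rw [← mul_sub]
    congr 1
    simp only [colLogDeriv, hE, hT, if_true, one_mul, Finset.sum_neg_distrib, expNu, hB]
    rw [prod_colSigma_some hw]
    have h0 := (hx l).1
    have hn := ofReal_ne_zero_of_mem hw n
    have hn1 := one_sub_ofReal_ne_zero_of_mem hw n
    have hXe : p.θ l * (x l * (1 / (x l * w n))) / (x l * (1 / (x l * w n)) - 1) =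
        p.θ l + p.θ l * w n / (1 - w n) := by
      have : x l * (1 / (x l * w n)) = 1 / (w n : ℂ) := by field_simp
      rw [this]
      have h2 : 1 / (w n : ℂ) - 1 ≠ 0 := by
        intro h; apply hn1; field_simp at h; linear_combination h
      rw [div_eq_iff h2]
      field_simp
      ring
    rw [hXe, ← hA]
    ring
  · push Not at hc
    refine setIntegral_congr_fun measurableSet_cube fun w hw => ?_
    have hX := colX_sub_one_ne_zero (c := c) hx hw l
    have h1 := one_sub_colZ_ne_zero hxc hw l
    congr 1
    have hC : expC p r c l = p.θ l := by
      rw [expC, shiftC_eq_zero hr hc]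
      rcases c with _ | ⟨j, n⟩
      · simp [baseC]
      · have hj : l ≠ j := by rintro rfl; exact hc n rfl
        simp [baseC, hj]
    rw [colLogDeriv]
    rcases c with _ | ⟨j, n⟩
    · simp only [expEps, ite_mul, one_mul, zero_mul, Finset.sum_ite_eq, Finset.mem_univ, if_true,
        hC, expNu, zero_add]
      rw [cubeMonomial_colT_none] at h1 ⊢
      simp only [colZ, colSigma] at h1 hX ⊢
      rw [← neg_sub 1 (x l * _), div_neg, mul_assoc]
    · have hj : l ≠ j := by rintro rfl; exact hc n rfl
      have hE : ∀ i, expEps (some (j, n)) l i = if l = i then -1 else 0 := by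
        intro i
        simp only [expEps, hj, if_false]
        split_ifs with h2 h3
        · exact absurd (h3.trans h2) hj
        · simp
        · simp
        · simp
      have hN : expNu p r (some (j, n)) l = p.θ l := by
        simp only [expNu, hj, if_false, Params.θ]
        rcases r with _ | ⟨i, m⟩
        · simp
        · have hi : l ≠ i := by rintro rfl; exact hr m rfl
          simp [hi]
      simp only [hE, ite_mul, zero_mul, Finset.sum_ite_eq, Finset.mem_univ, if_true, hC, hN]
      rw [cubeMonomial_colT_ne w hj] at h1 ⊢
      rw [prod_colSigma_some hw] at hX ⊢
      simp only [colZ, hj, if_false] at h1 hX ⊢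
      have hj0 := (hx j).1
      have hl0 := (hx l).1
      have hn := ofReal_ne_zero_of_mem hw n
      rw [eq_div_iff hX]
      have h3 : x l - x j * w n ≠ 0 := by
        intro h
        apply h1
        have : x j / x l * w n = (x j * w n) / x l := by ring
        rw [this, ← sub_eq_zero.1 h, div_self hl0, sub_self]
      have h4 : x l - w n * x j ≠ 0 := by rwa [mul_comm]
      field_simp
      ring

theorem sum_expNu_some (i j : Fin N) (m n : Fin d) :
    ∑ l, expNu p (some (i, m)) (some (j, n)) l = -p.γ n + if m < n then 1 else 0 := by
  have h : ∀ l, expNu p (some (i, m)) (some (j, n)) l =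
      (if l = j then p.b j n + extraOrder j n (some (i, m)) + p.β j +
        (if i = j then 1 else 0) else 0) + (-p.β l) + (if l = i then -1 else 0) := by
    intro l
    simp only [expNu]
    by_cases h1 : l = j
    · subst h1
      by_cases h2 : l = i
      · subst h2; simp; ring
      · have h3 : i ≠ l := fun h => h2 h.symm
        simp [h2, h3]
    · simp only [h1, if_false]
      split_ifs <;> simp
      ring
  rw [Finset.sum_congr rfl fun l _ => h l, Finset.sum_add_distrib, Finset.sum_add_distrib,
    Finset.sum_ite_eq', Finset.sum_ite_eq', Finset.sum_neg_distrib]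
  simp only [Finset.mem_univ, if_true, Params.b, sum_erase_β, extraOrder]
  split_ifs <;> simp <;> ring

/-- The total Euler operator on a form with a pole. Apart from the column `(j, m)`, where it is a
pointwise identity, this is an integration by parts along `w_m`. -/
theorem sum_integral_colKernel_mul_colLogDeriv (hp : p.Convergent) (c : Idx d N)
    {x : Fin N → ℂ} (hx : x ∈ slitDomain N) (ell : Fin N → ℂ) (i : Fin N) (m : Fin d) :
    ∑ l, ∫ w in cube d, colKernel p (some (i, m)) c x ell w * colLogDeriv p (some (i, m)) c x l w =
      ∫ w in cube d, colKernel p (some (i, m)) c x ell w *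
        (-p.α m + p.η m * colSigma c x w m / (1 - colSigma c x w m)) := by
  have hxc := slitDomain_subset_colDomain c hx
  have hint := fun l => integrableOn_colKernel_mul_colLogDeriv hp (some (i, m)) c hxc ell l
  rw [← integral_finsetSum _ fun l _ => hint l]
  have hint' := integrable_finsetSum (μ := volume.restrict (cube d)) Finset.univ fun l _ => hint l
  have hηpos : 0 < (p.η m).re := by
    simp only [Params.η, Complex.sub_re]; linarith [hp.α_lt_γ m]
  have hlog : ∀ w, ∑ l, colLogDeriv p (some (i, m)) c x l w = (∑ l, expNu p (some (i, m)) c l) +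
      ∑ q, (∑ l, expEps c l q) * (-(expC p (some (i, m)) c q * colZ c x q *
        cubeMonomial (colT c) w q / (1 - colZ c x q * cubeMonomial (colT c) w q))) := by
    intro w
    simp only [colLogDeriv, Finset.sum_add_distrib, Finset.sum_mul]
    rw [Finset.sum_comm]
  simp only [← Finset.mul_sum, hlog] at hint' ⊢
  rcases c with _ | ⟨j, n⟩
  · have hB : expB p (some (i, m)) none m = p.η m := by simp [expB, baseB, shiftB]
    have hA : expA p (some (i, m)) none m = p.α m - 1 := by simp [expA, baseA, shiftA]
    obtain ⟨i1, i2⟩ := integral_colKernel_euler hp (some (i, m)) none hxc ell m (by rwa [hB])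
    refine setIntegral_eq_of_sub_eq hint' i1 i2 fun w hw => ?_
    simp only [← mul_sub, hA, hB, expNu, expEps, colT, Finset.mem_univ, if_true,
      Finset.sum_ite_eq', Finset.sum_const_zero, one_mul, Finset.sum_neg_distrib, colSigma]
    ring
  · have hE : ∀ q, ∑ l, expEps (some (j, n)) l q = if q = j then 1 else 0 := by
      intro q
      simp only [expEps, Finset.sum_sub_distrib]
      split_ifs <;> simp
    simp only [hE, ite_mul, one_mul, zero_mul, Finset.sum_ite_eq', Finset.mem_univ, if_true,
      sum_expNu_some] at hint' ⊢
    by_cases hmn : m = n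
    · subst hmn
      refine setIntegral_congr_fun measurableSet_cube fun w hw => ?_
      have h1 := one_sub_colZ_ne_zero hxc hw j
      have h2 := one_sub_colSigma_ne_zero (c := some (j, m)) hx hw m
      congr 1
      have hC : expC p (some (i, m)) (some (j, m)) j = p.η m := by
        simp only [expC, baseC, shiftC, if_true]
        split_ifs <;> simp
        rename_i h3 h4
        exact absurd h3.symm h4
      simp only [hC, lt_irrefl, if_false]
      rw [cubeMonomial_colT_self] at h1 ⊢
      simp only [colZ, colSigma, if_true, Function.update_self] at h1 h2 ⊢
      have hj0 := (hx j).1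
      have hS := prod_ofReal_ne_zero hw Finset.univ
      generalize ∏ k, (w k : ℂ) = S at h1 h2 hS ⊢
      have h3 : x j * S - 1 ≠ 0 := by rw [← neg_ne_zero, neg_sub]; exact h1
      have h4 : p.η m * (1 / (x j * S)) / (1 - 1 / (x j * S)) = -(p.η m / (1 - x j * S)) := by
        rw [div_eq_iff h2]
        field_simp
        ring
      rw [h4]
      field_simp
      simp only [Params.η]
      ring
    · have hB : expB p (some (i, m)) (some (j, n)) m = p.η m := by
        simp [expB, baseB, shiftB, hmn]
      have hA : expA p (some (i, m)) (some (j, n)) m + 1 =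
          p.α m - p.γ n + if m < n then 1 else 0 := by
        simp only [expA, baseA, shiftA, hmn, if_false, lt_irrefl, le_refl, and_true]
        rcases lt_or_gt_of_ne hmn with h | h
        · simp [h]
        · simp [h, h.not_gt]
      have hT : ∀ q, m ∈ colT (some (j, n)) q ↔ q = j := by
        intro q; simp only [colT]; split_ifs with h <;> simp [h, hmn]
      obtain ⟨i1, i2⟩ := integral_colKernel_euler hp (some (i, m)) (some (j, n)) hxc ell m
        (by rwa [hB])
      refine setIntegral_eq_of_sub_eq hint' i1 i2 fun w hw => ?_
      simp only [← mul_sub, hA, hB, hT, Finset.sum_ite_eq', Finset.mem_univ, if_true, colSigma,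
        ne_eq, hmn, not_false_eq_true, Function.update_of_ne]
      ring

/-- The columns of Euler integrals solve the Pfaffian system. -/
theorem isSolution_integral_colKernel (hp : p.Convergent) {Ω : Set (Fin N → ℂ)}
    (hΩo : IsOpen Ω) (hΩ : Ω ⊆ slitDomain N) {lam : Fin N → (Fin N → ℂ) → ℂ}
    (hlam : IsLogBranch Ω lam) (c : Idx d N) :
    IsSolution p Ω fun x r => ∫ w in cube d, colKernel p r c x (fun l => lam l x) w := by
  intro x hx
  have hxs := hΩ hx
  have hell : ∀ l, Complex.exp (lam l x) = x l := fun l => (hlam l).2 x hx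
  have hD := hasFDerivAt_pi.2 fun r => hasFDerivAt_integral_colKernel hp hΩo hΩ hlam r c hx
  refine ⟨hD.differentiableAt, fun v => ?_⟩
  rw [hD.fderiv]
  ext r
  have key := pfaffForm_mulVec_integral p (fun i => (hxs i).1) (ne_one_of_mem_slitDomain hxs)
    (fun i j hij => ne_of_mem_slitDomain hxs hij) (σ := colSigma c x)
    (G := fun r => colKernel p r c x (fun l => lam l x))
    (fun r => integrableOn_colKernel hp r c (slitDomain_subset_colDomain c hxs) _)
    (fun w hw r => colKernel_eq hxs hell hw r c)
    (fun w hw i => colX_sub_one_ne_zero hxs hw i)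
    (fun w hw m => one_sub_colSigma_ne_zero hxs hw m)
    (fun l r hr => integral_colKernel_mul_colLogDeriv hp r c hxs _ l hr)
    (fun i m => sum_integral_colKernel_mul_colLogDeriv hp c hxs _ i m) v r
  rw [key]
  simp only [ContinuousLinearMap.pi_apply, sum_apply, smul_apply, ContinuousLinearMap.proj_apply,
    smul_eq_mul]
  refine Finset.sum_congr rfl fun l _ => ?_
  ring

end Solutions

/-! ### Cube coordinates on the chains -/

section Simplex

variable {d N : ℕ}

/-- The simplex in terms of the ratios of consecutive coordinates: `u_k = s_0 ⋯ s_k`. -/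
noncomputable def simplexMap (s : Fin d → ℝ) (k : Fin d) : ℝ := Fin.partialProd s k.succ

theorem homog_partialProd {M : Type*} [CommMonoid M] (s : Fin d → M) :
    homog (fun k => Fin.partialProd s k.succ) = Fin.partialProd s := by
  ext m
  refine Fin.cases ?_ (fun k => ?_) m
  · simp [homog]
  · simp [homog]

theorem homog_simplexMap (s : Fin d → ℝ) : homog (simplexMap s) = Fin.partialProd s :=
  homog_partialProd s

theorem partialProd_pos {s : Fin d → ℝ} (hs : s ∈ cube d) (m : Fin (d + 1)) :
    0 < Fin.partialProd s m := by
  induction m using Fin.induction with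
  | zero => simp
  | succ k ih =>
    rw [Fin.partialProd_succ]
    exact mul_pos ih (mem_cube.1 hs k).1

theorem image_simplexMap : simplexMap '' cube d = simplex d := by
  ext u
  constructor
  · rintro ⟨s, hs, rfl⟩
    refine ⟨fun k => ?_, ?_⟩
    · rw [homog_simplexMap, Fin.partialProd_succ]
      exact mul_lt_of_lt_one_right (partialProd_pos hs _) (mem_cube.1 hs k).2
    · rw [homog_simplexMap]
      exact partialProd_pos hs _
  · rintro ⟨h1, h2⟩
    have hpos : ∀ m, 0 < homog u m := fun m => by
      induction m using Fin.reverseInduction with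
      | last => exact h2
      | cast k ih => exact ih.trans (h1 k)
    have hp : Fin.partialProd (fun k => homog u k.succ / homog u k.castSucc) = homog u := by
      ext m
      induction m using Fin.induction with
      | zero => simp [homog]
      | succ k ih => rw [Fin.partialProd_succ, ih, mul_div_cancel₀ _ (hpos _).ne']
    refine ⟨fun k => homog u k.succ / homog u k.castSucc, mem_cube.2 fun k => ⟨?_, ?_⟩, ?_⟩
    · exact div_pos (hpos _) (hpos _)
    · exact (div_lt_one (hpos _)).2 (h1 k)
    · ext k
      rw [simplexMap, hp]
      simp [homog]

theorem injOn_simplexMap : InjOn simplexMap (cube d) := by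
  intro s hs t ht h
  have h' : Fin.partialProd s = Fin.partialProd t := by
    rw [← homog_simplexMap, ← homog_simplexMap, h]
  ext k
  have h1 := congrFun h' k.succ
  rw [Fin.partialProd_succ, Fin.partialProd_succ, ← congrFun h' k.castSucc] at h1
  exact mul_left_cancel₀ (partialProd_pos hs _).ne' h1

theorem simplexMap_apply (s : Fin d → ℝ) (k : Fin d) :
    simplexMap s k = ∏ l ∈ Finset.Iic k, s l := by
  rw [simplexMap, Fin.partialProd_succ, partialProd_castSucc, mul_comm, ← Finset.Iio_insert,
    Finset.prod_insert (by simp)]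

/-- The differential of `simplexMap`. -/
noncomputable def simplexDeriv (s : Fin d → ℝ) : (Fin d → ℝ) →L[ℝ] (Fin d → ℝ) :=
  ContinuousLinearMap.pi fun k => ∑ i ∈ Finset.Iic k, (∏ j ∈ (Finset.Iic k).erase i, s j) •
    (ContinuousLinearMap.proj i : (Fin d → ℝ) →L[ℝ] ℝ)

theorem hasFDerivAt_simplexMap (s : Fin d → ℝ) :
    HasFDerivAt simplexMap (simplexDeriv s) s := by
  rw [hasFDerivAt_pi']
  intro k
  have h := HasFDerivAt.finsetProd (u := Finset.Iic k) (x := s) fun i _ =>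
    (ContinuousLinearMap.proj (R := ℝ) (φ := fun _ : Fin d => ℝ) i).hasFDerivAt (x := s)
  have e : (fun s : Fin d → ℝ => simplexMap s k) = fun s => ∏ l ∈ Finset.Iic k, s l := by
    ext s; exact simplexMap_apply s k
  rw [e]
  exact h

theorem det_simplexDeriv (s : Fin d → ℝ) :
    (simplexDeriv s).det = ∏ k : Fin d, Fin.partialProd s k.castSucc := by
  rw [ContinuousLinearMap.det, ← LinearMap.det_toMatrix', Matrix.det_of_isLowerTriangular]
  · refine Finset.prod_congr rfl fun k _ => ?_
    rw [LinearMap.toMatrix'_apply, partialProd_castSucc]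
    simp only [simplexDeriv, ContinuousLinearMap.coe_coe, ContinuousLinearMap.pi_apply, sum_apply,
      smul_apply, ContinuousLinearMap.proj_apply, smul_eq_mul]
    rw [Finset.sum_eq_single k (by intro b _ hb; simp [hb]) (by simp)]
    rw [Pi.single_eq_same, mul_one]
    refine Finset.prod_congr ?_ fun _ _ => rfl
    ext l; simp [lt_iff_le_and_ne, and_comm]
  · intro k l hkl
    have hkl' : k < l := hkl
    rw [LinearMap.toMatrix'_apply]
    simp only [simplexDeriv, ContinuousLinearMap.coe_coe, ContinuousLinearMap.pi_apply, sum_apply,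
      smul_apply, ContinuousLinearMap.proj_apply, smul_eq_mul]
    refine Finset.sum_eq_zero fun i hi => ?_
    have : i ≠ l := ((Finset.mem_Iic.1 hi).trans_lt hkl').ne
    simp [this]

theorem abs_det_simplexDeriv {s : Fin d → ℝ} (hs : s ∈ cube d) :
    |(simplexDeriv s).det| = ∏ k : Fin d, Fin.partialProd s k.castSucc := by
  rw [det_simplexDeriv, abs_of_nonneg]
  exact Finset.prod_nonneg fun k _ => (partialProd_pos hs _).le

theorem setIntegral_simplex (g : (Fin d → ℝ) → ℂ) : ∫ u in simplex d, g u =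
    ∫ s in cube d, ((∏ k : Fin d, Fin.partialProd s k.castSucc : ℝ) : ℂ) * g (simplexMap s) := by
  rw [← image_simplexMap, integral_image_eq_integral_abs_det_fderiv_smul volume measurableSet_cube
    (fun s _ => (hasFDerivAt_simplexMap s).hasFDerivWithinAt) injOn_simplexMap]
  refine setIntegral_congr_fun measurableSet_cube fun s hs => ?_
  simp only [abs_det_simplexDeriv hs, Complex.real_smul]

theorem integrableOn_simplex_iff (g : (Fin d → ℝ) → ℂ) : IntegrableOn g (simplex d) ↔
    IntegrableOn (fun s => ((∏ k : Fin d, Fin.partialProd s k.castSucc : ℝ) : ℂ) *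
      g (simplexMap s)) (cube d) := by
  rw [← image_simplexMap, integrableOn_image_iff_integrableOn_abs_det_fderiv_smul volume
    measurableSet_cube (fun s _ => (hasFDerivAt_simplexMap s).hasFDerivWithinAt) injOn_simplexMap]
  refine integrableOn_congr_fun (fun s hs => ?_) measurableSet_cube
  simp only [abs_det_simplexDeriv hs, Complex.real_smul]

theorem comp_perm_mem_cube_iff (e : Equiv.Perm (Fin d)) (w : Fin d → ℝ) :
    w ∘ e ∈ cube d ↔ w ∈ cube d := by
  simp only [mem_cube, Function.comp_apply]
  exact ⟨fun h k => by simpa using h (e.symm k), fun h k => h (e k)⟩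

theorem measurePreserving_comp_perm (e : Equiv.Perm (Fin d)) :
    MeasurePreserving (MeasurableEquiv.piCongrLeft (fun _ : Fin d => ℝ) e)
      (volume.restrict (cube d)) (volume.restrict (cube d)) := by
  have h := (volume_measurePreserving_piCongrLeft (fun _ : Fin d => ℝ) e).restrict_preimage_emb
    (MeasurableEquiv.measurableEmbedding _) (cube d)
  have hpre : (MeasurableEquiv.piCongrLeft (fun _ : Fin d => ℝ) e) ⁻¹' cube d = cube d := by
    ext w
    rw [mem_preimage, ← comp_perm_mem_cube_iff e]
    have : (MeasurableEquiv.piCongrLeft (fun _ : Fin d => ℝ) e) w ∘ e = w := by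
      ext k
      exact Equiv.piCongrLeft_apply_apply (fun _ => ℝ) e w k
    rw [this]
  rwa [hpre] at h

theorem piCongrLeft_eq_comp (e : Equiv.Perm (Fin d)) (w : Fin d → ℝ) :
    (MeasurableEquiv.piCongrLeft (fun _ : Fin d => ℝ) e) w = w ∘ e.symm := by
  ext k
  obtain ⟨l, rfl⟩ := e.surjective k
  rw [Function.comp_apply, e.symm_apply_apply]
  exact Equiv.piCongrLeft_apply_apply (fun _ => ℝ) e w l

/-- Change of variables from the simplex to the cube, with the cube coordinates permuted by `e`. -/
theorem setIntegral_simplex_perm (e : Equiv.Perm (Fin d)) (g : (Fin d → ℝ) → ℂ) :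
    ∫ u in simplex d, g u = ∫ w in cube d,
      ((∏ k : Fin d, Fin.partialProd (w ∘ e.symm) k.castSucc : ℝ) : ℂ) *
        g (simplexMap (w ∘ e.symm)) := by
  rw [setIntegral_simplex, ← (measurePreserving_comp_perm e).integral_comp']
  simp only [piCongrLeft_eq_comp]

theorem integrableOn_simplex_perm_iff (e : Equiv.Perm (Fin d)) (g : (Fin d → ℝ) → ℂ) :
    IntegrableOn g (simplex d) ↔ IntegrableOn (fun w =>
      ((∏ k : Fin d, Fin.partialProd (w ∘ e.symm) k.castSucc : ℝ) : ℂ) *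
        g (simplexMap (w ∘ e.symm))) (cube d) := by
  rw [integrableOn_simplex_iff, IntegrableOn, ← (measurePreserving_comp_perm e).integrable_comp_emb
    (MeasurableEquiv.measurableEmbedding _)]
  simp only [Function.comp_def, piCongrLeft_eq_comp]
  rfl

end Simplex

section Jacobian

variable {d : ℕ}

/-- The Jacobian determinant of a projective transformation in affine coordinates. -/
theorem jacobian_dehomog (A : Matrix (Fin (d + 1)) (Fin (d + 1)) ℂ) (u : Fin d → ℝ)
    (h0 : (A.mulVec (homog fun k => (u k : ℂ))) 0 ≠ 0) :
    jacobian (fun u : Fin d → ℝ => dehomog (A.mulVec (homog fun k => (u k : ℂ)))) u =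
      A.det / (A.mulVec (homog fun k => (u k : ℂ)) 0) ^ (d + 1) := by
  set g : Fin (d + 1) → (Fin d → ℝ) → ℂ := fun m u => A.mulVec (homog fun k => (u k : ℂ)) m
    with hg
  have hgu : ∀ m u, g m u = A m 0 + ∑ l : Fin d, A m l.succ * (u l : ℂ) := by
    intro m u
    simp only [hg, Matrix.mulVec, dotProduct, Fin.sum_univ_succ, homog, Fin.cons_zero,
      Fin.cons_succ, mul_one]
  have hder : ∀ m, HasFDerivAt (g m) (∑ l : Fin d, A m l.succ •
      (Complex.ofRealCLM.comp (ContinuousLinearMap.proj l : (Fin d → ℝ) →L[ℝ] ℝ))) u := by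
    intro m
    have h1 : ∀ l : Fin d, HasFDerivAt (fun u : Fin d → ℝ => A m l.succ * (u l : ℂ))
        (A m l.succ • (Complex.ofRealCLM.comp
          (ContinuousLinearMap.proj l : (Fin d → ℝ) →L[ℝ] ℝ))) u := fun l =>
      ((Complex.ofRealCLM.comp (ContinuousLinearMap.proj (R := ℝ)
        (φ := fun _ : Fin d => ℝ) l)).hasFDerivAt).const_mul _
    have := (HasFDerivAt.fun_sum (u := Finset.univ) fun l _ => h1 l).const_add (A m 0)
    have e : g m = fun u : Fin d → ℝ => A m 0 + ∑ l : Fin d, A m l.succ * (u l : ℂ) := by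
      ext u; exact hgu m u
    rw [e]
    exact this
  have hpart : ∀ m l, (∑ l : Fin d, A m l.succ • (Complex.ofRealCLM.comp
      (ContinuousLinearMap.proj l : (Fin d → ℝ) →L[ℝ] ℝ))) (Pi.single l 1) = A m l.succ := by
    intro m l
    simp only [sum_apply, smul_apply, ContinuousLinearMap.comp_apply,
      ContinuousLinearMap.proj_apply, smul_eq_mul]
    rw [Finset.sum_eq_single l (by intro b _ hb; simp [hb]) (by simp)]
    simp
  have hg0 : g 0 u ≠ 0 := h0
  have hM : ∀ k l : Fin d, fderiv ℝ (fun u : Fin d → ℝ =>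
      dehomog (A.mulVec (homog fun k => (u k : ℂ)))) u (Pi.single l 1) k =
      (g 0 u)⁻¹ * (A k.succ l.succ - g k.succ u / g 0 u * A 0 l.succ) := by
    intro k l
    have hinv : HasFDerivAt (fun u => (g 0 u)⁻¹) _ u :=
      ((hasDerivAt_inv hg0).hasFDerivAt.restrictScalars ℝ).comp u (hder 0)
    have hT := hasFDerivAt_pi.2 fun k : Fin d => (hder k.succ).mul hinv
    have e : (fun u : Fin d → ℝ => dehomog (A.mulVec (homog fun k => (u k : ℂ)))) =
        fun u k => g k.succ u * (g 0 u)⁻¹ := by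
      ext u k
      simp [dehomog, hg, div_eq_mul_inv]
    rw [e, HasFDerivAt.fderiv (f := fun (u : Fin d → ℝ) (k : Fin d) => g k.succ u * (g 0 u)⁻¹) hT]
    simp only [ContinuousLinearMap.pi_apply, add_apply, smul_apply, smul_eq_mul,
      ContinuousLinearMap.comp_apply, ContinuousLinearMap.coe_restrictScalars', hpart,
      ContinuousLinearMap.toSpanSingleton_apply]
    field_simp
    ring
  -- replace the column `0` of `A` by `A (1, u)`, and clear it below the diagonal
  have hdet1 : (A.updateCol 0 fun m => g m u).det = A.det := by
    have := Matrix.det_updateCol_sum A 0 (homog fun k => (u k : ℂ))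
    simp only [smul_eq_mul, homog, Fin.cons_zero, one_mul] at this
    rw [← this]
    congr 2
    ext m
    simp only [hg, Matrix.mulVec, dotProduct, homog, mul_comm]
  set B : Matrix (Fin (d + 1)) (Fin (d + 1)) ℂ := Matrix.of fun m l =>
    (A.updateCol 0 fun m => g m u) m l -
      (if m = 0 then 0 else g m u / g 0 u) * (A.updateCol 0 fun m => g m u) 0 l with hB
  have hdet2 : (A.updateCol 0 fun m => g m u).det = B.det := by
    refine Matrix.det_eq_of_forall_row_eq_smul_add_const
      (fun m => if m = 0 then 0 else g m u / g 0 u) 0 (by simp) fun m l => ?_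
    simp only [hB, Matrix.of_apply, if_true, zero_mul, sub_zero]
    ring
  have hdet3 : B.det = g 0 u * (B.submatrix Fin.succ Fin.succ).det := by
    rw [Matrix.det_succ_column_zero, Fin.sum_univ_succ, Finset.sum_eq_zero]
    · simp [hB]
    · intro k _
      have : B k.succ 0 = 0 := by
        simp only [hB, Matrix.of_apply, Matrix.updateCol_self, Fin.succ_ne_zero, if_false]
        field_simp
        ring
      rw [this, mul_zero, zero_mul]
  have hsub : (Matrix.of fun k l : Fin d => fderiv ℝ (fun u : Fin d → ℝ =>
      dehomog (A.mulVec (homog fun k => (u k : ℂ)))) u (Pi.single l 1) k) =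
      (g 0 u)⁻¹ • B.submatrix Fin.succ Fin.succ := by
    ext k l
    rw [Matrix.of_apply, hM]
    simp [hB]
  rw [jacobian, hsub, Matrix.det_smul, Fintype.card_fin, ← hdet1, hdet2, hdet3, pow_succ, inv_pow]
  change _ = _ / (g 0 u ^ d * g 0 u)
  field_simp

end Jacobian

/-! ### The cyclic substitutions -/

section Cyclic

variable {d N : ℕ}

/-- The linear map `cycInv ξ`. -/
noncomputable def cycInvLin (d : ℕ) (ξ : ℂ) : (Fin (d + 1) → ℂ) →ₗ[ℂ] (Fin (d + 1) → ℂ) where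
  toFun := cycInv ξ
  map_add' τ τ' := by
    ext m
    refine Fin.cases ?_ (fun k => ?_) m
    · simp [cycInv, mul_add]
    · simp [cycInv, Fin.init]
  map_smul' a τ := by
    ext m
    refine Fin.cases ?_ (fun k => ?_) m
    · simp [cycInv]; ring
    · simp [cycInv, Fin.init]

theorem det_cycInvLin (ξ : ℂ) :
    LinearMap.det (cycInvLin d ξ) = ξ * LinearMap.det (cycInvLin d 1) := by
  have h : cycInvLin d ξ =
      Matrix.toLin' (Matrix.diagonal (Fin.cons ξ fun _ => 1)) ∘ₗ cycInvLin d 1 := by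
    ext1 τ
    ext m
    simp only [LinearMap.comp_apply, Matrix.toLin'_apply, Matrix.mulVec_diagonal]
    refine Fin.cases ?_ (fun k => ?_) m
    · simp [cycInvLin, cycInv]
    · simp [cycInvLin, cycInv]
  rw [h, LinearMap.det_comp, LinearMap.det_toLin', Matrix.det_diagonal, Fin.prod_univ_succ]
  simp

theorem det_cycInvLin_one_ne_zero : LinearMap.det (cycInvLin d 1) ≠ 0 := by
  have h : Function.Bijective (cycInvLin d 1) := by
    rw [Function.bijective_iff_has_inverse]
    exact ⟨cyc 1, fun τ => cyc_cycInv one_ne_zero τ, fun τ => cycInv_cyc one_ne_zero τ⟩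
  exact (LinearEquiv.isUnit_det' (LinearEquiv.ofBijective _ h)).ne_zero

theorem cycInvLin_pow_apply (ξ : ℂ) (m : ℕ) (τ : Fin (d + 1) → ℂ) :
    (cycInvLin d ξ ^ m) τ = (cycInv ξ)^[m] τ := by
  rw [Module.End.pow_apply]
  rfl

theorem prod_cycInv (ξ : ℂ) (τ : Fin (d + 1) → ℂ) : ∏ m, cycInv ξ τ m = ξ * ∏ m, τ m := by
  rw [Fin.prod_univ_succ, Fin.prod_univ_castSucc (n := d) τ]
  simp [cycInv, Fin.init]
  ring

theorem prod_iterate_cycInv (ξ : ℂ) (n : ℕ) (τ : Fin (d + 1) → ℂ) :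
    ∏ m, (cycInv ξ)^[n] τ m = ξ ^ n * ∏ m, τ m := by
  induction n with
  | zero => simp
  | succ n ih => rw [Function.iterate_succ_apply', prod_cycInv, ih, pow_succ]; ring

/-- `ρ` is the sequence of successive ratios of the sequence `τ`, prolonged periodically up to the
factor `ξ`. -/
def IsRatio (ξ : ℂ) (τ ρ : Fin (d + 1) → ℂ) : Prop :=
  (∀ k : Fin d, τ k.succ = τ k.castSucc * ρ k.succ) ∧ τ 0 = ξ * τ (Fin.last d) * ρ 0

/-- The inverse cyclic substitution rotates the ratios by one place. -/
theorem IsRatio.cycInv {ξ : ℂ} {τ ρ : Fin (d + 1) → ℂ} (h : IsRatio ξ τ ρ) :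
    IsRatio ξ (cycInv ξ τ) fun m => ρ (m - 1) := by
  have key : ∀ m, τ m = HGPfaff.cycInv ξ τ m * ρ m := fun m => by
    refine Fin.cases ?_ (fun k => ?_) m
    · simpa [HGPfaff.cycInv] using h.2
    · simpa [HGPfaff.cycInv, Fin.init] using h.1 k
  refine ⟨fun k => ?_, ?_⟩
  · have : k.succ - 1 = k.castSucc := by
      rw [sub_eq_iff_eq_add, Fin.coeSucc_eq_succ]
    simp only [this]
    rw [← key]
    simp [HGPfaff.cycInv, Fin.init]
  · have : (0 : Fin (d + 1)) - 1 = Fin.last d := by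
      rw [sub_eq_iff_eq_add, Fin.last_add_one]
    simp only [this]
    rw [mul_assoc, ← key]
    simp [HGPfaff.cycInv]

theorem IsRatio.iterate_cycInv {ξ : ℂ} {τ ρ : Fin (d + 1) → ℂ} (h : IsRatio ξ τ ρ)
    (s : Fin (d + 1)) : IsRatio ξ ((HGPfaff.cycInv ξ)^[s] τ) fun m => ρ (m - s) := by
  induction s using Fin.induction with
  | zero => simpa using h
  | succ i ih =>
    have := ih.cycInv
    rw [Fin.val_succ, Function.iterate_succ_apply']
    have e : ∀ m : Fin (d + 1), m - i.succ = m - 1 - i.castSucc := fun m => by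
      rw [← Fin.coeSucc_eq_succ, sub_add_eq_sub_sub_swap]
    simp only [e]
    exact this

/-- The ratio at the place `0`, across the end of the period, is the inverse of `ξ` times the
product of the other ratios. -/
theorem isRatio_partialProd {ξ : ℂ} (s : Fin d → ℂ) (h : ξ * ∏ k, s k ≠ 0) :
    IsRatio ξ (Fin.partialProd s) (Fin.cons (1 / (ξ * ∏ k, s k)) s) := by
  refine ⟨fun k => by simp [Fin.partialProd_succ], ?_⟩
  rw [partialProd_last, Fin.partialProd_zero, Fin.cons_zero, mul_one_div_cancel h]

theorem IsRatio.eq_mul_partialProd {ξ : ℂ} {τ ρ : Fin (d + 1) → ℂ} (h : IsRatio ξ τ ρ)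
    (m : Fin (d + 1)) : τ m = τ 0 * Fin.partialProd (fun k : Fin d => ρ k.succ) m := by
  induction m using Fin.induction with
  | zero => simp
  | succ k ih => rw [h.1, ih, Fin.partialProd_succ]; ring

/-- The places in `Δ_0` of the ratios of the coordinates on the chain `(j, n)`, apart from the one
at the place `n` that involves `x_j`. -/
def ratioPlace (n k : Fin d) : Fin (d + 1) := if k = n then -n.succ else k.succ - n.succ

theorem ratioPlace_ne_zero (n k : Fin d) : ratioPlace n k ≠ 0 := by
  rw [ratioPlace]
  split_ifs with h
  · rw [neg_ne_zero]; exact Fin.succ_ne_zero n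
  · rw [sub_ne_zero]; exact fun h' => h (Fin.succ_injective _ h')

theorem ratioPlace_injective (n : Fin d) : Function.Injective (ratioPlace n) := by
  intro k l h
  unfold ratioPlace at h
  split_ifs at h with hk hl hl
  · rw [hk, hl]
  · rw [eq_sub_iff_add_eq, neg_add_cancel] at h
    exact absurd h.symm (Fin.succ_ne_zero l)
  · rw [eq_comm, eq_sub_iff_add_eq, neg_add_cancel] at h
    exact absurd h.symm (Fin.succ_ne_zero k)
  · exact Fin.succ_injective _ (sub_left_injective h)

/-- The permutation of the cube coordinates by which the parametrization of the chain `c` takes the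
form `colSigma`. -/
noncomputable def chainPerm (c : Idx d N) : Equiv.Perm (Fin d) :=
  match c with
  | none => Equiv.refl _
  | some (_, n) => Equiv.ofBijective (fun k => (ratioPlace n k).pred (ratioPlace_ne_zero n k))
      (Finite.injective_iff_bijective.1 fun _ _ h => ratioPlace_injective n (Fin.pred_inj.1 h))

/-- The sign by which the orientation of the chain `c` differs from the one given by the cube
coordinates: a power of the determinant of the cyclic permutation. -/
noncomputable def chainSign (c : Idx d N) : ℂ :=
  match c with
  | none => 1
  | some (_, n) => LinearMap.det (cycInvLin d 1) ^ ((n : ℕ) + 1)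

theorem chainSign_ne_zero (c : Idx d N) : chainSign c ≠ 0 := by
  rcases c with _ | ⟨_, n⟩
  · exact one_ne_zero
  · exact pow_ne_zero _ det_cycInvLin_one_ne_zero

/-- The parametrization of the simplex used over the chain `c`. -/
noncomputable def chainCube (c : Idx d N) (w : Fin d → ℝ) : Fin d → ℝ :=
  simplexMap (w ∘ (chainPerm c).symm)

theorem ofReal_partialProd (s : Fin d → ℝ) (m : Fin (d + 1)) :
    ((Fin.partialProd s m : ℝ) : ℂ) = Fin.partialProd (fun k => (s k : ℂ)) m := by
  induction m using Fin.induction with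
  | zero => simp
  | succ k ih => rw [Fin.partialProd_succ, Fin.partialProd_succ, Complex.ofReal_mul, ih]

theorem homog_ofReal_simplexMap (s : Fin d → ℝ) :
    homog (fun k => (simplexMap s k : ℂ)) = Fin.partialProd fun k => (s k : ℂ) := by
  rw [← homog_partialProd]
  congr 1
  ext k
  exact ofReal_partialProd s k.succ

theorem isRatio_chain {j : Fin N} {n : Fin d} {x : Fin N → ℂ} (hj : x j ≠ 0) {w : Fin d → ℝ}
    (hw : w ∈ cube d) : IsRatio (x j) ((cycInv (x j))^[(n : ℕ) + 1]
      (homog fun k => (chainCube (some (j, n)) w k : ℂ)))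
      (fun m => (Fin.cons (1 / (x j * ∏ k, (w k : ℂ)))
        (fun k => (w ((chainPerm (some (j, n))).symm k) : ℂ)) : Fin (d + 1) → ℂ)
          (m - n.succ)) := by
  rw [chainCube, homog_ofReal_simplexMap]
  have hprod : ∏ k, (w ((chainPerm (some (j, n))).symm k) : ℂ) = ∏ k, (w k : ℂ) :=
    Equiv.prod_comp (chainPerm (some (j, n))).symm fun k => (w k : ℂ)
  have h := isRatio_partialProd (ξ := x j)
    (fun k => (w ((chainPerm (some (j, n))).symm k) : ℂ))
    (by rw [hprod]; exact mul_ne_zero hj (prod_ofReal_ne_zero hw _))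
  rw [hprod] at h
  exact h.iterate_cycInv n.succ

/-- After `n + 1` rotations the ratios along the chain `(j, n)` are those of `colSigma`. -/
theorem ratio_eq_colSigma {j : Fin N} {n : Fin d} {x : Fin N → ℂ} (w : Fin d → ℝ) (k : Fin d) :
    (Fin.cons (1 / (x j * ∏ k, (w k : ℂ)))
      (fun k => (w ((chainPerm (some (j, n))).symm k) : ℂ)) : Fin (d + 1) → ℂ)
        (k.succ - n.succ) = colSigma (some (j, n)) x w k := by
  by_cases h : k = n
  · subst h
    simp [colSigma]
  · have hk : k.succ - n.succ = (chainPerm (some (j, n)) k).succ := by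
      simp only [chainPerm, Equiv.ofBijective_apply, Fin.succ_pred, ratioPlace, h, if_false]
    rw [hk, Fin.cons_succ, Equiv.symm_apply_apply]
    simp [colSigma, h]

theorem homog_iterate_cycInv_ne_zero {j : Fin N} {n : Fin d} {x : Fin N → ℂ} (hj : x j ≠ 0)
    {w : Fin d → ℝ} (hw : w ∈ cube d) : (cycInv (x j))^[(n : ℕ) + 1]
      (homog fun k => (chainCube (some (j, n)) w k : ℂ)) 0 ≠ 0 := by
  refine (Finset.prod_ne_zero_iff (s := Finset.univ)).1 ?_ 0 (Finset.mem_univ _)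
  rw [prod_iterate_cycInv, chainCube, homog_ofReal_simplexMap]
  refine mul_ne_zero (pow_ne_zero _ hj) (Finset.prod_ne_zero_iff.2 fun m _ => ?_)
  have := ofReal_partialProd (w ∘ (chainPerm (some (j, n))).symm) m
  simp only [Function.comp_apply] at this ⊢
  rw [← this]
  exact_mod_cast (partialProd_pos ((comp_perm_mem_cube_iff _ w).2 hw) m).ne'

/-- The coordinates on the chain `c` are the partial products of the ratios `colSigma`. -/
theorem homog_chain {c : Idx d N} {x : Fin N → ℂ} (hx : ∀ j, x j ≠ 0) {w : Fin d → ℝ}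
    (hw : w ∈ cube d) :
    homog (chain c x (chainCube c w)) = Fin.partialProd (colSigma c x w) := by
  rcases c with _ | ⟨j, n⟩
  · exact homog_ofReal_simplexMap w
  · rw [← homog_partialProd]
    congr 1
    ext k
    have h := (isRatio_chain (n := n) (hx j) hw).eq_mul_partialProd k.succ
    simp only [ratio_eq_colSigma] at h
    simp only [chain, dehomog]
    rw [h]
    exact mul_div_cancel_left₀ _ (homog_iterate_cycInv_ne_zero (hx j) hw)

theorem prod_partialProd (σ : Fin d → ℂ) :
    ∏ m, Fin.partialProd σ m = (∏ k : Fin d, Fin.partialProd σ k.castSucc) * ∏ k, σ k := by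
  rw [Fin.prod_univ_castSucc, partialProd_last]

/-- The product of the Jacobian determinants of `simplexMap` and of the chain. The projective map
has Jacobian determinant `det / h_0 ^ (d + 1)`, where `h` is the image of `(1, u)`; the power of
`h_0` is computed by comparing the products of all homogeneous coordinates before and after the
map. -/
theorem jacobian_chain {c : Idx d N} {x : Fin N → ℂ} (hx : ∀ j, x j ≠ 0) {w : Fin d → ℝ}
    (hw : w ∈ cube d) :
    ((∏ k : Fin d, Fin.partialProd (w ∘ (chainPerm c).symm) k.castSucc : ℝ) : ℂ) *
      jacobian (chain c x) (chainCube c w) =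
    chainSign c * ((∏ k : Fin d, Fin.partialProd (colSigma c x w) k.castSucc) *
      ((∏ k, colSigma c x w k) / ∏ k, (w k : ℂ))) := by
  have hw0 := prod_ofReal_ne_zero hw Finset.univ
  simp only [Complex.ofReal_prod, ofReal_partialProd]
  rcases c with _ | ⟨j, n⟩
  · have h1 : jacobian (chain (none : Idx d N) x) (chainCube (none : Idx d N) w) = 1 := by
      have h := jacobian_dehomog (d := d) 1 (chainCube (none : Idx d N) w) (by simp [homog])
      simp only [Matrix.one_mulVec, Matrix.det_one] at h
      have e : chain (none : Idx d N) x =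
          fun u : Fin d → ℝ => dehomog (homog fun k => (u k : ℂ)) := by
        ext u k
        simp [chain, dehomog, homog]
      rw [e, h]
      simp [homog]
    rw [h1]
    simp only [chainSign, colSigma, div_self hw0, chainPerm]
    simp
  · set h0 := (cycInv (x j))^[(n : ℕ) + 1]
      (homog fun k => (chainCube (some (j, n)) w k : ℂ)) 0 with hh0
    have h0ne : h0 ≠ 0 := homog_iterate_cycInv_ne_zero (hx j) hw
    have h1 : jacobian (chain (some (j, n)) x) (chainCube (some (j, n)) w) =
        (x j * LinearMap.det (cycInvLin d 1)) ^ ((n : ℕ) + 1) / h0 ^ (d + 1) := by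
      have e : ∀ v, (LinearMap.toMatrix' (cycInvLin d (x j) ^ ((n : ℕ) + 1))).mulVec v =
          (cycInv (x j))^[(n : ℕ) + 1] v := fun v => by
        rw [LinearMap.toMatrix'_mulVec, cycInvLin_pow_apply]
      have h := jacobian_dehomog (LinearMap.toMatrix' (cycInvLin d (x j) ^ ((n : ℕ) + 1)))
        (chainCube (some (j, n)) w) (by rw [e]; exact h0ne)
      simp only [e, LinearMap.det_toMatrix', map_pow] at h
      rw [det_cycInvLin] at h
      exact h
    have h2 : x j ^ ((n : ℕ) + 1) * ∏ m, Fin.partialProd (fun k =>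
        ((w ∘ (chainPerm (some (j, n))).symm) k : ℂ)) m =
        h0 ^ (d + 1) * ∏ m, Fin.partialProd (colSigma (some (j, n)) x w) m := by
      have h := (isRatio_chain (n := n) (hx j) hw).eq_mul_partialProd
      simp only [ratio_eq_colSigma] at h
      have h' := prod_iterate_cycInv (x j) ((n : ℕ) + 1)
        (homog fun k => (chainCube (some (j, n)) w k : ℂ))
      rw [Finset.prod_congr rfl fun m _ => h m, Finset.prod_mul_distrib, Finset.prod_const,
        Finset.card_univ, Fintype.card_fin] at h'
      rw [← hh0] at h'
      rw [h', chainCube, homog_ofReal_simplexMap]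
    rw [prod_partialProd, prod_partialProd] at h2
    have hprod : ∏ k, ((w ∘ (chainPerm (some (j, n))).symm) k : ℂ) = ∏ k, (w k : ℂ) :=
      Equiv.prod_comp (chainPerm (some (j, n))).symm fun k => (w k : ℂ)
    rw [hprod] at h2
    rw [h1, chainSign, mul_pow]
    field_simp
    linear_combination LinearMap.det (cycInvLin d 1) ^ ((n : ℕ) + 1) * h2

theorem gap_chain {c : Idx d N} {x : Fin N → ℂ} (hx : ∀ j, x j ≠ 0) {w : Fin d → ℝ}
    (hw : w ∈ cube d) (k : Fin d) : gap (chain c x (chainCube c w)) k =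
      Fin.partialProd (colSigma c x w) k.castSucc * (1 - colSigma c x w k) := by
  rw [gap, homog_chain hx hw, Fin.partialProd_succ]
  ring

theorem lastCoord_chain {c : Idx d N} {x : Fin N → ℂ} (hx : ∀ j, x j ≠ 0) {w : Fin d → ℝ}
    (hw : w ∈ cube d) : lastCoord (chain c x (chainCube c w)) = ∏ k, colSigma c x w k := by
  rw [lastCoord, homog_chain hx hw, partialProd_last]

theorem colSigma_ne_zero {c : Idx d N} {x : Fin N → ℂ} (hx : ∀ j, x j ≠ 0) {w : Fin d → ℝ}
    (hw : w ∈ cube d) (k : Fin d) : colSigma c x w k ≠ 0 := by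
  rcases c with _ | ⟨j, n⟩
  · exact ofReal_ne_zero_of_mem hw k
  · by_cases h : k = n
    · subst h
      rw [colSigma, Function.update_self]
      exact one_div_ne_zero (mul_ne_zero (hx j) (prod_ofReal_ne_zero hw _))
    · simpa [colSigma, h] using ofReal_ne_zero_of_mem hw k

/-- The integrand of a period in the coordinates of the cube, including the Jacobian determinant of
these. -/
theorem integrand_chainCube (W : (Fin N → ℂ) → (Fin d → ℝ) → ℂ) (r c : Idx d N)
    {x : Fin N → ℂ} (hx : x ∈ slitDomain N) {w : Fin d → ℝ} (hw : w ∈ cube d) :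
    ((∏ k : Fin d, Fin.partialProd (w ∘ (chainPerm c).symm) k.castSucc : ℝ) : ℂ) *
      integrand W r c x (chainCube c w) =
    chainSign c * W x (chainCube c w) * ((∏ k, colSigma c x w k) / ∏ k, (w k : ℂ)) /
      (∏ k, (1 - colSigma c x w k)) * formRatio x (colSigma c x w) r := by
  have hx0 : ∀ j, x j ≠ 0 := fun j => (hx j).1
  have hpp : ∀ m, Fin.partialProd (colSigma c x w) m ≠ 0 := fun m => by
    induction m using Fin.induction with
    | zero => simp
    | succ k ih => rw [Fin.partialProd_succ]; exact mul_ne_zero ih (colSigma_ne_zero hx0 hw k)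
  have hg : ∀ k, gap (chain c x (chainCube c w)) k ≠ 0 := fun k => by
    rw [gap_chain hx0 hw]
    exact mul_ne_zero (hpp _) (one_sub_colSigma_ne_zero hx hw k)
  have hform : formCoeff r x (chain c x (chainCube c w)) =
      1 / (∏ k, gap (chain c x (chainCube c w)) k) * formRatio x (colSigma c x w) r := by
    rcases r with _ | ⟨i, m⟩
    · simp [formCoeff, formRatio]
    · have h1 := colX_sub_one_ne_zero (c := c) hx hw i
      have h2 : ∏ k ∈ Finset.univ.erase m, gap (chain c x (chainCube c w)) k ≠ 0 :=
        Finset.prod_ne_zero_iff.2 fun k _ => hg k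
      have h3 := hg m
      simp only [formCoeff, formRatio]
      rw [← Finset.mul_prod_erase _ _ (Finset.mem_univ m), ← gap_chain hx0 hw,
        lastCoord_chain hx0 hw]
      field_simp
  rw [integrand, hform]
  have h1 : ∏ k, gap (chain c x (chainCube c w)) k =
      (∏ k : Fin d, Fin.partialProd (colSigma c x w) k.castSucc) *
        ∏ k, (1 - colSigma c x w k) := by
    rw [← Finset.prod_mul_distrib]
    exact Finset.prod_congr rfl fun k _ => gap_chain hx0 hw k
  have h2 : ∏ k : Fin d, Fin.partialProd (colSigma c x w) k.castSucc ≠ 0 :=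
    Finset.prod_ne_zero_iff.2 fun k _ => hpp _
  have h3 : ∏ k, (1 - colSigma c x w k) ≠ 0 :=
    Finset.prod_ne_zero_iff.2 fun k _ => one_sub_colSigma_ne_zero hx hw k
  have hj := jacobian_chain (c := c) hx0 hw
  rw [h1]
  calc _ = W x (chainCube c w) * formRatio x (colSigma c x w) r *
        (1 / ((∏ k : Fin d, Fin.partialProd (colSigma c x w) k.castSucc) *
        ∏ k, (1 - colSigma c x w k))) * (((∏ k : Fin d,
          Fin.partialProd (w ∘ (chainPerm c).symm) k.castSucc : ℝ) : ℂ) *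
          jacobian (chain c x) (chainCube c w)) := by ring
    _ = _ := by rw [hj]; field_simp

end Cyclic

/-! ### Branches of the integrand -/

section Branches

variable {d N : ℕ} {p : Params d N}

/-- Two continuous logarithms of the same function on a preconnected set differ by a constant. -/
theorem exists_eq_add_of_exp_eq {X : Type*} [TopologicalSpace X] {S : Set X}
    (hS : IsPreconnected S) {f g : X → ℂ} (hf : ContinuousOn f S) (hg : ContinuousOn g S)
    (h : ∀ q ∈ S, Complex.exp (f q) = Complex.exp (g q)) : ∃ κ, ∀ q ∈ S, f q = g q + κ := by
  have hn : ∀ q : S, ∃ n : ℤ, f q - g q = n * (2 * Real.pi * Complex.I) := fun q => by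
    rw [← Complex.exp_eq_one_iff, Complex.exp_sub, h q q.2, div_self (Complex.exp_ne_zero _)]
  choose n hn using hn
  have h2 : (2 * Real.pi * Complex.I : ℂ) ≠ 0 := Complex.two_pi_I_ne_zero
  have hcont : Continuous n := by
    rw [Int.isClosedEmbedding_coe_real.isInducing.continuous_iff]
    have e : ((fun m : ℤ => (m : ℝ)) ∘ n) =
        fun q : S => ((f q - g q) / (2 * Real.pi * Complex.I)).re := by
      ext q
      rw [hn q, mul_div_cancel_right₀ _ h2]
      simp
    rw [e]
    exact Complex.continuous_re.comp ((hf.domRestrict.sub hg.domRestrict).div_const _)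
  have := Subtype.preconnectedSpace hS
  rcases S.eq_empty_or_nonempty with rfl | ⟨q₀, hq₀⟩
  · exact ⟨0, by simp⟩
  refine ⟨f q₀ - g q₀, fun q hq => ?_⟩
  have := hn ⟨q, hq⟩
  rw [PreconnectedSpace.constant ‹_› hcont (x := ⟨q, hq⟩) (y := ⟨q₀, hq₀⟩), ← hn ⟨q₀, hq₀⟩] at this
  simp only at this
  rw [← this]
  ring

/-- Logarithms of the ratios `colSigma`. -/
noncomputable def logSigma (c : Idx d N) (ell : Fin N → ℂ) (w : Fin d → ℝ) (k : Fin d) : ℂ :=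
  match c with
  | none => Complex.log (w k)
  | some (j, n) => if k = n then -ell j - ∑ k, Complex.log (w k) else Complex.log (w k)

/-- Logarithms of the differences `1 - colSigma`. -/
noncomputable def logOneSub (c : Idx d N) (x ell : Fin N → ℂ) (w : Fin d → ℝ) (k : Fin d) : ℂ :=
  match c with
  | none => Complex.log (1 - w k)
  | some (j, n) =>
    if k = n then
      Real.pi * Complex.I + Complex.log (1 - colZ (some (j, n)) x j *
        (cubeMonomial (colT (some (j, n))) w j : ℂ)) - ell j - ∑ k, Complex.log (w k)
    else Complex.log (1 - w k)

/-- Logarithms of the factors `1 - x_i t_{L-1}`. -/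
noncomputable def logFactor (c : Idx d N) (x ell : Fin N → ℂ) (w : Fin d → ℝ) (i : Fin N) : ℂ :=
  match c with
  | none => Complex.log (1 - colZ (none : Idx d N) x i *
      (cubeMonomial (colT (none : Idx d N)) w i : ℂ))
  | some (j, n) =>
    if i = j then Real.pi * Complex.I + Complex.log (1 - w n) - Complex.log (w n)
    else Real.pi * Complex.I + ell i - ell j - Complex.log (w n) +
      Complex.log (1 - colZ (some (j, n)) x i * (cubeMonomial (colT (some (j, n))) w i : ℂ))

theorem exp_sum_log {w : Fin d → ℝ} (hw : w ∈ cube d) :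
    Complex.exp (∑ k, Complex.log (w k)) = ∏ k, (w k : ℂ) := by
  rw [Complex.exp_sum]
  exact Finset.prod_congr rfl fun k _ => Complex.exp_log (ofReal_ne_zero_of_mem hw k)

theorem exp_logSigma {c : Idx d N} {x ell : Fin N → ℂ} (hell : ∀ l, Complex.exp (ell l) = x l)
    {w : Fin d → ℝ} (hw : w ∈ cube d) (k : Fin d) :
    Complex.exp (logSigma c ell w k) = colSigma c x w k := by
  have hk := Complex.exp_log (ofReal_ne_zero_of_mem hw k)
  rcases c with _ | ⟨j, n⟩
  · exact hk
  · by_cases h : k = n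
    · simp only [logSigma, colSigma, h, if_true, Function.update_self]
      rw [sub_eq_add_neg, ← neg_add, Complex.exp_neg, Complex.exp_add, hell, exp_sum_log hw,
        one_div]
    · simpa [logSigma, colSigma, h] using hk

theorem exp_logOneSub {c : Idx d N} {x ell : Fin N → ℂ} (hx : x ∈ slitDomain N)
    (hell : ∀ l, Complex.exp (ell l) = x l) {w : Fin d → ℝ} (hw : w ∈ cube d) (k : Fin d) :
    Complex.exp (logOneSub c x ell w k) = 1 - colSigma c x w k := by
  have hk := Complex.exp_log (one_sub_ofReal_ne_zero_of_mem hw k)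
  rcases c with _ | ⟨j, n⟩
  · exact hk
  · by_cases h : k = n
    · have h1 := one_sub_colZ_ne_zero (slitDomain_subset_colDomain (some (j, n)) hx) hw j
      simp only [logOneSub, colSigma, h, if_true, Function.update_self]
      rw [Complex.exp_sub, Complex.exp_sub, Complex.exp_add, Complex.exp_pi_mul_I,
        Complex.exp_log h1, hell, exp_sum_log hw, cubeMonomial_colT_self]
      simp only [colZ, if_true]
      have hj := (hx j).1
      have hS := prod_ofReal_ne_zero hw Finset.univ
      field_simp
      ring
    · simpa [logOneSub, colSigma, h] using hk

theorem exp_logFactor {c : Idx d N} {x ell : Fin N → ℂ} (hx : x ∈ slitDomain N)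
    (hell : ∀ l, Complex.exp (ell l) = x l) {w : Fin d → ℝ} (hw : w ∈ cube d) (i : Fin N) :
    Complex.exp (logFactor c x ell w i) = 1 - x i * ∏ k, colSigma c x w k := by
  have h1 := one_sub_colZ_ne_zero (slitDomain_subset_colDomain c hx) hw i
  rcases c with _ | ⟨j, n⟩
  · simp only [logFactor]
    rw [Complex.exp_log h1, cubeMonomial_colT_none]
    rfl
  · have hn := ofReal_ne_zero_of_mem hw n
    have hj := (hx j).1
    have hi := (hx i).1
    rw [prod_colSigma_some hw]
    by_cases h : i = j
    · subst h
      simp only [logFactor, if_true]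
      rw [Complex.exp_sub, Complex.exp_add, Complex.exp_pi_mul_I,
        Complex.exp_log (one_sub_ofReal_ne_zero_of_mem hw n), Complex.exp_log hn]
      field_simp
      ring
    · simp only [logFactor, h, if_false]
      rw [Complex.exp_add, Complex.exp_sub, Complex.exp_sub, Complex.exp_add, Complex.exp_pi_mul_I,
        Complex.exp_log h1, Complex.exp_log hn, hell, hell, cubeMonomial_colT_ne w h]
      simp only [colZ, h, if_false]
      field_simp
      ring

theorem ofReal_mem_slitPlane_of_mem {w : Fin d → ℝ} (hw : w ∈ cube d) (k : Fin d) :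
    (w k : ℂ) ∈ Complex.slitPlane := Or.inl (by simpa using (mem_cube.1 hw k).1)

theorem one_sub_ofReal_mem_slitPlane_of_mem {w : Fin d → ℝ} (hw : w ∈ cube d) (k : Fin d) :
    1 - (w k : ℂ) ∈ Complex.slitPlane := Or.inl (by simpa using (mem_cube.1 hw k).2)

section Continuity

variable {Ω : Set (Fin N → ℂ)} {lam : Fin N → (Fin N → ℂ) → ℂ}

theorem continuousOn_log_cube (k : Fin d) :
    ContinuousOn (fun q : (Fin N → ℂ) × (Fin d → ℝ) => Complex.log (q.2 k)) (Ω ×ˢ cube d) :=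
  ContinuousOn.clog (by fun_prop) fun _ hq => ofReal_mem_slitPlane_of_mem hq.2 k

theorem continuousOn_log_one_sub_cube (k : Fin d) :
    ContinuousOn (fun q : (Fin N → ℂ) × (Fin d → ℝ) => Complex.log (1 - q.2 k)) (Ω ×ˢ cube d) :=
  ContinuousOn.clog (by fun_prop) fun _ hq => one_sub_ofReal_mem_slitPlane_of_mem hq.2 k

theorem continuousOn_logBranch_fst (hlam : IsLogBranch Ω lam) (l : Fin N) :
    ContinuousOn (fun q : (Fin N → ℂ) × (Fin d → ℝ) => lam l q.1) (Ω ×ˢ cube d) :=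
  (hlam l).1.comp continuousOn_fst fun _ hq => hq.1

theorem continuousOn_log_one_sub_colZ (hΩ : Ω ⊆ slitDomain N) (c : Idx d N) (i : Fin N) :
    ContinuousOn (fun q : (Fin N → ℂ) × (Fin d → ℝ) => Complex.log (1 - colZ c q.1 i *
      (cubeMonomial (colT c) q.2 i : ℂ))) (Ω ×ˢ cube d) := by
  refine ContinuousOn.clog ?_ fun q hq => one_sub_mul_mem_slitPlane'
    (colZ_mem_domain0 (slitDomain_subset_colDomain c (hΩ hq.1)))
    (cubeMonomial_mem_Icc _ (cube_subset_Icc hq.2)) i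
  have h1 : ContinuousOn (fun q : (Fin N → ℂ) × (Fin d → ℝ) => colZ c q.1 i) (Ω ×ˢ cube d) := by
    rcases c with _ | ⟨j, n⟩
    · simp only [colZ]; fun_prop
    · simp only [colZ]
      split_ifs
      · fun_prop
      · exact ContinuousOn.div (by fun_prop) (by fun_prop) fun q hq => (hΩ hq.1 i).1
  have h2 : Continuous fun q : (Fin N → ℂ) × (Fin d → ℝ) =>
      (cubeMonomial (colT c) q.2 i : ℂ) :=
    Complex.continuous_ofReal.comp
      ((continuous_apply i).comp ((continuous_cubeMonomial _).comp continuous_snd))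
  exact continuousOn_const.sub (h1.mul h2.continuousOn)

theorem continuousOn_logSigma (hlam : IsLogBranch Ω lam) (c : Idx d N) (k : Fin d) :
    ContinuousOn (fun q : (Fin N → ℂ) × (Fin d → ℝ) => logSigma c (fun l => lam l q.1) q.2 k)
      (Ω ×ˢ cube d) := by
  rcases c with _ | ⟨j, n⟩
  · exact continuousOn_log_cube k
  · simp only [logSigma]
    split_ifs
    · exact (continuousOn_logBranch_fst hlam j).neg.sub
        (continuousOn_finsetSum _ fun k _ => continuousOn_log_cube k)
    · exact continuousOn_log_cube k

theorem continuousOn_logOneSub (hΩ : Ω ⊆ slitDomain N) (hlam : IsLogBranch Ω lam) (c : Idx d N)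
    (k : Fin d) : ContinuousOn (fun q : (Fin N → ℂ) × (Fin d → ℝ) =>
      logOneSub c q.1 (fun l => lam l q.1) q.2 k) (Ω ×ˢ cube d) := by
  rcases c with _ | ⟨j, n⟩
  · exact continuousOn_log_one_sub_cube k
  · simp only [logOneSub]
    split_ifs
    · exact ((continuousOn_const.add (continuousOn_log_one_sub_colZ hΩ _ j)).sub
        (continuousOn_logBranch_fst hlam j)).sub
        (continuousOn_finsetSum _ fun k _ => continuousOn_log_cube k)
    · exact continuousOn_log_one_sub_cube k

theorem continuousOn_logFactor (hΩ : Ω ⊆ slitDomain N) (hlam : IsLogBranch Ω lam) (c : Idx d N)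
    (i : Fin N) : ContinuousOn (fun q : (Fin N → ℂ) × (Fin d → ℝ) =>
      logFactor c q.1 (fun l => lam l q.1) q.2 i) (Ω ×ˢ cube d) := by
  rcases c with _ | ⟨j, n⟩
  · exact continuousOn_log_one_sub_colZ hΩ _ i
  · simp only [logFactor]
    split_ifs
    · exact (continuousOn_const.add (continuousOn_log_one_sub_cube n)).sub (continuousOn_log_cube n)
    · exact (((continuousOn_const.add (continuousOn_logBranch_fst hlam i)).sub
        (continuousOn_logBranch_fst hlam j)).sub (continuousOn_log_cube n)).add
        (continuousOn_log_one_sub_colZ hΩ _ i)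

end Continuity

theorem isPreconnected_cube : IsPreconnected (cube d) :=
  isPreconnected_univ_pi fun _ => isPreconnected_Ioo

theorem continuous_chainCube (c : Idx d N) : Continuous (chainCube c) := by
  refine continuous_pi fun k => ?_
  simp only [chainCube, simplexMap_apply, Function.comp_apply]
  fun_prop

theorem chainCube_mem_simplex (c : Idx d N) {w : Fin d → ℝ} (hw : w ∈ cube d) :
    chainCube c w ∈ simplex d :=
  image_simplexMap ▸ mem_image_of_mem _ ((comp_perm_mem_cube_iff _ w).2 hw)

theorem partialSum_last (f : Fin d → ℂ) : Fin.partialSum f (Fin.last d) = ∑ k, f k := by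
  induction d with
  | zero => simp
  | succ n ih =>
    rw [← Fin.succ_last, Fin.partialSum_succ', ih, Fin.sum_univ_succ]
    rfl

theorem exp_partialSum (f : Fin d → ℂ) (m : Fin (d + 1)) :
    Complex.exp (Fin.partialSum f m) = Fin.partialProd (fun k => Complex.exp (f k)) m := by
  induction m using Fin.induction with
  | zero => simp
  | succ k ih => rw [Fin.partialSum_succ, Fin.partialProd_succ, Complex.exp_add, ih]

/-- The exponent of `U` in terms of the logarithms of the ratios, by partial summation. -/
theorem sum_ζ_mul_add_η_mul (f g : Fin d → ℂ) :
    ∑ k : Fin d, (p.ζ k * Fin.partialSum f k.succ +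
      p.η k * (Fin.partialSum f k.castSucc + g k)) =
    ∑ k, p.α k * f k - ∑ k, f k + ∑ k, p.η k * g k := by
  set Γ : Fin (d + 1) → ℂ := Fin.snoc p.γ 1 with hΓ
  have h1 : ∑ k : Fin d, Γ k.succ * Fin.partialSum f k.succ =
      (∑ k : Fin d, Γ k.castSucc * Fin.partialSum f k.castSucc) + ∑ k, f k := by
    have := (Fin.sum_univ_succ fun m => Γ m * Fin.partialSum f m).symm.trans
      (Fin.sum_univ_castSucc fun m => Γ m * Fin.partialSum f m)
    rw [Fin.partialSum_zero, mul_zero, zero_add, partialSum_last] at this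
    rw [this, hΓ, Fin.snoc_last, one_mul]
  have h2 : ∀ k : Fin d, p.ζ k * Fin.partialSum f k.succ +
      p.η k * (Fin.partialSum f k.castSucc + g k) =
      p.α k * f k - Γ k.succ * Fin.partialSum f k.succ +
        Γ k.castSucc * Fin.partialSum f k.castSucc + p.η k * g k := fun k => by
    rw [Params.ζ, Params.η, ← hΓ, Fin.partialSum_succ, hΓ, Fin.snoc_castSucc]
    ring
  rw [Finset.sum_congr rfl fun k _ => h2 k, Finset.sum_add_distrib, Finset.sum_add_distrib,
    Finset.sum_sub_distrib, h1]
  ring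

/-- Over the cube, every branch of `U` is a constant multiple of a standard one. -/
theorem exists_branch_eq {Ω : Set (Fin N → ℂ)} (hΩc : IsPreconnected Ω) (hΩ : Ω ⊆ slitDomain N)
    {lam : Fin N → (Fin N → ℂ) → ℂ} (hlam : IsLogBranch Ω lam) {c : Idx d N}
    {W : (Fin N → ℂ) → (Fin d → ℝ) → ℂ} (hW : IsBranchOfU p Ω c W) :
    ∃ K : ℂ, K ≠ 0 ∧ ∀ x ∈ Ω, ∀ w ∈ cube d, W x (chainCube c w) = K * Complex.exp
      (∑ k, p.α k * logSigma c (fun l => lam l x) w k - ∑ k, logSigma c (fun l => lam l x) w k +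
        ∑ k, p.η k * logOneSub c x (fun l => lam l x) w k +
        ∑ i, p.θ i * logFactor c x (fun l => lam l x) w i) := by
  obtain ⟨A, B, C, hA, hB, hC, h⟩ := hW
  have hconn : IsPreconnected (Ω ×ˢ cube d) := hΩc.prod isPreconnected_cube
  have hmaps : MapsTo (fun q : (Fin N → ℂ) × (Fin d → ℝ) => (q.1, chainCube c q.2))
      (Ω ×ˢ cube d) (Ω ×ˢ simplex d) := fun q hq => ⟨hq.1, chainCube_mem_simplex c hq.2⟩
  have hcont : ContinuousOn (fun q : (Fin N → ℂ) × (Fin d → ℝ) => (q.1, chainCube c q.2))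
      (Ω ×ˢ cube d) :=
    (continuous_fst.prodMk ((continuous_chainCube c).comp continuous_snd)).continuousOn
  have hS : ∀ m, ContinuousOn (fun q : (Fin N → ℂ) × (Fin d → ℝ) =>
      Fin.partialSum (logSigma c (fun l => lam l q.1) q.2) m) (Ω ×ˢ cube d) := fun m => by
    induction m using Fin.induction with
    | zero => simp only [Fin.partialSum_zero]; exact continuousOn_const
    | succ k ih =>
      simp only [Fin.partialSum_succ]
      exact ih.add (continuousOn_logSigma hlam c k)
  have hpp : ∀ x ∈ Ω, ∀ w ∈ cube d, ∀ m, Complex.exp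
      (Fin.partialSum (logSigma c (fun l => lam l x) w) m) =
      homog (chain c x (chainCube c w)) m := fun x hx w hw m => by
    rw [exp_partialSum, homog_chain (fun j => (hΩ hx j).1) hw]
    congr 1
    ext k
    exact exp_logSigma (fun l => (hlam l).2 x hx) hw k
  have hAe : ∀ k, ∃ κ, ∀ q ∈ Ω ×ˢ cube d, A k (q.1, chainCube c q.2) =
      Fin.partialSum (logSigma c (fun l => lam l q.1) q.2) k.succ + κ := fun k => by
    refine exists_eq_add_of_exp_eq hconn ((hA k).comp hcont hmaps) (hS k.succ) fun q hq => ?_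
    rw [hpp q.1 hq.1 q.2 hq.2]
    exact ((h q.1 hq.1 _ (hmaps hq).2).1 k).trans (by simp [homog])
  have hBe : ∀ k, ∃ κ, ∀ q ∈ Ω ×ˢ cube d, B k (q.1, chainCube c q.2) =
      (Fin.partialSum (logSigma c (fun l => lam l q.1) q.2) k.castSucc +
        logOneSub c q.1 (fun l => lam l q.1) q.2 k) + κ := fun k => by
    refine exists_eq_add_of_exp_eq hconn ((hB k).comp hcont hmaps)
      ((hS k.castSucc).add (continuousOn_logOneSub hΩ hlam c k)) fun q hq => ?_
    rw [Complex.exp_add, hpp q.1 hq.1 q.2 hq.2,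
      exp_logOneSub (hΩ hq.1) (fun l => (hlam l).2 q.1 hq.1) hq.2]
    refine ((h q.1 hq.1 _ (hmaps hq).2).2.1 k).trans ?_
    have hx0 : ∀ j, q.1 j ≠ 0 := fun j => (hΩ hq.1 j).1
    rw [gap_chain hx0 hq.2, homog_chain hx0 hq.2]
  have hCe : ∀ i, ∃ κ, ∀ q ∈ Ω ×ˢ cube d, C i (q.1, chainCube c q.2) =
      logFactor c q.1 (fun l => lam l q.1) q.2 i + κ := fun i => by
    refine exists_eq_add_of_exp_eq hconn ((hC i).comp hcont hmaps)
      (continuousOn_logFactor hΩ hlam c i) fun q hq => ?_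
    rw [exp_logFactor (hΩ hq.1) (fun l => (hlam l).2 q.1 hq.1) hq.2]
    refine ((h q.1 hq.1 _ (hmaps hq).2).2.2.1 i).trans ?_
    rw [lastCoord_chain (fun j => (hΩ hq.1 j).1) hq.2]
  choose κA hκA using hAe
  choose κB hκB using hBe
  choose κC hκC using hCe
  refine ⟨Complex.exp (∑ k, (p.ζ k * κA k + p.η k * κB k) + ∑ i, p.θ i * κC i),
    Complex.exp_ne_zero _, fun x hx w hw => ?_⟩
  rw [(h x hx _ (chainCube_mem_simplex c hw)).2.2.2, ← Complex.exp_add, ← sum_ζ_mul_add_η_mul]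
  congr 1
  have e1 : ∀ k, A k (x, chainCube c w) = _ := fun k => hκA k (x, w) ⟨hx, hw⟩
  have e2 : ∀ k, B k (x, chainCube c w) = _ := fun k => hκB k (x, w) ⟨hx, hw⟩
  have e3 : ∀ i, C i (x, chainCube c w) = _ := fun i => hκC i (x, w) ⟨hx, hw⟩
  simp only [e1, e2, e3, mul_add, Finset.sum_add_distrib]
  ring

end Branches

/-! ### The matrix of periods in terms of Euler integrals -/

section Periods

variable {d N : ℕ} {p : Params d N}

theorem colKernel_none_eq_exp {c : Idx d N} {x : Fin N → ℂ} (hx : x ∈ colDomain c)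
    (ell : Fin N → ℂ) {w : Fin d → ℝ} (hw : w ∈ cube d) :
    colKernel p none c x ell w = Complex.exp (∑ l, expNu p none c l * ell l +
      (∑ k, (baseA p c k * Complex.log (w k) + baseB p c k * Complex.log (1 - w k)) +
        ∑ i, baseC p c i * Complex.log (1 - colZ c x i * (cubeMonomial (colT c) w i : ℂ)))) := by
  rw [Complex.exp_add, Complex.exp_add,
    Complex.exp_sum (s := Finset.univ) (f := fun k : Fin d => _),
    Complex.exp_sum (s := Finset.univ) (f := fun i : Fin N => baseC p c i * _)]
  simp only [colKernel, colSign, one_mul, eulerKernel, betaDensity, binomProd, expA, expB, expC,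
    shiftA, shiftB, shiftC, Int.cast_zero, add_zero]
  congr 2
  · refine Finset.prod_congr rfl fun k _ => ?_
    rw [Complex.cpow_def_of_ne_zero (ofReal_ne_zero_of_mem hw k),
      Complex.cpow_def_of_ne_zero (one_sub_ofReal_ne_zero_of_mem hw k), Complex.exp_add,
      mul_comm (Complex.log _), mul_comm (Complex.log _)]
  · refine Finset.prod_congr rfl fun i _ => ?_
    rw [Complex.cpow_def_of_ne_zero (one_sub_colZ_ne_zero hx hw i), mul_comm (Complex.log _)]

/-- The constant factor that relates the standard branch of the integrand to the kernel of the
Euler integral. -/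
noncomputable def branchConst (p : Params d N) (c : Idx d N) : ℂ :=
  match c with
  | none => 1
  | some (_, n) => Complex.exp (Real.pi * Complex.I * (p.η n - 1 + ∑ i, p.θ i))

theorem branchConst_ne_zero (c : Idx d N) : branchConst p c ≠ 0 := by
  rcases c with _ | ⟨_, n⟩
  · exact one_ne_zero
  · exact Complex.exp_ne_zero _

/-- The integrand of `φ_0`, built from the standard logarithms of all factors, is a constant
multiple of the kernel of the Euler integral: on the chain `(j, n)` each factor with a negative standard
argument contributes a power of `exp (π I)`. -/
theorem standard_branch_eq {c : Idx d N} {x : Fin N → ℂ} (hx : x ∈ colDomain c)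
    (ell : Fin N → ℂ) {w : Fin d → ℝ} (hw : w ∈ cube d) :
    Complex.exp (∑ k, p.α k * logSigma c ell w k - ∑ k, logSigma c ell w k +
        ∑ k, p.η k * logOneSub c x ell w k + ∑ i, p.θ i * logFactor c x ell w i) *
      Complex.exp (∑ k, logSigma c ell w k) / Complex.exp (∑ k, Complex.log (w k)) /
      Complex.exp (∑ k, logOneSub c x ell w k) =
    branchConst p c * colKernel p none c x ell w := by
  rw [colKernel_none_eq_exp hx ell hw, ← Complex.exp_add, ← Complex.exp_sub, ← Complex.exp_sub]
  rcases c with _ | ⟨j, n⟩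
  · rw [branchConst, one_mul]
    congr 1
    simp only [logSigma, logOneSub, logFactor, baseA, baseB, baseC, expNu, sub_mul, one_mul,
      Finset.sum_add_distrib, Finset.sum_sub_distrib, zero_mul, Finset.sum_const_zero]
    ring
  · rw [branchConst, ← Complex.exp_add]
    congr 1
    have hsplit : ∀ f : Fin d → ℂ, ∑ k, f k = f n + ∑ k ∈ Finset.univ.erase n, f k := fun f =>
      (Finset.add_sum_erase _ f (Finset.mem_univ n)).symm
    have hsplit' : ∀ f : Fin N → ℂ, ∑ k, f k = f j + ∑ k ∈ Finset.univ.erase j, f k := fun f =>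
      (Finset.add_sum_erase _ f (Finset.mem_univ j)).symm
    have hd : ∀ (f g : Fin d → ℂ), (∀ k, k ≠ n → f k = g k) →
        ∑ k ∈ Finset.univ.erase n, f k = ∑ k ∈ Finset.univ.erase n, g k := fun f g h =>
      Finset.sum_congr rfl fun k hk => h k (Finset.ne_of_mem_erase hk)
    have hd' : ∀ (f g : Fin N → ℂ), (∀ k, k ≠ j → f k = g k) →
        ∑ k ∈ Finset.univ.erase j, f k = ∑ k ∈ Finset.univ.erase j, g k := fun f g h =>
      Finset.sum_congr rfl fun k hk => h k (Finset.ne_of_mem_erase hk)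
    set S := ∑ k, Complex.log (w k) with hS
    set Λ := Complex.log (1 - colZ (some (j, n)) x j *
        (cubeMonomial (colT (some (j, n))) w j : ℂ)) with hΛ
    -- separate the terms with index `n` and `j`, and collect the coefficients of the logarithms
    have e1 : ∑ k, p.α k * logSigma (some (j, n)) ell w k = p.α n * (-ell j - S) +
        ∑ k ∈ Finset.univ.erase n, p.α k * Complex.log (w k) := by
      rw [hsplit]
      congr 1
      · simp [logSigma, hS]
      · exact hd _ _ fun k hk => by simp [logSigma, hk]
    have e2 : ∑ k, (p.η k * logOneSub (some (j, n)) x ell w k) =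
        p.η n * (Real.pi * Complex.I + Λ - ell j - S) +
        ∑ k ∈ Finset.univ.erase n, p.η k * Complex.log (1 - w k) := by
      rw [hsplit]
      congr 1
      · simp [logOneSub, hS, hΛ]
      · exact hd _ _ fun k hk => by simp [logOneSub, hk]
    have e3 : ∑ k, logOneSub (some (j, n)) x ell w k =
        (Real.pi * Complex.I + Λ - ell j - S) +
        ∑ k ∈ Finset.univ.erase n, Complex.log (1 - w k) := by
      rw [hsplit]
      congr 1
      · simp [logOneSub, hS, hΛ]
      · exact hd _ _ fun k hk => by simp [logOneSub, hk]
    have e4 : ∑ i, p.θ i * logFactor (some (j, n)) x ell w i =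
        p.θ j * (Real.pi * Complex.I + Complex.log (1 - w n) - Complex.log (w n)) +
        ((∑ i ∈ Finset.univ.erase j, p.θ i) *
          (Real.pi * Complex.I - ell j - Complex.log (w n)) +
        ∑ i ∈ Finset.univ.erase j, p.θ i * ell i +
        ∑ i ∈ Finset.univ.erase j, p.θ i * Complex.log (1 - colZ (some (j, n)) x i *
          (cubeMonomial (colT (some (j, n))) w i : ℂ))) := by
      rw [hsplit']
      congr 1
      · simp [logFactor]
      · rw [Finset.sum_mul, ← Finset.sum_add_distrib, ← Finset.sum_add_distrib]
        refine hd' _ _ fun i hi => ?_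
        simp only [logFactor, hi, if_false]
        ring
    have e5 : ∑ l, expNu p none (some (j, n)) l * ell l =
        (p.b j n + 1) * ell j + ∑ i ∈ Finset.univ.erase j, p.θ i * ell i := by
      rw [hsplit']
      congr 1
      · simp [expNu, extraOrder]
      · exact hd' _ _ fun i hi => by simp [expNu, hi, Params.θ]
    have e6 : ∑ k, (baseA p (some (j, n)) k * Complex.log (w k) +
        baseB p (some (j, n)) k * Complex.log (1 - w k)) =
        ((∑ i, p.β i) - p.γ n) * Complex.log (w n) + p.θ j * Complex.log (1 - w n) +
        (∑ k ∈ Finset.univ.erase n, p.α k * Complex.log (w k) -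
          p.γ n * (S - Complex.log (w n)) +
          ∑ k ∈ Finset.univ.erase n, p.η k * Complex.log (1 - w k) -
          ∑ k ∈ Finset.univ.erase n, Complex.log (1 - w k)) := by
      rw [hsplit]
      congr 1
      · simp [baseA, baseB]
      · rw [hS, hsplit, add_sub_cancel_left, Finset.mul_sum, ← Finset.sum_sub_distrib,
          ← Finset.sum_add_distrib, ← Finset.sum_sub_distrib]
        refine hd _ _ fun k hk => ?_
        simp only [baseA, baseB, hk, if_false]
        ring
    have e7 : ∑ i, baseC p (some (j, n)) i * Complex.log (1 - colZ (some (j, n)) x i *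
        (cubeMonomial (colT (some (j, n))) w i : ℂ)) = (p.η n - 1) * Λ +
        ∑ i ∈ Finset.univ.erase j, p.θ i * Complex.log (1 - colZ (some (j, n)) x i *
          (cubeMonomial (colT (some (j, n))) w i : ℂ)) := by
      rw [hsplit']
      congr 1
      · simp [baseC, hΛ]
      · exact hd' _ _ fun i hi => by simp [baseC, hi]
    have e8 : ∑ i, p.θ i = p.θ j + ∑ i ∈ Finset.univ.erase j, p.θ i := hsplit' _
    have e9 : ∑ i, p.β i = -p.θ j - ∑ i ∈ Finset.univ.erase j, p.θ i := by
      rw [hsplit']; simp [Params.θ]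
    have e10 : p.b j n = -(∑ i ∈ Finset.univ.erase j, p.θ i) - p.γ n := by
      simp [Params.b, Params.θ]
    have e11 : p.η n = p.γ n - p.α n := rfl
    rw [e1, e2, e3, e4, e5, e6, e7, e8, e9, e10, e11]
    ring

/-- On the cube, the integrands of a column of the matrix of periods are a common constant multiple
of the kernels of Euler integrals. -/
theorem exists_integrand_eq {Ω : Set (Fin N → ℂ)} (hΩc : IsPreconnected Ω)
    (hΩ : Ω ⊆ slitDomain N) {lam : Fin N → (Fin N → ℂ) → ℂ} (hlam : IsLogBranch Ω lam)
    {c : Idx d N} {W : (Fin N → ℂ) → (Fin d → ℝ) → ℂ} (hW : IsBranchOfU p Ω c W) :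
    ∃ K : ℂ, K ≠ 0 ∧ ∀ x ∈ Ω, ∀ r, ∀ w ∈ cube d,
      ((∏ k : Fin d, Fin.partialProd (w ∘ (chainPerm c).symm) k.castSucc : ℝ) : ℂ) *
        integrand W r c x (chainCube c w) = K * colKernel p r c x (fun l => lam l x) w := by
  obtain ⟨K, hK, h⟩ := exists_branch_eq hΩc hΩ hlam hW
  refine ⟨chainSign c * K * branchConst p c, mul_ne_zero (mul_ne_zero (chainSign_ne_zero c) hK)
    (branchConst_ne_zero c), fun x hx r w hw => ?_⟩
  have hell : ∀ l, Complex.exp (lam l x) = x l := fun l => (hlam l).2 x hx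
  rw [integrand_chainCube W r c (hΩ hx) hw, h x hx w hw, colKernel_eq (hΩ hx) hell hw r c]
  have hs := standard_branch_eq (p := p) (slitDomain_subset_colDomain c (hΩ hx))
    (fun l => lam l x) hw
  have h1 : Complex.exp (∑ k, logSigma c (fun l => lam l x) w k) = ∏ k, colSigma c x w k := by
    rw [Complex.exp_sum]
    exact Finset.prod_congr rfl fun k _ => exp_logSigma hell hw k
  have h2 : Complex.exp (∑ k, logOneSub c x (fun l => lam l x) w k) =
      ∏ k, (1 - colSigma c x w k) := by
    rw [Complex.exp_sum]
    exact Finset.prod_congr rfl fun k _ => exp_logOneSub (hΩ hx) hell hw k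
  rw [h1, h2, exp_sum_log hw] at hs
  linear_combination chainSign c * K * formRatio x (colSigma c x w) r * hs

/-- Up to a nonzero constant for each column, the periods are the integrals of the kernels
`colKernel`. -/
theorem exists_periods_eq {Ω : Set (Fin N → ℂ)} (hp : p.Convergent) (hΩc : IsPreconnected Ω)
    (hΩ : Ω ⊆ slitDomain N) {lam : Fin N → (Fin N → ℂ) → ℂ} (hlam : IsLogBranch Ω lam)
    {c : Idx d N} {W : (Fin N → ℂ) → (Fin d → ℝ) → ℂ} (hW : IsBranchOfU p Ω c W) :
    ∃ K : ℂ, K ≠ 0 ∧ ∀ x ∈ Ω, ∀ r, IntegrableOn (integrand W r c x) (simplex d) ∧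
      ∫ u in simplex d, integrand W r c x u =
        K * ∫ w in cube d, colKernel p r c x (fun l => lam l x) w := by
  obtain ⟨K, hK, h⟩ := exists_integrand_eq hΩc hΩ hlam hW
  refine ⟨K, hK, fun x hx r => ⟨?_, ?_⟩⟩
  · rw [integrableOn_simplex_perm_iff (chainPerm c)]
    refine IntegrableOn.congr_fun ((integrableOn_colKernel hp r c
      (slitDomain_subset_colDomain c (hΩ hx)) fun l => lam l x).const_mul K)
      (fun w hw => (h x hx r w hw).symm) measurableSet_cube
  · rw [setIntegral_simplex_perm (chainPerm c), ← integral_const_mul]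
    exact setIntegral_congr_fun measurableSet_cube fun w hw => h x hx r w hw

end Periods

/-! ### Euler integrals in a confluent limit -/

section Confluence

variable {d N : ℕ}

theorem ofReal_sub_mul_mem_slitPlane {ξ : ℂ} (hξ : -ξ ∈ Complex.slitPlane) {s t : ℝ}
    (hs : 0 ≤ s) (ht : 0 ≤ t) (hst : 0 < s + t) : (s : ℂ) - ξ * t ∈ Complex.slitPlane := by
  rw [Complex.mem_slitPlane_iff] at *
  simp only [Complex.neg_re, Complex.neg_im, neg_ne_zero] at hξ
  simp only [Complex.sub_re, Complex.ofReal_re, Complex.re_mul_ofReal, Complex.sub_im,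
    Complex.ofReal_im, Complex.im_mul_ofReal, zero_sub, neg_ne_zero]
  rcases ht.eq_or_lt with rfl | ht
  · left; simpa using hst
  · rcases hξ with h | h
    · left; nlinarith
    · right; exact mul_ne_zero h ht.ne'

/-- The point `1` has positive distance from a ray other than `[0, ∞)`. -/
theorem exists_le_norm_one_sub_mul {ξ : ℂ} (hξ : -ξ ∈ Complex.slitPlane) :
    ∃ δ > 0, ∀ t : ℝ, 0 ≤ t → δ ≤ ‖1 - ξ * t‖ := by
  rw [Complex.mem_slitPlane_iff] at hξ
  simp only [Complex.neg_re, Complex.neg_im, neg_ne_zero] at hξ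
  rcases hξ with h | h
  · refine ⟨1, one_pos, fun t ht => le_trans ?_ (Complex.re_le_norm _)⟩
    simp only [Complex.sub_re, Complex.one_re, Complex.re_mul_ofReal]
    nlinarith
  · have hn : 0 < ‖ξ‖ := norm_pos_iff.2 fun h0 => h (by simp [h0])
    refine ⟨|ξ.im| / ‖ξ‖, div_pos (abs_pos.2 h) hn, fun t _ => ?_⟩
    rw [div_le_iff₀ hn, mul_comm, ← Complex.norm_conj ξ, ← norm_mul]
    refine le_trans (le_of_eq ?_) (Complex.abs_im_le_norm _)
    have : (starRingEnd ℂ ξ * (1 - ξ * t)).im = -ξ.im := by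
      simp [Complex.mul_im]
      ring
    rw [this, abs_neg]

theorem ofReal_mul_cpow {s : ℝ} (hs : 0 < s) {z : ℂ} (hz : z ≠ 0) (a : ℂ) :
    ((s : ℂ) * z) ^ a = (s : ℂ) ^ a * z ^ a := by
  have hs' : (s : ℂ) ≠ 0 := Complex.ofReal_ne_zero.2 hs.ne'
  rw [Complex.cpow_def_of_ne_zero (mul_ne_zero hs' hz), Complex.cpow_def_of_ne_zero hs',
    Complex.cpow_def_of_ne_zero hz, Complex.log_ofReal_mul hs hz, Complex.ofReal_log hs.le,
    add_mul, Complex.exp_add]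

theorem norm_cpow_le_of_norm_le {z a : ℂ} {R : ℝ} (ha : 0 ≤ a.re) (hz : ‖z‖ ≤ R) :
    ‖z ^ a‖ ≤ R ^ a.re * Real.exp (Real.pi * |a.im|) := by
  refine (Complex.norm_cpow_le z a).trans ?_
  rw [div_eq_mul_inv, ← Real.exp_neg]
  refine mul_le_mul (Real.rpow_le_rpow (norm_nonneg _) hz ha) (Real.exp_le_exp.2 ?_)
    (Real.exp_pos _).le (Real.rpow_nonneg ((norm_nonneg _).trans hz) _)
  refine (neg_le_abs _).trans ?_
  rw [abs_mul]
  exact mul_le_mul_of_nonneg_right (Complex.abs_arg_le_pi z) (abs_nonneg _)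

theorem eulerKernel_cons (A B : Fin d → ℂ) (c : Fin (N + 1) → ℂ)
    (T : Fin (N + 1) → Finset (Fin d)) (z₀ : ℂ) (z : Fin N → ℂ) (w : Fin d → ℝ) :
    eulerKernel A B c T (Fin.cons z₀ z) w = (1 - z₀ * (cubeMonomial T w 0 : ℂ)) ^ c 0 *
      eulerKernel A B (fun i => c i.succ) (fun i => T i.succ) z w := by
  simp only [eulerKernel, binomProd, Fin.prod_univ_succ, Fin.cons_zero, Fin.cons_succ,
    cubeMonomial]
  ring

theorem eulerIntegral_cons_zero (A B : Fin d → ℂ) (c : Fin (N + 1) → ℂ)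
    (T : Fin (N + 1) → Finset (Fin d)) (z : Fin N → ℂ) :
    eulerIntegral A B c T (Fin.cons 0 z) =
      eulerIntegral A B (fun i => c i.succ) (fun i => T i.succ) z := by
  simp [eulerIntegral, eulerKernel_cons]

theorem cons_mem_domain0 {z₀ : ℂ} {z : Fin N → ℂ} (h₀ : (1 : ℂ) ∉ segment ℝ 0 z₀)
    (hz : z ∈ domain0 N) : (Fin.cons z₀ z : Fin (N + 1) → ℂ) ∈ domain0 (N + 1) := by
  intro i
  refine Fin.cases ?_ (fun k => ?_) i
  · simpa using h₀
  · simpa using hz k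

theorem eulerKernel_add_single {A B : Fin d → ℂ} (c : Fin N → ℂ) (T : Fin N → Finset (Fin d))
    (z : Fin N → ℂ) (n : Fin d) (a : ℂ) {w : Fin d → ℝ} (hw : w ∈ cube d) :
    eulerKernel (fun k => A k + if k = n then a else 0) B c T z w =
      (w n : ℂ) ^ a * eulerKernel A B c T z w := by
  have h : ∀ k, (w k : ℂ) ^ (A k + if k = n then a else 0) =
      (w k : ℂ) ^ A k * if k = n then (w n : ℂ) ^ a else 1 := fun k => by
    rw [Complex.cpow_add _ _ (ofReal_ne_zero_of_mem hw k)]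
    split_ifs with hk
    · rw [hk]
    · simp
  simp only [eulerKernel, betaDensity, h, Finset.prod_mul_distrib, Finset.prod_ite_eq',
    Finset.mem_univ, if_true]
  ring

variable {A B : Fin d → ℂ} {c : Fin (N + 1) → ℂ} {T : Fin (N + 1) → Finset (Fin d)} {n : Fin d}
  {ξ : ℂ} {z : Fin N → ℂ}

theorem one_notMem_segment_div (hξ : -ξ ∈ Complex.slitPlane) {s : ℝ} (hs : 0 < s) :
    (1 : ℂ) ∉ segment ℝ 0 (ξ / s) := by
  rw [← one_sub_mem_slitPlane_iff]
  have h := ofReal_sub_mul_mem_slitPlane hξ (s := 1) (t := s⁻¹) zero_le_one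
    (inv_nonneg.2 hs.le) (by positivity)
  simpa [div_eq_mul_inv] using h

theorem one_sub_div_mul_ne_zero (hξ : -ξ ∈ Complex.slitPlane) {s : ℝ} (hs : 0 < s)
    {w : Fin d → ℝ} (hw : w ∈ cube d) : 1 - ξ / s * (w n : ℂ) ≠ 0 :=
  Complex.slitPlane_ne_zero (one_sub_mul_mem_slitPlane (one_notMem_segment_div hξ hs)
    (mem_cube.1 hw n).1.le (mem_cube.1 hw n).2.le)

theorem cpow_mul_one_sub_div (hξ : -ξ ∈ Complex.slitPlane) {s : ℝ} (hs : 0 < s)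
    {w : Fin d → ℝ} (hw : w ∈ cube d) (a : ℂ) :
    (s : ℂ) ^ a * (1 - ξ / s * (w n : ℂ)) ^ a = ((s : ℂ) - ξ * w n) ^ a := by
  rw [← ofReal_mul_cpow hs (one_sub_div_mul_ne_zero hξ hs hw)]
  congr 1
  have : (s : ℂ) ≠ 0 := Complex.ofReal_ne_zero.2 hs.ne'
  field_simp

theorem norm_ofReal_sub_mul_le {s : ℝ} (hs : s ∈ Ioo (0 : ℝ) 1) {w : Fin d → ℝ}
    (hw : w ∈ cube d) : ‖(s : ℂ) - ξ * w n‖ ≤ 1 + ‖ξ‖ := by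
  refine (norm_sub_le _ _).trans (add_le_add ?_ ?_)
  · rw [Complex.norm_of_nonneg hs.1.le]; exact hs.2.le
  · rw [norm_mul, Complex.norm_of_nonneg (mem_cube.1 hw n).1.le]
    exact mul_le_of_le_one_right (norm_nonneg _) (mem_cube.1 hw n).2.le

theorem tendsto_ofReal_nhdsGT_zero : Tendsto (fun s : ℝ => (s : ℂ)) (𝓝[>] 0) (𝓝 0) := by
  have h : Tendsto (fun s : ℝ => (s : ℂ)) (𝓝 0) (𝓝 ((0 : ℝ) : ℂ)) :=
    Complex.continuous_ofReal.tendsto 0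
  rw [Complex.ofReal_zero] at h
  exact h.mono_left nhdsWithin_le_nhds

theorem tendsto_ofReal_sub_mul_cpow (hξ : -ξ ∈ Complex.slitPlane) {w : Fin d → ℝ}
    (hw : w ∈ cube d) (a : ℂ) : Tendsto (fun s : ℝ => ((s : ℂ) - ξ * w n) ^ a) (𝓝[>] 0)
      (𝓝 ((-ξ) ^ a * (w n : ℂ) ^ a)) := by
  have hn := (mem_cube.1 hw n).1
  have h1 : ContinuousAt (fun s : ℝ => ((s : ℂ) - ξ * w n) ^ a) 0 := by
    refine ContinuousAt.cpow (by fun_prop) continuousAt_const ?_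
    exact ofReal_sub_mul_mem_slitPlane hξ le_rfl hn.le (by simpa using hn)
  have h2 := h1.tendsto.mono_left (nhdsWithin_le_nhds (s := Ioi 0))
  have e : (((0 : ℝ) : ℂ) - ξ * w n) ^ a = (-ξ) ^ a * (w n : ℂ) ^ a := by
    rw [mul_comm ((-ξ) ^ a), ← ofReal_mul_cpow hn (Complex.slitPlane_ne_zero hξ)]
    congr 1
    simp [mul_comm]
  rwa [e] at h2

/-- The limit in which one argument `ξ / s` of an Euler integral, whose monomial is the single
coordinate `w_n`, tends to infinity: since `s ^ c (1 - ξ w_n / s) ^ c = (s - ξ w_n) ^ c`, the factor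
turns into a power of `w_n`. -/
theorem tendsto_cpow_mul_eulerIntegral (hA : ∀ k, -1 < (A k).re) (hB : ∀ k, -1 < (B k).re)
    (hc : 0 < (c 0).re) (hT : T 0 = {n}) (hz : z ∈ domain0 N) (hξ : -ξ ∈ Complex.slitPlane) :
    Tendsto (fun s : ℝ => (s : ℂ) ^ c 0 * eulerIntegral A B c T (Fin.cons (ξ / s) z)) (𝓝[>] 0)
      (𝓝 ((-ξ) ^ c 0 * eulerIntegral (fun k => A k + if k = n then c 0 else 0) B
        (fun i => c i.succ) (fun i => T i.succ) z)) := by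
  simp only [eulerIntegral, ← integral_const_mul]
  have hmon : ∀ w : Fin d → ℝ, (cubeMonomial T w 0 : ℂ) = w n := fun w => by
    simp [cubeMonomial, hT]
  have hev : ∀ᶠ s : ℝ in 𝓝[>] 0, s ∈ Ioo (0 : ℝ) 1 := Ioo_mem_nhdsGT one_pos
  refine tendsto_integral_filter_of_dominated_convergence
    (fun w => ((1 + ‖ξ‖) ^ (c 0).re * Real.exp (Real.pi * |(c 0).im|)) *
      ‖eulerKernel A B (fun i => c i.succ) (fun i => T i.succ) z w‖) ?_ ?_ ?_ ?_
  · filter_upwards [hev] with s hs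
    exact ((integrableOn_eulerKernel hA hB _ _ (cons_mem_domain0
      (one_notMem_segment_div hξ hs.1) hz)).const_mul _).aestronglyMeasurable
  · filter_upwards [hev] with s hs
    refine (ae_restrict_iff' measurableSet_cube).2 (Eventually.of_forall fun w hw => ?_)
    rw [eulerKernel_cons, hmon, ← mul_assoc, cpow_mul_one_sub_div hξ hs.1 hw, norm_mul]
    exact mul_le_mul_of_nonneg_right
      (norm_cpow_le_of_norm_le hc.le (norm_ofReal_sub_mul_le hs hw)) (norm_nonneg _)
  · exact (integrableOn_eulerKernel hA hB _ _ hz).norm.const_mul _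
  · refine (ae_restrict_iff' measurableSet_cube).2 (Eventually.of_forall fun w hw => ?_)
    rw [eulerKernel_add_single _ _ _ _ _ hw, ← mul_assoc]
    refine ((tendsto_ofReal_sub_mul_cpow hξ hw (c 0)).mul_const _).congr' ?_
    filter_upwards [hev] with s hs
    rw [eulerKernel_cons, hmon, ← mul_assoc, cpow_mul_one_sub_div hξ hs.1 hw]

/-- With one more power of `s` than in `tendsto_cpow_mul_eulerIntegral` the limit is zero. It is
assumed only that `c + 1`, and not `c`, has positive real part. -/
theorem tendsto_cpow_add_one_mul_eulerIntegral (hA : ∀ k, -1 < (A k).re)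
    (hB : ∀ k, -1 < (B k).re) (hc : 0 < (c 0 + 1).re) (hT : T 0 = {n}) (hz : z ∈ domain0 N)
    (hξ : -ξ ∈ Complex.slitPlane) :
    Tendsto (fun s : ℝ => (s : ℂ) ^ (c 0 + 1) * eulerIntegral A B c T (Fin.cons (ξ / s) z))
      (𝓝[>] 0) (𝓝 0) := by
  simp only [eulerIntegral, ← integral_const_mul]
  have hmon : ∀ w : Fin d → ℝ, (cubeMonomial T w 0 : ℂ) = w n := fun w => by
    simp [cubeMonomial, hT]
  have hev : ∀ᶠ s : ℝ in 𝓝[>] 0, s ∈ Ioo (0 : ℝ) 1 := Ioo_mem_nhdsGT one_pos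
  obtain ⟨δ, hδ, hδ'⟩ := exists_le_norm_one_sub_mul hξ
  have hker : ∀ s ∈ Ioo (0 : ℝ) 1, ∀ w ∈ cube d,
      (s : ℂ) ^ (c 0 + 1) * eulerKernel A B c T (Fin.cons (ξ / s) z) w =
        ((s : ℂ) - ξ * w n) ^ (c 0 + 1) * (1 - ξ / s * (w n : ℂ))⁻¹ *
          eulerKernel A B (fun i => c i.succ) (fun i => T i.succ) z w := fun s hs w hw => by
    have h0 := one_sub_div_mul_ne_zero (n := n) hξ hs.1 hw
    rw [eulerKernel_cons, hmon, ← cpow_mul_one_sub_div hξ hs.1 hw,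
      Complex.cpow_add _ 1 h0, Complex.cpow_one]
    linear_combination -((s : ℂ) ^ (c 0 + 1) * (1 - ξ / s * (w n : ℂ)) ^ c 0 *
      eulerKernel A B (fun i => c i.succ) (fun i => T i.succ) z w) * mul_inv_cancel₀ h0
  rw [← integral_zero (Fin d → ℝ) ℂ (μ := volume.restrict (cube d))]
  refine tendsto_integral_filter_of_dominated_convergence
    (fun w => ((1 + ‖ξ‖) ^ (c 0 + 1).re * Real.exp (Real.pi * |(c 0 + 1).im|) * δ⁻¹) *
      ‖eulerKernel A B (fun i => c i.succ) (fun i => T i.succ) z w‖) ?_ ?_ ?_ ?_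
  · filter_upwards [hev] with s hs
    exact ((integrableOn_eulerKernel hA hB _ _ (cons_mem_domain0
      (one_notMem_segment_div hξ hs.1) hz)).const_mul _).aestronglyMeasurable
  · filter_upwards [hev] with s hs
    refine (ae_restrict_iff' measurableSet_cube).2 (Eventually.of_forall fun w hw => ?_)
    rw [hker s hs w hw, norm_mul, norm_mul, norm_inv]
    refine mul_le_mul_of_nonneg_right (mul_le_mul (norm_cpow_le_of_norm_le hc.le
      (norm_ofReal_sub_mul_le hs hw)) (inv_anti₀ hδ ?_) (by positivity) (by positivity))
      (norm_nonneg _)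
    have := hδ' (w n / s) (div_nonneg (mem_cube.1 hw n).1.le hs.1.le)
    refine this.trans_eq ?_
    congr 2
    rw [Complex.ofReal_div, mul_div_assoc', div_mul_eq_mul_div]
  · exact (integrableOn_eulerKernel hA hB _ _ hz).norm.const_mul _
  · refine (ae_restrict_iff' measurableSet_cube).2 (Eventually.of_forall fun w hw => ?_)
    have hn := (mem_cube.1 hw n).1
    have h1 := tendsto_ofReal_nhdsGT_zero.mul
      ((tendsto_ofReal_sub_mul_cpow (n := n) hξ hw (c 0)).mul_const
        (eulerKernel A B (fun i => c i.succ) (fun i => T i.succ) z w))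
    rw [zero_mul] at h1
    refine h1.congr' ?_
    filter_upwards [hev] with s hs
    have hs0 : (s : ℂ) ≠ 0 := Complex.ofReal_ne_zero.2 hs.1.ne'
    rw [eulerKernel_cons, hmon, ← cpow_mul_one_sub_div hξ hs.1 hw, Complex.cpow_add _ _ hs0,
      Complex.cpow_one]
    ring

end Confluence

/-! ### The normalized matrix of periods and its confluent limit -/

section Normalized

variable {d N : ℕ} (p : Params d N)

/-- The factor `1 / x_i` that distinguishes the entries in the rows `(i, m)` of the columns `(j, n)`
with `i ≠ j`. -/
noncomputable def rowFactor (r c : Idx d N) (x : Fin N → ℂ) : ℂ :=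
  match r, c with
  | some (i, _), some (j, _) => if i = j then 1 else 1 / x i
  | _, _ => 1

/-- The integral power of `x_j` in the entry `(r, c)` of a column `c = (j, n)`. -/
noncomputable def colPow (r c : Idx d N) (x : Fin N → ℂ) : ℂ :=
  match c with
  | none => 1
  | some (j, n) => x j ^ extraOrder j n r

/-- The multi-valued factor of the column `c`. -/
noncomputable def colPrefactor (c : Idx d N) (ell : Fin N → ℂ) : ℂ :=
  match c with
  | none => 1
  | some (j, n) => Complex.exp (p.b j n * ell j) *
      ∏ i ∈ Finset.univ.erase j, Complex.exp (-p.β i * ell i)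

/-- The holomorphic part of the entry `(r, c)` of the matrix of periods. -/
noncomputable def holPart (r c : Idx d N) (x : Fin N → ℂ) : ℂ :=
  rowFactor r c x * colSign r c *
    eulerIntegral (expA p r c) (expB p r c) (expC p r c) (colT c) (colZ c x)

/-- The matrix of periods without the multi-valued factors of its columns. -/
noncomputable def normalizedMatrix (x : Fin N → ℂ) : Matrix (Idx d N) (Idx d N) ℂ :=
  Matrix.of fun r c => colPow r c x * holPart p r c x

variable {p}

theorem colPrefactor_ne_zero (c : Idx d N) (ell : Fin N → ℂ) : colPrefactor p c ell ≠ 0 := by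
  rcases c with _ | ⟨j, n⟩
  · exact one_ne_zero
  · exact mul_ne_zero (Complex.exp_ne_zero _)
      (Finset.prod_ne_zero_iff.2 fun _ _ => Complex.exp_ne_zero _)

theorem exp_sum_expNu (r c : Idx d N) {x ell : Fin N → ℂ}
    (hell : ∀ l, Complex.exp (ell l) = x l) : Complex.exp (∑ l, expNu p r c l * ell l) =
      colPrefactor p c ell * (colPow r c x * rowFactor r c x) := by
  rcases c with _ | ⟨j, n⟩
  · rcases r with _ | ⟨i, m⟩ <;> simp [expNu, colPrefactor, colPow, rowFactor]
  · have h1 : Complex.exp (expNu p r (some (j, n)) j * ell j) =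
        Complex.exp (p.b j n * ell j) * x j ^ extraOrder j n r := by
      simp only [expNu, if_true]
      rw [add_mul, Complex.exp_add, Complex.exp_nat_mul, hell]
    have h2 : ∏ l ∈ Finset.univ.erase j, Complex.exp (expNu p r (some (j, n)) l * ell l) =
        (∏ l ∈ Finset.univ.erase j, Complex.exp (-p.β l * ell l)) *
          rowFactor r (some (j, n)) x := by
      rcases r with _ | ⟨i, m⟩
      · rw [rowFactor, mul_one]
        · refine Finset.prod_congr rfl fun l hl => ?_
          simp [expNu, Finset.ne_of_mem_erase hl]
        · simp
      · have h3 : ∀ l ∈ Finset.univ.erase j, Complex.exp (expNu p (some (i, m)) (some (j, n)) l *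
            ell l) = Complex.exp (-p.β l * ell l) * if l = i then 1 / x i else 1 := by
          intro l hl
          simp only [expNu, Finset.ne_of_mem_erase hl, if_false]
          rw [sub_mul, Complex.exp_sub]
          split_ifs with h
          · rw [one_mul, hell, h]; ring
          · simp
        rw [Finset.prod_congr rfl h3, Finset.prod_mul_distrib, Finset.prod_ite_eq']
        congr 1
        by_cases hij : i = j
        · simp [rowFactor, hij]
        · simp [rowFactor, hij]
    rw [← Finset.add_sum_erase _ _ (Finset.mem_univ j), Complex.exp_add, Complex.exp_sum, h1, h2]
    simp only [colPrefactor, colPow]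
    ring

/-- The factorization of the periods that is asserted in the local behaviour. -/
theorem integral_colKernel_eq (r c : Idx d N) {x ell : Fin N → ℂ}
    (hell : ∀ l, Complex.exp (ell l) = x l) :
    ∫ w in cube d, colKernel p r c x ell w =
      colPrefactor p c ell * normalizedMatrix p x r c := by
  rw [integral_colKernel, exp_sum_expNu r c hell, normalizedMatrix, Matrix.of_apply, holPart]
  ring

end Normalized

section Slit

variable {N : ℕ}

theorem mem_segment_zero_iff {y z : ℂ} :
    y ∈ segment ℝ 0 z ↔ ∃ t : ℝ, 0 ≤ t ∧ t ≤ 1 ∧ (t : ℂ) * z = y := by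
  simp only [segment_eq_image, smul_zero, zero_add, mem_image, mem_Icc, Complex.real_smul,
    and_assoc]

/-- The coordinates of a point of the slit domain have distinct arguments. -/
theorem neg_div_mem_slitPlane {x : Fin N → ℂ} (hx : x ∈ slitDomain N) {i j : Fin N} (h : i ≠ j) :
    -(x i / x j) ∈ Complex.slitPlane := by
  by_contra hc
  rw [Complex.mem_slitPlane_iff] at hc
  simp only [Complex.neg_re, Complex.neg_im, neg_ne_zero, not_or, not_lt, not_not] at hc
  set t := (x i / x j).re with ht
  have ht0 : 0 ≤ t := by linarith [hc.1]
  have hti : (t : ℂ) * x j = x i := by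
    have : x i / x j = t := Complex.ext (by simp [ht]) (by simp [hc.2])
    rw [← this, div_mul_cancel₀ _ (hx j).1]
  rcases le_total t 1 with h1 | h1
  · exact (hx j).2.2 i h (mem_segment_zero_iff.2 ⟨t, ht0, h1, hti⟩)
  · have ht' : (t : ℂ) ≠ 0 := Complex.ofReal_ne_zero.2 (by linarith)
    refine (hx i).2.2 j h.symm (mem_segment_zero_iff.2 ⟨t⁻¹, inv_nonneg.2 ht0,
      inv_le_one_of_one_le₀ h1, ?_⟩)
    rw [← hti, Complex.ofReal_inv, inv_mul_cancel_left₀ ht']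

theorem notMem_segment_of_neg_div_mem_slitPlane {a b : ℂ} (ha : a ≠ 0)
    (h : -(b / a) ∈ Complex.slitPlane) : b ∉ segment ℝ 0 a := by
  rw [mem_segment_zero_iff]
  rintro ⟨t, ht0, _, rfl⟩
  rw [mul_div_cancel_right₀ _ ha] at h
  rcases Complex.mem_slitPlane_iff.1 h with h | h
  · simp at h; linarith
  · simp at h

theorem mem_slitDomain_of_cons {x₀ : ℂ} {x : Fin N → ℂ}
    (hx : (Fin.cons x₀ x : Fin (N + 1) → ℂ) ∈ slitDomain (N + 1)) : x ∈ slitDomain N := by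
  intro j
  have h := hx j.succ
  simp only [Fin.cons_succ] at h
  refine ⟨h.1, ?_, fun i hi => ?_⟩
  · simpa using h.2.1
  · simpa using h.2.2 i.succ (by simpa using hi)

/-- The slit domain is stable under shrinking a coordinate, since it only restricts the arguments of
the coordinates and their positions relative to `1`. -/
theorem cons_ofReal_mul_mem_slitDomain {x₀ : ℂ} {x : Fin N → ℂ}
    (hx : (Fin.cons x₀ x : Fin (N + 1) → ℂ) ∈ slitDomain (N + 1)) {s : ℝ} (hs : 0 < s)
    (hs1 : s ≤ 1) : (Fin.cons (s * x₀) x : Fin (N + 1) → ℂ) ∈ slitDomain (N + 1) := by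
  have hs' : (s : ℂ) ≠ 0 := Complex.ofReal_ne_zero.2 hs.ne'
  have hx0 : x₀ ≠ 0 := by simpa using (hx 0).1
  have hd : ∀ k : Fin N, -(x k / (s * x₀)) ∈ Complex.slitPlane := fun k => by
    have h := neg_div_mem_slitPlane hx (Fin.succ_ne_zero k)
    simp only [Fin.cons_succ, Fin.cons_zero] at h
    have e : -(x k / (s * x₀)) = (s⁻¹ : ℝ) * -(x k / x₀) := by
      push_cast; field_simp
    rw [e, Complex.mem_slitPlane_iff] at *
    rw [Complex.re_ofReal_mul, Complex.im_ofReal_mul]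
    have hs2 : 0 < s⁻¹ := inv_pos.2 hs
    exact h.imp (fun h => mul_pos hs2 h) fun h => mul_ne_zero hs2.ne' h
  have hd' : ∀ k : Fin N, -(s * x₀ / x k) ∈ Complex.slitPlane := fun k => by
    have h := neg_div_mem_slitPlane hx (Fin.succ_ne_zero k).symm
    simp only [Fin.cons_succ, Fin.cons_zero] at h
    have e : -(s * x₀ / x k) = s * -(x₀ / x k) := by ring
    rw [e, Complex.mem_slitPlane_iff] at *
    rw [Complex.re_ofReal_mul, Complex.im_ofReal_mul]
    exact h.imp (fun h => mul_pos hs h) fun h => mul_ne_zero hs.ne' h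
  intro j
  refine Fin.cases ?_ (fun k => ?_) j
  · refine ⟨by simpa [hs.ne'] using hx0, ?_, fun i hi => ?_⟩
    · have h := (hx 0).2.1
      simp only [Fin.cons_zero] at h ⊢
      rw [mem_segment_zero_iff] at h ⊢
      rintro ⟨t, ht0, ht1, ht⟩
      exact h ⟨t * s, by positivity, mul_le_one₀ ht1 hs.le hs1, by rw [← ht]; push_cast; ring⟩
    · obtain ⟨k, rfl⟩ := Fin.exists_succ_eq.2 hi
      simpa using notMem_segment_of_neg_div_mem_slitPlane (mul_ne_zero hs' hx0) (hd k)
  · have h := hx k.succ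
    refine ⟨by simpa using h.1, by simpa using h.2.1, fun i hi => ?_⟩
    refine Fin.cases (fun hi => ?_) (fun l hi => ?_) i hi
    · simpa using notMem_segment_of_neg_div_mem_slitPlane (by simpa using h.1) (hd' k)
    · simpa using h.2.2 l.succ hi

end Slit

section Confluence

variable {d N : ℕ} {p : Params d (N + 1)}

/-- The parameters that remain when the first variable, and with it `β_0`, is dropped. -/
def Params.tail (p : Params d (N + 1)) : Params d N where
  α := p.α
  β := fun i => p.β i.succ
  γ := p.γ

theorem Params.Convergent.tail (hp : p.Convergent) : p.tail.Convergent where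
  α_pos := hp.α_pos
  α_lt_γ := hp.α_lt_γ
  γ_lt_α := hp.γ_lt_α
  γ_lt n := by
    have h := hp.γ_lt n
    rw [Fin.sum_univ_succ] at h
    have h0 := hp.β_neg 0
    simp only [Params.tail]
    linarith
  β_neg i := hp.β_neg i.succ

/-- The index of a row or column, after a variable has been added in front of the others. -/
def liftIdx (r : Idx d N) : Idx d (N + 1) :=
  match r with
  | none => none
  | some (i, m) => some (i.succ, m)

theorem expA_liftIdx_none (r : Idx d N) :
    expA p (liftIdx r) none = expA p.tail r none := by
  rcases r with _ | ⟨i, m⟩ <;> rfl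

theorem expB_liftIdx (r c : Idx d N) :
    expB p (liftIdx r) (liftIdx c) = expB p.tail r c := by
  ext k
  rcases r with _ | ⟨i, m⟩ <;> rcases c with _ | ⟨j, n⟩ <;>
    simp [expB, baseB, shiftB, liftIdx, Params.tail, Params.η, Params.θ]

theorem expC_liftIdx_succ (r c : Idx d N) (l : Fin N) :
    expC p (liftIdx r) (liftIdx c) l.succ = expC p.tail r c l := by
  rcases r with _ | ⟨i, m⟩ <;> rcases c with _ | ⟨j, n⟩ <;>
    simp [expC, baseC, shiftC, liftIdx, Params.tail, Params.η, Params.θ]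

theorem expC_liftIdx_zero (r : Idx d N) (j : Fin N) (n : Fin d) :
    expC p (liftIdx r) (some (j.succ, n)) 0 = p.θ 0 := by
  rcases r with _ | ⟨i, m⟩ <;>
    simp [expC, baseC, shiftC, liftIdx, (Fin.succ_ne_zero _).symm]

/-- The exponent of `w_n` absorbs the factor of the first variable, which becomes a power of `w_n`
in the confluent limit. -/
theorem expA_liftIdx_some (r : Idx d N) (j : Fin N) (n k : Fin d) :
    expA p (liftIdx r) (some (j.succ, n)) k + (if k = n then p.θ 0 else 0) =
      expA p.tail r (some (j, n)) k := by
  have h : shiftA (liftIdx r) (some (j.succ, n)) k = shiftA r (some (j, n)) k := by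
    rcases r with _ | ⟨i, m⟩ <;> rfl
  rw [expA, expA, h]
  simp only [baseA, Params.tail, Params.θ]
  split_ifs
  · rw [Fin.sum_univ_succ]; ring
  · ring

theorem colT_liftIdx_succ (c : Idx d N) (i : Fin N) : colT (liftIdx c) i.succ = colT c i := by
  rcases c with _ | ⟨j, n⟩ <;> simp [colT, liftIdx]

theorem colSign_liftIdx (r c : Idx d N) : colSign (liftIdx r) (liftIdx c) = colSign r c := by
  rcases r with _ | ⟨i, m⟩ <;> rcases c with _ | ⟨j, n⟩ <;> rfl

theorem colPow_liftIdx (r c : Idx d N) (x₀ : ℂ) (x : Fin N → ℂ) :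
    colPow (liftIdx r) (liftIdx c) (Fin.cons x₀ x) = colPow r c x := by
  rcases r with _ | ⟨i, m⟩ <;> rcases c with _ | ⟨j, n⟩ <;>
    simp [colPow, liftIdx, extraOrder]

theorem rowFactor_liftIdx (r c : Idx d N) (x₀ : ℂ) (x : Fin N → ℂ) :
    rowFactor (liftIdx r) (liftIdx c) (Fin.cons x₀ x) = rowFactor r c x := by
  rcases r with _ | ⟨i, m⟩ <;> rcases c with _ | ⟨j, n⟩ <;>
    simp [rowFactor, liftIdx]

theorem colZ_some_succ (j : Fin N) (n : Fin d) (x₀ : ℂ) (x : Fin N → ℂ) :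
    colZ (some (j.succ, n)) (Fin.cons x₀ x : Fin (N + 1) → ℂ) =
      Fin.cons (x j / x₀) (colZ (some (j, n)) x) := by
  ext i
  refine Fin.cases ?_ (fun k => ?_) i
  · simp [colZ, (Fin.succ_ne_zero _).symm]
  · simp [colZ]

variable {x₀ : ℂ} {x : Fin N → ℂ}

theorem tendsto_holPart_none (hp : p.Convergent) (hx : x ∈ slitDomain N) (r : Idx d (N + 1)) :
    Tendsto (fun s : ℝ => holPart p r none (Fin.cons (s * x₀) x)) (𝓝[>] 0)
      (𝓝 (colSign r none * eulerIntegral (expA p r none) (expB p r none)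
        (fun l => expC p r none l.succ) (fun l => colT (none : Idx d (N + 1)) l.succ) x)) := by
  have h1 : ∀ y : Fin (N + 1) → ℂ, holPart p r none y = colSign r none *
      eulerIntegral (expA p r none) (expB p r none) (expC p r none) (colT none) y := fun y => by
    rcases r with _ | ⟨i, m⟩ <;> simp only [holPart, rowFactor, one_mul] <;> rfl
  simp only [h1]
  refine Tendsto.const_mul _ ?_
  rw [← eulerIntegral_cons_zero]
  have hmem : (Fin.cons 0 x : Fin (N + 1) → ℂ) ∈ domain0 (N + 1) :=
    cons_mem_domain0 (by simp) (slitDomain_subset_domain0 hx)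
  have hc := ((differentiableOn_eulerIntegral (expA_re hp r none) (expB_re hp r none)
    (expC p r none) (colT none)).differentiableAt
      (isOpen_domain0.mem_nhds hmem)).continuousAt.tendsto
  refine hc.comp (tendsto_pi_nhds.2 fun i => ?_)
  refine Fin.cases ?_ (fun k => ?_) i
  · simpa using tendsto_ofReal_nhdsGT_zero.mul_const x₀
  · simp

theorem tendsto_colZ_zero (n : Fin d) : Tendsto (fun s : ℝ => colZ (some (0, n))
    (Fin.cons (s * x₀) x : Fin (N + 1) → ℂ)) (𝓝[>] 0) (𝓝 0) := by
  have h0 : Tendsto (fun s : ℝ => (s : ℂ) * x₀) (𝓝[>] 0) (𝓝 0) := by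
    simpa using tendsto_ofReal_nhdsGT_zero.mul_const x₀
  refine tendsto_pi_nhds.2 fun i => ?_
  refine Fin.cases ?_ (fun k => ?_) i
  · simpa [colZ] using h0
  · simpa [colZ] using h0.div_const (x k)

theorem zero_mem_domain0 : (0 : Fin N → ℂ) ∈ domain0 N := fun _ => by simp

theorem tendsto_eulerIntegral_colZ_zero (hp : p.Convergent) (r : Idx d (N + 1)) (n : Fin d) :
    Tendsto (fun s : ℝ => eulerIntegral (expA p r (some (0, n))) (expB p r (some (0, n)))
        (expC p r (some (0, n))) (colT (some (0, n)))
        (colZ (some (0, n)) (Fin.cons (s * x₀) x))) (𝓝[>] 0)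
      (𝓝 (eulerIntegral (expA p r (some (0, n))) (expB p r (some (0, n)))
        (expC p r (some (0, n))) (colT (some (0, n))) 0)) :=
  ((differentiableOn_eulerIntegral (expA_re hp r _) (expB_re hp r _) _ _).differentiableAt
    (isOpen_domain0.mem_nhds zero_mem_domain0)).continuousAt.tendsto.comp (tendsto_colZ_zero n)

/-- The scaling of the rows of the normalized matrix in the confluent limit. -/
noncomputable def rowScale (s : ℝ) (r : Idx d (N + 1)) : ℂ :=
  match r with
  | none => 1
  | some (i, _) => if i = 0 then s else 1

/-- The scaling of the columns of the normalized matrix in the confluent limit. -/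
noncomputable def colScale (p : Params d (N + 1)) (s : ℝ) (c : Idx d (N + 1)) : ℂ :=
  match c with
  | none => 1
  | some (j, _) => if j = 0 then (s : ℂ)⁻¹ else (s : ℂ) ^ p.θ 0

/-- The factors of the columns in the confluent limit. -/
noncomputable def limitFactor (p : Params d (N + 1)) (x₀ : ℂ) (x : Fin N → ℂ) (c : Idx d N) : ℂ :=
  match c with
  | none => 1
  | some (j, _) => (-(x j / x₀)) ^ p.θ 0

/-- The normalized matrix of periods at the point `(s x_0, x)`, with rescaled rows and columns. -/
noncomputable def scaledMatrix (p : Params d (N + 1)) (x₀ : ℂ) (x : Fin N → ℂ) (s : ℝ) :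
    Matrix (Idx d (N + 1)) (Idx d (N + 1)) ℂ :=
  Matrix.of fun r c => rowScale s r * normalizedMatrix p (Fin.cons (s * x₀) x) r c * colScale p s c

theorem θ_re_pos (hp : p.Convergent) (i : Fin (N + 1)) : 0 < (p.θ i).re := by
  simpa [Params.θ] using hp.β_neg i

theorem rowScale_liftIdx (s : ℝ) (r : Idx d N) : rowScale s (liftIdx r) = 1 := by
  rcases r with _ | ⟨i, m⟩ <;> simp [rowScale, liftIdx]

/-- The block of the remaining variables: in the limit `x_0 → 0` the entries are those of the matrix
with one variable less, up to factors of the columns. -/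
theorem tendsto_scaledMatrix_lift_lift (hp : p.Convergent)
    (hx : (Fin.cons x₀ x : Fin (N + 1) → ℂ) ∈ slitDomain (N + 1)) (r c : Idx d N) :
    Tendsto (fun s => scaledMatrix p x₀ x s (liftIdx r) (liftIdx c)) (𝓝[>] 0)
      (𝓝 (normalizedMatrix p.tail x r c * limitFactor p x₀ x c)) := by
  have hx' := mem_slitDomain_of_cons hx
  simp only [scaledMatrix, Matrix.of_apply, normalizedMatrix, rowScale_liftIdx, one_mul,
    colPow_liftIdx]
  rcases c with _ | ⟨j, n⟩
  · have h := (tendsto_holPart_none (x₀ := x₀) hp hx' (liftIdx r)).const_mul (colPow r none x)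
    have hr : rowFactor r none x = 1 := by rcases r with _ | ⟨i, m⟩ <;> rfl
    have hs : colSign (liftIdx r) (none : Idx d (N + 1)) = colSign r (none : Idx d N) :=
      colSign_liftIdx r none
    have hB : expB p (liftIdx r) none = expB p.tail r none := expB_liftIdx r none
    have hC : (fun l : Fin N => expC p (liftIdx r) none l.succ) = expC p.tail r none :=
      funext fun l => expC_liftIdx_succ r none l
    have hT : (fun l : Fin N => colT (none : Idx d (N + 1)) l.succ) = colT (none : Idx d N) := rfl
    rw [hs, expA_liftIdx_none, hB, hC, hT] at h
    have hlift : liftIdx (none : Idx d N) = none := rfl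
    rw [holPart, hr, one_mul, limitFactor, mul_one]
    simp only [hlift, colScale, mul_one]
    exact h
  · have hξ : -(x j / x₀) ∈ Complex.slitPlane := by
      simpa using neg_div_mem_slitPlane hx (Fin.succ_ne_zero j)
    have hlift : liftIdx (some (j, n)) = (some (j.succ, n) : Idx d (N + 1)) := rfl
    have hc0 := expC_liftIdx_zero (p := p) r j n
    have h := tendsto_cpow_mul_eulerIntegral (expA_re hp (liftIdx r) (some (j.succ, n)))
      (expB_re hp (liftIdx r) (some (j.succ, n))) (c := expC p (liftIdx r) (some (j.succ, n)))
      (T := colT (some (j.succ, n))) (n := n) (by rw [hc0]; exact θ_re_pos hp 0)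
      (by simp [colT, (Fin.succ_ne_zero _).symm])
      (colZ_mem_domain0 (slitDomain_subset_colDomain (some (j, n)) hx')) hξ
    have hA : (fun k => expA p (liftIdx r) (some (j.succ, n)) k +
        if k = n then p.θ 0 else 0) = expA p.tail r (some (j, n)) :=
      funext fun k => expA_liftIdx_some r j n k
    have hB : expB p (liftIdx r) (some (j.succ, n)) = expB p.tail r (some (j, n)) :=
      expB_liftIdx r (some (j, n))
    have hC : (fun l : Fin N => expC p (liftIdx r) (some (j.succ, n)) l.succ) =
        expC p.tail r (some (j, n)) := funext fun l => expC_liftIdx_succ r (some (j, n)) l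
    have hT : (fun l : Fin N => colT (some (j.succ, n) : Idx d (N + 1)) l.succ) =
        colT (some (j, n)) := funext fun l => colT_liftIdx_succ (some (j, n)) l
    rw [hc0, hA, hC, hT] at h
    have h2 := h.const_mul (colPow r (some (j, n)) x * (rowFactor r (some (j, n)) x *
      colSign r (some (j, n))))
    have e : ∀ s : ℝ, x j / (s * x₀) = x j / x₀ / s := fun s => by rw [mul_comm, div_div]
    have key : ∀ s : ℝ, colPow r (some (j, n)) x *
        holPart p (liftIdx r) (liftIdx (some (j, n))) (Fin.cons (s * x₀) x) *
          colScale p s (liftIdx (some (j, n))) =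
        colPow r (some (j, n)) x * (rowFactor r (some (j, n)) x * colSign r (some (j, n))) *
        ((s : ℂ) ^ p.θ 0 * eulerIntegral (expA p (liftIdx r) (some (j.succ, n)))
          (expB p (liftIdx r) (some (j.succ, n))) (expC p (liftIdx r) (some (j.succ, n)))
          (colT (some (j.succ, n))) (Fin.cons (x j / x₀ / s) (colZ (some (j, n)) x))) := by
      intro s
      rw [holPart, rowFactor_liftIdx, colSign_liftIdx, hlift, colZ_some_succ, e]
      simp only [colScale, Fin.succ_ne_zero, if_false]
      ring
    simp only [key]
    convert h2 using 2
    rw [holPart, limitFactor, hB]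
    ring

/-- The off-diagonal block that vanishes in the confluent limit. -/
theorem tendsto_scaledMatrix_zero_lift (hp : p.Convergent)
    (hx : (Fin.cons x₀ x : Fin (N + 1) → ℂ) ∈ slitDomain (N + 1)) (m : Fin d) (c : Idx d N) :
    Tendsto (fun s => scaledMatrix p x₀ x s (some (0, m)) (liftIdx c)) (𝓝[>] 0) (𝓝 0) := by
  have hx' := mem_slitDomain_of_cons hx
  have hx0 : x₀ ≠ 0 := by simpa using (hx 0).1
  simp only [scaledMatrix, Matrix.of_apply, normalizedMatrix]
  rcases c with _ | ⟨j, n⟩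
  · have h := tendsto_ofReal_nhdsGT_zero.mul
      (tendsto_holPart_none (x₀ := x₀) hp hx' (some (0, m)))
    rw [zero_mul] at h
    simpa [rowScale, colPow, colScale, liftIdx] using h
  · have hξ : -(x j / x₀) ∈ Complex.slitPlane := by
      simpa using neg_div_mem_slitPlane hx (Fin.succ_ne_zero j)
    have hc0 : expC p (some (0, m)) (some (j.succ, n)) 0 + 1 = p.θ 0 := by
      simp [expC, baseC, shiftC, (Fin.succ_ne_zero _).symm]
    have h := tendsto_cpow_add_one_mul_eulerIntegral (expA_re hp (some (0, m)) (some (j.succ, n)))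
      (expB_re hp (some (0, m)) (some (j.succ, n))) (c := expC p (some (0, m)) (some (j.succ, n)))
      (T := colT (some (j.succ, n))) (n := n) (by rw [hc0]; exact θ_re_pos hp 0)
      (by simp [colT, (Fin.succ_ne_zero _).symm])
      (colZ_mem_domain0 (slitDomain_subset_colDomain (some (j, n)) hx')) hξ
    rw [hc0] at h
    have h2 := h.const_mul (x j ^ extraOrder j.succ n (some (0, m)) * (1 / x₀ *
      colSign (some ((0 : Fin (N + 1)), m)) (some (j.succ, n))))
    rw [mul_zero] at h2
    refine h2.congr' ?_
    filter_upwards [self_mem_nhdsWithin] with s hs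
    have hs0 : (s : ℂ) ≠ 0 := Complex.ofReal_ne_zero.2 (ne_of_gt hs)
    have hlift : liftIdx (some (j, n)) = (some (j.succ, n) : Idx d (N + 1)) := rfl
    have e : x j / (s * x₀) = x j / x₀ / s := by rw [mul_comm, div_div]
    rw [hlift, holPart, colZ_some_succ, e]
    simp only [rowScale, colPow, colScale, rowFactor, if_true, Fin.succ_ne_zero, if_false,
      (Fin.succ_ne_zero _).symm, Fin.cons_succ, Fin.cons_zero]
    field_simp

/-- The entries of the diagonal block of the confluent limit that belongs to the first variable. -/
noncomputable def limitBlock (p : Params d (N + 1)) : Matrix (Fin d) (Fin d) ℂ :=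
  Matrix.of fun m n => 0 ^ extraOrder 0 n (some ((0 : Fin (N + 1)), m)) *
    (colSign (some ((0 : Fin (N + 1)), m)) (some (0, n)) *
      eulerIntegral (expA p (some (0, m)) (some (0, n))) (expB p (some (0, m)) (some (0, n)))
        (expC p (some (0, m)) (some (0, n))) (colT (some (0, n))) 0)

theorem det_limitBlock_ne_zero (hp : p.Convergent) : (limitBlock p).det ≠ 0 := by
  rw [Matrix.det_of_isLowerTriangular]
  · refine Finset.prod_ne_zero_iff.2 fun m _ => ?_
    simp only [limitBlock, Matrix.of_apply, extraOrder, if_true, lt_irrefl, if_false, colSign]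
    have h := eulerIntegral_ne_zero_of_eq_zero (expA_re hp (some (0, m)) (some (0, m)))
      (expB_re hp (some (0, m)) (some (0, m))) (expC p (some (0, m)) (some (0, m)))
      (colT (some (0, m))) (z := 0) (fun _ => rfl)
    simpa using h
  · intro m n hmn
    have hmn' : m < n := hmn
    simp [limitBlock, extraOrder, hmn']

/-- The diagonal block of the first variable, whose Euler integrals have all their arguments tending
to zero. -/
theorem tendsto_scaledMatrix_zero_zero (hp : p.Convergent) (m n : Fin d) :
    Tendsto (fun s => scaledMatrix p x₀ x s (some (0, m)) (some (0, n))) (𝓝[>] 0)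
      (𝓝 (limitBlock p m n)) := by
  have h0 : Tendsto (fun s : ℝ => (s : ℂ) * x₀) (𝓝[>] 0) (𝓝 0) := by
    simpa using tendsto_ofReal_nhdsGT_zero.mul_const x₀
  have h := (h0.pow (extraOrder 0 n (some ((0 : Fin (N + 1)), m)))).mul
    ((tendsto_eulerIntegral_colZ_zero (x₀ := x₀) (x := x) hp (some (0, m)) n).const_mul
      (colSign (some ((0 : Fin (N + 1)), m)) (some (0, n))))
  refine h.congr' ?_
  filter_upwards [self_mem_nhdsWithin] with s hs
  have hs0 : (s : ℂ) ≠ 0 := Complex.ofReal_ne_zero.2 (ne_of_gt hs)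
  simp only [scaledMatrix, Matrix.of_apply, normalizedMatrix, holPart, rowScale, colScale, colPow,
    rowFactor, if_true, Fin.cons_zero]
  field_simp

theorem exists_tendsto_scaledMatrix_lift_zero (hp : p.Convergent) (r : Idx d N) (n : Fin d) :
    ∃ a, Tendsto (fun s => scaledMatrix p x₀ x s (liftIdx r) (some (0, n))) (𝓝[>] 0) (𝓝 a) := by
  have h0 : Tendsto (fun s : ℝ => (s : ℂ) * x₀) (𝓝[>] 0) (𝓝 0) := by
    simpa using tendsto_ofReal_nhdsGT_zero.mul_const x₀
  obtain ⟨e, he⟩ : ∃ e, extraOrder (0 : Fin (N + 1)) n (liftIdx r) = e + 1 := by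
    rcases r with _ | ⟨i, m⟩
    · exact ⟨0, rfl⟩
    · exact ⟨if m < n then 1 else 0, by simp [extraOrder, liftIdx, add_comm]⟩
  obtain ⟨f, hf⟩ : ∃ f : ℂ, ∀ y₀ : ℂ, rowFactor (liftIdx r) (some (0, n))
      (Fin.cons y₀ x : Fin (N + 1) → ℂ) = f := by
    rcases r with _ | ⟨i, m⟩
    · exact ⟨1, fun _ => rfl⟩
    · exact ⟨1 / x i, fun _ => by simp [rowFactor, liftIdx]⟩
  have h := (h0.pow e).mul ((tendsto_eulerIntegral_colZ_zero (x₀ := x₀) (x := x) hp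
    (liftIdx r) n).const_mul (x₀ * (f * colSign (liftIdx r) (some (0, n)))))
  refine ⟨_, h.congr' ?_⟩
  filter_upwards [self_mem_nhdsWithin] with s hs
  have hs0 : (s : ℂ) ≠ 0 := Complex.ofReal_ne_zero.2 (ne_of_gt hs)
  simp only [scaledMatrix, Matrix.of_apply, normalizedMatrix, holPart, rowScale_liftIdx, colScale,
    colPow, hf, he, if_true, Fin.cons_zero]
  field_simp
  ring

/-- The indices split into those of the first variable and the others. -/
def idxEquiv (d N : ℕ) : Fin d ⊕ Idx d N ≃ Idx d (N + 1) where
  toFun := Sum.elim (fun m => some (0, m)) liftIdx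
  invFun r := match r with
    | none => Sum.inr none
    | some (i, m) => Fin.cases (Sum.inl m) (fun k => Sum.inr (some (k, m))) i
  left_inv := by
    rintro (m | _ | ⟨i, m⟩) <;> simp [liftIdx]
  right_inv := by
    rintro (_ | ⟨i, m⟩)
    · rfl
    · refine Fin.cases ?_ (fun k => ?_) i <;> simp [liftIdx]

/-- In the confluent limit the matrix of periods becomes block triangular. Its diagonal blocks are a
triangular matrix of beta integrals, and the matrix of periods in the remaining variables. -/
theorem eventually_det_scaledMatrix_ne_zero (hp : p.Convergent)
    (hx : (Fin.cons x₀ x : Fin (N + 1) → ℂ) ∈ slitDomain (N + 1))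
    (hdet : (normalizedMatrix p.tail x).det ≠ 0) :
    ∀ᶠ s : ℝ in 𝓝[>] 0, (scaledMatrix p x₀ x s).det ≠ 0 := by
  have hx0 : x₀ ≠ 0 := by simpa using (hx 0).1
  choose Q hQ using fun r n => exists_tendsto_scaledMatrix_lift_zero (x₀ := x₀) (x := x) hp r n
  have hlim : Tendsto (fun s => (scaledMatrix p x₀ x s).submatrix (idxEquiv d N) (idxEquiv d N))
      (𝓝[>] 0) (𝓝 (Matrix.fromBlocks (limitBlock p) 0 (Matrix.of Q)
        (normalizedMatrix p.tail x * Matrix.diagonal (limitFactor p x₀ x)))) := by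
    refine tendsto_pi_nhds.2 fun a => tendsto_pi_nhds.2 fun b => ?_
    rcases a with m | r <;> rcases b with n | c
    · exact tendsto_scaledMatrix_zero_zero hp m n
    · exact tendsto_scaledMatrix_zero_lift hp hx m c
    · exact hQ r n
    · rw [Matrix.fromBlocks_apply₂₂, Matrix.mul_diagonal]
      exact tendsto_scaledMatrix_lift_lift hp hx r c
  have hdetlim := ((Continuous.matrix_det continuous_id).tendsto _).comp hlim
  simp only [Function.comp_def, id, Matrix.det_submatrix_equiv_self] at hdetlim
  refine hdetlim.eventually_ne ?_
  rw [Matrix.det_fromBlocks_zero₁₂, Matrix.det_mul, Matrix.det_diagonal]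
  refine mul_ne_zero (det_limitBlock_ne_zero hp) (mul_ne_zero hdet
    (Finset.prod_ne_zero_iff.2 fun c _ => ?_))
  rcases c with _ | ⟨j, n⟩
  · exact one_ne_zero
  · rw [limitFactor, Ne, Complex.cpow_eq_zero_iff, not_and_or]
    left
    have := (mem_slitDomain_of_cons hx j).1
    simp [hx0, this]

theorem scaledMatrix_eq (p : Params d (N + 1)) (x₀ : ℂ) (x : Fin N → ℂ) (s : ℝ) :
    scaledMatrix p x₀ x s = Matrix.diagonal (rowScale s) *
      normalizedMatrix p (Fin.cons (s * x₀) x) * Matrix.diagonal (colScale p s) := by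
  ext r c
  rw [Matrix.mul_diagonal, Matrix.diagonal_mul]
  rfl

theorem eventually_det_normalizedMatrix_ne_zero (hp : p.Convergent)
    (hx : (Fin.cons x₀ x : Fin (N + 1) → ℂ) ∈ slitDomain (N + 1))
    (hdet : (normalizedMatrix p.tail x).det ≠ 0) :
    ∀ᶠ s : ℝ in 𝓝[>] 0, (normalizedMatrix p (Fin.cons (s * x₀) x)).det ≠ 0 := by
  filter_upwards [eventually_det_scaledMatrix_ne_zero hp hx hdet] with s hs h0
  rw [scaledMatrix_eq, Matrix.det_mul, Matrix.det_mul, h0, mul_zero, zero_mul] at hs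
  exact hs rfl

end Confluence

/-! ### Non-degeneracy of the matrix of periods -/

section Nondegeneracy

variable {d N : ℕ} {p : Params d N}

theorem continuousOn_pfaffForm_path {x v : Fin N → ℂ} {S : Set ℝ}
    (h : ∀ s ∈ S, x + s • v ∈ slitDomain N) :
    ContinuousOn (fun s : ℝ => pfaffForm p (x + s • v) v) S := by
  have hy : ∀ i, ContinuousOn (fun s : ℝ => (x + s • v) i) S := fun i => by
    simp only [Pi.add_apply, Pi.smul_apply]
    fun_prop
  unfold pfaffForm
  refine ContinuousOn.add (continuousOn_finsetSum _ fun i _ => ContinuousOn.add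
    (ContinuousOn.smul (continuousOn_const.div (hy i) fun s hs => (h s hs i).1) continuousOn_const)
    (ContinuousOn.smul (continuousOn_const.div (continuousOn_const.sub (hy i)) fun s hs =>
      sub_ne_zero.2 (ne_one_of_mem_slitDomain (h s hs) i).symm) continuousOn_const))
    (continuousOn_finsetSum _ fun i _ => continuousOn_finsetSum _ fun j _ => ?_)
  by_cases hij : i < j
  · simp only [hij, if_true]
    exact ContinuousOn.smul (continuousOn_const.div ((hy i).sub (hy j)) fun s hs =>
      sub_ne_zero.2 (ne_of_mem_slitDomain (h s hs) hij.ne)) continuousOn_const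
  · simp only [hij, if_false]
    exact continuousOn_const

/-- A solution of the Pfaffian system that vanishes at the end of a segment vanishes at its
beginning. -/
theorem IsSolution.eq_zero_of_eq_zero {Ω : Set (Fin N → ℂ)} (hΩ : Ω ⊆ slitDomain N)
    {y : (Fin N → ℂ) → Idx d N → ℂ} (hy : IsSolution p Ω y) {x v : Fin N → ℂ} {a b : ℝ}
    (hab : a ≤ b) (h : ∀ s ∈ Icc a b, x + s • v ∈ Ω) (h0 : y (x + b • v) = 0) :
    y (x + a • v) = 0 := by
  -- matrices as bounded operators, so that a compactness argument gives the Lipschitz constant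
  set Φ : Matrix (Idx d N) (Idx d N) ℂ →ₗ[ℂ] (Idx d N → ℂ) →L[ℂ] (Idx d N → ℂ) :=
    LinearMap.toContinuousLinearMap.toLinearMap ∘ₗ Matrix.toLin'.toLinearMap with hΦ
  have hΦa : ∀ A u, Φ A u = A.mulVec u := fun A u => by simp [hΦ]
  have hA : ContinuousOn (fun s : ℝ => Φ (pfaffForm p (x + s • v) v)) (Icc a b) :=
    (LinearMap.continuous_of_finiteDimensional Φ).comp_continuousOn
      (continuousOn_pfaffForm_path fun s hs => hΩ (h s hs))
  obtain ⟨K, hK⟩ := isCompact_Icc.exists_bound_of_continuousOn hA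
  have hder : ∀ s ∈ Icc a b, HasDerivAt (fun s : ℝ => y (x + s • v))
      (Φ (pfaffForm p (x + s • v) v) (y (x + s • v))) s := fun s hs => by
    obtain ⟨h1, h2⟩ := hy _ (h s hs)
    have h3 : HasDerivAt (fun s : ℝ => x + s • v) v s := by
      simpa using ((hasDerivAt_id s).smul_const v).const_add x
    rw [hΦa, ← h2]
    exact (h1.hasFDerivAt.restrictScalars ℝ).comp_hasDerivAt s h3
  have hzero : ∀ s ∈ Icc a b, HasDerivAt (fun _ : ℝ => (0 : Idx d N → ℂ))
      (Φ (pfaffForm p (x + s • v) v) 0) s := fun s _ => by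
    rw [map_zero]
    exact hasDerivAt_const s _
  have key := ODE_solution_unique_of_mem_Icc_left (K := K.toNNReal) (a := a) (b := b)
    (v := fun s u => Φ (pfaffForm p (x + s • v) v) u) (s := fun _ => univ)
    (f := fun s => y (x + s • v)) (g := fun _ => 0)
    (fun s hs => LipschitzOnWith.of_dist_le_mul fun u _ u' _ => by
      rw [dist_eq_norm, dist_eq_norm, ← map_sub]
      refine (ContinuousLinearMap.le_opNorm _ _).trans ?_
      gcongr
      exact (hK s (Ioc_subset_Icc_self hs)).trans (Real.le_coe_toNNReal K))
    (fun s hs => (hder s hs).continuousAt.continuousWithinAt)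
    (fun s hs => (hder s (Ioc_subset_Icc_self hs)).hasDerivWithinAt) (fun _ _ => mem_univ _)
    continuousOn_const
    (fun s hs => (hzero s (Ioc_subset_Icc_self hs)).hasDerivWithinAt) (fun _ _ => mem_univ _) h0
  exact key (left_mem_Icc.2 hab)

/-- Logarithms of the coordinates in a neighbourhood of the rays through `x`. -/
theorem exists_isLogBranch {x : Fin N → ℂ} (hx : ∀ i, x i ≠ 0) :
    ∃ lam, IsLogBranch {y : Fin N → ℂ | ∀ i, y i / x i ∈ Complex.slitPlane} lam := by
  refine ⟨fun i y => Complex.log (x i) + Complex.log (y i / x i), fun i => ⟨?_, fun y hy => ?_⟩⟩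
  · exact continuousOn_const.add (ContinuousOn.clog (by fun_prop) fun y hy => hy i)
  · rw [Complex.exp_add, Complex.exp_log (hx i), Complex.exp_log (Complex.slitPlane_ne_zero (hy i)),
      mul_div_cancel₀ _ (hx i)]

theorem IsSolution.sum_smul {Ω : Set (Fin N → ℂ)} {y : Idx d N → (Fin N → ℂ) → Idx d N → ℂ}
    (hy : ∀ c, IsSolution p Ω (y c)) (u : Idx d N → ℂ) :
    IsSolution p Ω fun x r => ∑ c, y c x r * u c := by
  intro x hx
  have e : (fun x r => ∑ c, y c x r * u c) = fun x => ∑ c, u c • y c x := by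
    ext x r
    simp [mul_comm]
  have h : HasFDerivAt (fun x => ∑ c, u c • y c x) (∑ c, u c • fderiv ℂ (y c) x) x :=
    HasFDerivAt.fun_sum fun c _ => (hy c x hx).1.hasFDerivAt.const_smul (u c)
  rw [e]
  refine ⟨h.differentiableAt, fun v => ?_⟩
  rw [h.fderiv]
  simp only [sum_apply, smul_apply, (hy _ x hx).2 v]
  rw [Matrix.mulVec_sum]
  exact Finset.sum_congr rfl fun c _ => (Matrix.mulVec_smul _ _ _).symm

/-- Non-degeneracy at `(s x_0, x)` implies non-degeneracy at `(x_0, x)`. If a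
combination of the columns vanishes at one point, then it vanishes along the segment, being a
solution of a linear differential equation there. -/
theorem det_normalizedMatrix_ne_zero_of_cons {p : Params d (N + 1)} (hp : p.Convergent) {x₀ : ℂ}
    {x : Fin N → ℂ} (hx : (Fin.cons x₀ x : Fin (N + 1) → ℂ) ∈ slitDomain (N + 1)) {s : ℝ}
    (hs : 0 < s) (hs1 : s ≤ 1) (hdet : (normalizedMatrix p (Fin.cons (s * x₀) x)).det ≠ 0) :
    (normalizedMatrix p (Fin.cons x₀ x)).det ≠ 0 := by
  intro h0
  apply hdet
  set X : Fin (N + 1) → ℂ := Fin.cons x₀ x with hX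
  have hX0 : ∀ i, X i ≠ 0 := fun i => (hx i).1
  obtain ⟨lam, hlam⟩ := exists_isLogBranch hX0
  set Ω := slitDomain (N + 1) ∩ {y : Fin (N + 1) → ℂ | ∀ i, y i / X i ∈ Complex.slitPlane} with hΩ
  have hΩo : IsOpen Ω := by
    refine isOpen_slitDomain.inter ?_
    simp only [ofPred_forall]
    exact isOpen_iInter_of_finite fun i => Complex.isOpen_slitPlane.preimage (by fun_prop)
  have hlam' : IsLogBranch Ω lam := fun i =>
    ⟨(hlam i).1.mono inter_subset_right, fun y hy => (hlam i).2 y hy.2⟩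
  obtain ⟨u, hu, hu0⟩ := Matrix.exists_mulVec_eq_zero_iff.2 h0
  set u' : Idx d (N + 1) → ℂ := fun c => u c / colPrefactor p c (fun l => lam l X) with hu'
  have hY : ∀ y ∈ Ω, ∀ r, ∑ c, (∫ w in cube d, colKernel p r c y (fun l => lam l y) w) * u' c =
      (normalizedMatrix p y).mulVec (fun c => colPrefactor p c (fun l => lam l y) * u' c) r :=
    fun y hy r => by
      rw [Matrix.mulVec, dotProduct]
      refine Finset.sum_congr rfl fun c _ => ?_
      rw [integral_colKernel_eq r c fun l => (hlam' l).2 y hy]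
      ring
  have hsol := IsSolution.sum_smul (fun c => isSolution_integral_colKernel hp hΩo
    inter_subset_left hlam' c) u'
  have hpath : ∀ t : ℝ, (Fin.cons 0 x : Fin (N + 1) → ℂ) + t • (Fin.cons x₀ 0 : Fin (N + 1) → ℂ) =
      Fin.cons (t * x₀) x := fun t => by
    ext i
    refine Fin.cases ?_ (fun k => ?_) i <;> simp
  have hmem : ∀ t ∈ Icc s 1, (Fin.cons 0 x : Fin (N + 1) → ℂ) +
      t • (Fin.cons x₀ 0 : Fin (N + 1) → ℂ) ∈ Ω := fun t ht => by
    rw [hpath t]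
    have ht0 : 0 < t := hs.trans_le ht.1
    refine ⟨cons_ofReal_mul_mem_slitDomain hx ht0 ht.2, fun i => ?_⟩
    have h1 : (1 : ℂ) ∈ Complex.slitPlane := Complex.one_mem_slitPlane
    refine Fin.cases ?_ (fun k => ?_) i
    · have : x₀ ≠ 0 := by simpa [hX] using hX0 0
      simp only [hX, Fin.cons_zero]
      rw [mul_div_cancel_right₀ _ this]
      exact Complex.ofReal_mem_slitPlane.2 ht0
    · have : x k ≠ 0 := by simpa [hX] using hX0 k.succ
      simp only [hX, Fin.cons_succ]
      rw [div_self this]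
      exact h1
  have hXΩ : X ∈ Ω := by
    have := hmem 1 ⟨hs1, le_rfl⟩
    rwa [hpath 1, Complex.ofReal_one, one_mul] at this
  have hend := hsol.eq_zero_of_eq_zero inter_subset_left hs1 hmem (by
    rw [hpath 1, Complex.ofReal_one, one_mul]
    ext r
    rw [hY X hXΩ r]
    have e : (fun c => colPrefactor p c (fun l => lam l X) * u' c) = u := by
      ext c
      exact mul_div_cancel₀ _ (colPrefactor_ne_zero c _)
    rw [e, hu0])
  have hsΩ := hmem s ⟨le_rfl, hs1⟩
  rw [hpath s] at hend hsΩ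
  rw [← Matrix.exists_mulVec_eq_zero_iff]
  refine ⟨fun c => colPrefactor p c (fun l => lam l (Fin.cons (s * x₀) x)) * u' c, ?_, ?_⟩
  · obtain ⟨c, hc⟩ := Function.ne_iff.1 hu
    refine Function.ne_iff.2 ⟨c, mul_ne_zero (colPrefactor_ne_zero c _) (div_ne_zero hc
      (colPrefactor_ne_zero c _))⟩
  · ext r
    rw [← hY _ hsΩ r]
    exact congrFun hend r

/-- The matrix of periods is non-degenerate. -/
theorem det_normalizedMatrix_ne_zero (hp : p.Convergent) {x : Fin N → ℂ}
    (hx : x ∈ slitDomain N) : (normalizedMatrix p x).det ≠ 0 := by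
  induction N with
  | zero =>
    have : Subsingleton (Idx d 0) := ⟨by rintro (_ | ⟨i, _⟩) (_ | ⟨j, _⟩) <;>
      first | rfl | exact i.elim0 | exact j.elim0⟩
    rw [Matrix.det_eq_elem_of_subsingleton _ none]
    simpa [normalizedMatrix, colPow, holPart, rowFactor, colSign] using
      eulerIntegral_ne_zero_of_eq_zero (expA_re hp none none) (expB_re hp none none)
        (expC p none none) (colT none) (z := colZ (none : Idx d 0) x) (fun i => i.elim0)
  | succ N ih =>
    obtain ⟨x₀, x, rfl⟩ : ∃ x₀ x', x = Fin.cons x₀ x' :=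
      ⟨x 0, Fin.tail x, (Fin.cons_self_tail x).symm⟩
    have h := eventually_det_normalizedMatrix_ne_zero hp hx (ih hp.tail (mem_slitDomain_of_cons hx))
    obtain ⟨s, hs, hs0, hs1⟩ := (h.and (Ioo_mem_nhdsGT one_pos)).exists
    exact det_normalizedMatrix_ne_zero_of_cons hp hx hs0 hs1.le hs

end Nondegeneracy

/-! ### Local behaviour -/

section Local

variable {d N : ℕ} {p : Params d N}

theorem differentiableOn_holPart_none (hp : p.Convergent) (r : Idx d N) :
    DifferentiableOn ℂ (holPart p r none) (domain0 N) := by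
  have e : holPart p r none = fun x => colSign r none * eulerIntegral (expA p r none)
      (expB p r none) (expC p r none) (colT none) x := by
    ext x
    rcases r with _ | ⟨i, m⟩ <;> simp only [holPart, rowFactor, one_mul] <;> rfl
  rw [e]
  exact (differentiableOn_eulerIntegral (expA_re hp r none) (expB_re hp r none) _ _).const_mul _

theorem colSign_ne_zero (r c : Idx d N) : colSign r c ≠ 0 := by
  rcases r with _ | ⟨i, m⟩ <;> rcases c with _ | ⟨j, n⟩ <;> simp only [colSign]
  · exact one_ne_zero
  · exact one_ne_zero
  · exact neg_ne_zero.2 one_ne_zero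
  · split_ifs
    · exact neg_ne_zero.2 one_ne_zero
    · exact one_ne_zero

theorem holPart_ne_zero (hp : p.Convergent) {r c : Idx d N} {x : Fin N → ℂ}
    (hr : rowFactor r c x ≠ 0) (hz : ∀ i, colZ c x i = 0) : holPart p r c x ≠ 0 :=
  mul_ne_zero (mul_ne_zero hr (colSign_ne_zero r c))
    (eulerIntegral_ne_zero_of_eq_zero (expA_re hp r c) (expB_re hp r c) _ _ hz)

/-- In the columns `(j, n)` only the coordinates `x_i` with `i ≠ j` occur in denominators, so the
locus `x_j = 0` is included. -/
theorem differentiableOn_holPart_some (hp : p.Convergent) (r : Idx d N) (j : Fin N) (n : Fin d) :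
    DifferentiableOn ℂ (holPart p r (some (j, n))) (domainAt j) := by
  have h1 : DifferentiableOn ℂ (rowFactor r (some (j, n))) (domainAt j) := by
    rcases r with _ | ⟨i, m⟩
    · exact differentiableOn_const 1
    · unfold rowFactor
      by_cases h : i = j
      · simp only [h, if_true]
        exact differentiableOn_const 1
      · simp only [h, if_false]
        simp only [one_div]
        exact DifferentiableOn.fun_inv (by fun_prop) fun x hx => ne_zero_of_mem_domainAt hx h
  have h2 : DifferentiableOn ℂ (colZ (some (j, n)) : (Fin N → ℂ) → Fin N → ℂ) (domainAt j) := by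
    refine differentiableOn_pi.2 fun i => ?_
    by_cases h : i = j
    · simp only [colZ, h, if_true]
      fun_prop
    · simp only [colZ, h, if_false]
      simp only [div_eq_mul_inv]
      exact DifferentiableOn.fun_mul (by fun_prop)
        (DifferentiableOn.fun_inv (by fun_prop) fun x hx => ne_zero_of_mem_domainAt hx h)
  exact (h1.mul_const _).mul ((differentiableOn_eulerIntegral (expA_re hp r _) (expB_re hp r _) _
    _).comp h2 fun x hx => colZ_mem_domain0 (c := some (j, n)) hx)

theorem IsSolution.congr_const_mul {Ω : Set (Fin N → ℂ)} (hΩ : IsOpen Ω)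
    {y z : (Fin N → ℂ) → Idx d N → ℂ} (hy : IsSolution p Ω y) (K : ℂ)
    (h : ∀ x ∈ Ω, z x = K • y x) : IsSolution p Ω z := by
  intro x hx
  have h1 := ((hy x hx).1.hasFDerivAt.const_smul K).congr_of_eventuallyEq
    (f₁ := z) (Filter.eventuallyEq_of_mem (hΩ.mem_nhds hx) h)
  refine ⟨h1.differentiableAt, fun v => ?_⟩
  rw [h1.fderiv, smul_apply, (hy x hx).2, h x hx, Matrix.mulVec_smul]

end Local

end HGPfaff

theorem theorem4p1 (d N : ℕ) (hd : 1 ≤ d) (hN : 1 ≤ N) (p : Params d N) (hp : p.Convergent)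
    (Ω : Set (Fin N → ℂ)) (hΩ_open : IsOpen Ω) (hΩ_conn : IsConnected Ω)
    (hΩ : Ω ⊆ slitDomain N)
    (W : Idx d N → (Fin N → ℂ) → (Fin d → ℝ) → ℂ) (hW : ∀ c, IsBranchOfU p Ω c (W c))
    (lam : Fin N → (Fin N → ℂ) → ℂ) (hlam : IsLogBranch Ω lam) :
    (∀ x ∈ Ω, ∀ r c, MeasureTheory.IntegrableOn (integrand (W c) r c x) (simplex d)) ∧
    IsFundamentalSystem p Ω (periodMatrix W) ∧
    HasLocalBehaviour p Ω lam (periodMatrix W) := by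
  choose K hK0 hK using fun c => exists_periods_eq hp hΩ_conn.isPreconnected hΩ hlam (hW c)
  have hY : ∀ x ∈ Ω, ∀ r c, periodMatrix W x r c =
      K c * (colPrefactor p c (fun l => lam l x) * (colPow r c x * holPart p r c x)) :=
    fun x hx r c => by
      rw [periodMatrix, Matrix.of_apply, (hK c x hx r).2,
        integral_colKernel_eq r c fun l => (hlam l).2 x hx]
      rfl
  refine ⟨fun x hx r c => (hK c x hx r).1, ⟨fun c => ?_, fun x hx => ?_⟩, ?_, fun j n => ?_⟩
  · refine (isSolution_integral_colKernel hp hΩ_open hΩ hlam c).congr_const_mul hΩ_open (K c)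
      fun x hx => ?_
    ext r
    exact (hK c x hx r).2
  · have e : periodMatrix W x = normalizedMatrix p x *
        Matrix.diagonal fun c => K c * colPrefactor p c fun l => lam l x := by
      ext r c
      rw [Matrix.mul_diagonal, hY x hx r c, normalizedMatrix, Matrix.of_apply]
      ring
    rw [e, Matrix.det_mul, Matrix.det_diagonal]
    exact mul_ne_zero (det_normalizedMatrix_ne_zero hp (hΩ hx)) (Finset.prod_ne_zero_iff.2
      fun c _ => mul_ne_zero (hK0 c) (colPrefactor_ne_zero c _))
  · refine ⟨fun x r => K none * holPart p r none x,
      differentiableOn_pi.2 fun r => (differentiableOn_holPart_none hp r).const_mul _,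
      fun r => mul_ne_zero (hK0 none) (holPart_ne_zero hp ?_ fun _ => rfl), fun x hx r => ?_⟩
    · rcases r with _ | ⟨i, m⟩ <;> exact one_ne_zero
    · rw [hY x hx r none]
      simp only [colPrefactor, colPow, one_mul]
  · refine ⟨fun x r => K (some (j, n)) * holPart p r (some (j, n)) x,
      differentiableOn_pi.2 fun r => (differentiableOn_holPart_some hp r j n).const_mul _,
      fun x hx r => ?_, fun m _ => ⟨fun i => if i = j then 0 else 1, ⟨?_, fun i hi => ?_⟩,
        if_pos rfl, mul_ne_zero (hK0 _) (holPart_ne_zero hp ?_ fun i => ?_)⟩⟩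
    · rw [hY x hx r (some (j, n))]
      simp only [colPrefactor, colPow]
      ring
    · simp
    · simp [hi]
    · simp [rowFactor]
    · by_cases hi : i = j <;> simp [colZ, hi]
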